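/- Let $q$ be a prime power and let $n,m,\ell\ge 1$ be integers with $\ell\mid n$. Put $\mu=\min\{n/\ell,m\}$ and let $\zeta,t,s$ be integers with $\mu\le\zeta$ and $0\le t\le s\le\ell\mu$. For $t',\ell',\mu'\ge 0$ let $\mathcal T_{t',\ell',\mu'}=\{v\in\{0,\dots,\mu'\}^{\ell'}:\sum_i v_i=t'\}$, let $\mathcal T^{\mathrm{ord}}_{t',\ell',\mu'}$ be the set of its members with $v_1\ge\dots\ge v_{\ell'}$, and let $\delta_i(v)=|\{j:v_j=i\}|$. Let $\binom{a}{b}_q$ denote the Gaussian binomial. For a vector $v$ with entries in $\{0,\dots,\zeta\}$ and $\sum_i v_i\le s'$, let $\mathsf{scomp}_\zeta(v,s')$ be the output of the following randomized procedure: start with $w=v$ and perform $s'-\sum_i v_i$ rounds; in each round, among the positions $i$ with $w_i\neq\zeta$ take those with the largest $v_i$, among these take those with the smallest $w_i$, choose one of these at random, and increase $w_i$ by one. For vectors $w,v$ of length $\ell$ let $\varrho_{q,\zeta}(w,v)=\prod_{i=1}^{\ell}\binom{w_i}{v_i}_q\big/\binom{\zeta}{v_i}_q$, and let $$\varrho_{q,\zeta,s}(v)=\varrho_{q,\zeta}(\mathsf{scomp}_\zeta(v,s),v),\qquad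 Q=\sum_{v\in\mathcal T_{t,\ell,\mu}}\varrho_{q,\zeta,s}(v)^{-1},\qquad \omega(v)=\frac{\ell!}{\prod_{i=0}^{\mu}\delta_i(v)!}\,\varrho_{q,\zeta,s}(v)^{-1}.$$ Let $\iota=\ell!\,\bigl(\prod_{t'=0}^{\mu}\prod_{s'=t'}^{\zeta}\binom{s'}{t'}_q\bigr)^{\ell}$. For integers $t',\ell',\mu',s'\ge0$ let $$\mathsf M(t',\ell',\mu',s')=\sum_{v\in\mathcal T^{\mathrm{ord}}_{t',\ell',\mu'}}\Bigl(\prod_{i=0}^{\mu'}\delta_i(v)!\Bigr)^{-1}\prod_{i=1}^{\ell'}\binom{\zeta}{v_i}_q\Big/\binom{\mathsf{scomp}_\zeta(v,s')_i}{v_i}_q$$ if $\ell'\ge1$, $t'\le\min\{s',\ell'\mu'\}$ and $s'\le\ell'\zeta$; let $\mathsf M(t',\ell',\mu',s')=1$ if $\ell'=t'=s'=0$, and $\mathsf M(t',\ell',\mu',s')=0$ otherwise. **Drawing algorithm.** The input consists of $q,\zeta,t,s,\ell,\mu$ and the precomputed table of the integers $\iota\,\mathsf M(t',\ell',\mu',s')$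 for $0\le t'\le t$, $0\le\ell'\le\ell$, $0\le\mu'\le\mu$, $0\le s'\le s$. 1. Draw $X$ uniformly at random from the non-negative integers $<\iota Q$ and set $x\gets X/\iota$. 2. For $i=1,\dots,\ell$: with $S(c)=\sum_{t'=0}^{c-1}\sum_{\tilde v}\omega(\tilde v)$, where $\tilde v$ runs over the elements of $\mathcal T^{\mathrm{ord}}_{t,\ell,\mu}$ that begin with $t_1,\dots,t_{i-1},t'$, set $t_i\gets\max\{c\in\{0,\dots,\mu\}:S(c)\le x\}$ and then $x\gets x-S(t_i)$. 3. Return a uniformly random element of the set of distinct rearrangements of $(t_1,\dots,t_\ell)$. **Proposition.** (a) For every $v\in\mathcal T_{t,\ell,\mu}$ the value $\varrho_{q,\zeta}(\mathsf{scomp}_\zeta(v,s),v)$ does not depend on the random choices made in $\mathsf{scomp}_\zeta$, and the vector returned by the drawing algorithm is distributed exactly according to $p_v=\varrho_{q,\zeta,s}(v)^{-1}/Q$ on $\mathcal T_{t,\ell,\mu}$. (b) The drawing algorithm, given its input including the precomputed table, can be carried out in $O^\sim(n^3\zeta^2\log_2 q)$ bit operations. That is, there are a single program, independent of all parameters, and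 absolute constants $C,k$ such that for all admissible parameters the program halts for every outcome of its random draws, the joint distribution of the drawn integer $X$, the sorted vector $(t_1,\dots,t_\ell)$ and the returned vector is that of the drawing algorithm, and the number of bit operations is always at most $C\,f\,(\log_2(f+2))^k$, where $f=n^3\zeta^2\log_2 q$. Here programs are run on a random-access machine with registers and arrays of non-negative integers. Each step is charged $1$ plus the bit lengths of the integers (operands and array addresses) that it handles, except that a multiplication, division or remainder of operands of total bit length $L$ is charged $1+L(1+\lfloor\log_2 L\rfloor)$; drawing a uniformly random non-negative integer smaller than a given $N$ is one step, with operand $N$. -/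

import Mathlib

open scoped Nat

/-! ### Gaussian binomials, weight decompositions, the map `scomp` -/

/-- The Gaussian binomial `[a choose b]_q`, i.e. the number of `b`-dimensional subspaces of
`𝔽_q ^ a`, by the `q`-Pascal recursion. -/
def gaussBinom (q : ℕ) : ℕ → ℕ → ℕ
  | _, 0 => 1
  | 0, _ + 1 => 0
  | a + 1, b + 1 => gaussBinom q a b + q ^ (b + 1) * gaussBinom q a (b + 1)

/-- The product formula `[a choose b]_q = ∏_{i<b} (q^(a-i) - 1) / (q^(i+1) - 1)`. -/
theorem gaussBinom_mul_prod (q a b : ℕ) :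
    (gaussBinom q a b : ℤ) * ∏ i ∈ Finset.range b, ((q : ℤ) ^ (i + 1) - 1)
      = ∏ i ∈ Finset.range b, ((q : ℤ) ^ (a - i) - 1) := by
  induction a generalizing b with
  | zero =>
    cases b with
    | zero => simp [gaussBinom]
    | succ b => simp [gaussBinom]
  | succ a ih =>
    cases b with
    | zero => simp [gaussBinom]
    | succ b =>
      have h1 := ih b
      have h2 := ih (b + 1)
      rw [Finset.prod_range_succ, Finset.prod_range_succ] at h2
      rw [Finset.prod_range_succ, Finset.prod_range_succ']
      simp only [gaussBinom, Nat.add_sub_add_right, Nat.sub_zero]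
      push_cast
      rcases le_or_gt b a with hba | hba
      · have hp : (q : ℤ) ^ (b + 1) * (q : ℤ) ^ (a - b) = (q : ℤ) ^ (a + 1) := by
          rw [← pow_add]; congr 1; omega
        rw [← h1] at h2 ⊢
        linear_combination (q : ℤ) ^ (b + 1) * h2
          + (gaussBinom q a b : ℤ) * (∏ i ∈ Finset.range b, ((q : ℤ) ^ (i + 1) - 1)) * hp
      · have h0 : ∏ i ∈ Finset.range b, ((q : ℤ) ^ (a - i) - 1) = 0 :=
          Finset.prod_eq_zero (Finset.mem_range.2 hba) (by simp)
        rw [h0] at h1 h2 ⊢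
        linear_combination ((q : ℤ) ^ (b + 1) - 1) * h1 + (q : ℤ) ^ (b + 1) * h2

/-- The weight decompositions `𝒯_{t,ℓ,μ}`: vectors in `{0,…,μ}^ℓ` with sum `t`. -/
def decomps (t ℓ μ : ℕ) : Finset (Fin ℓ → ℕ) :=
  (Fintype.piFinset fun _ => Finset.range (μ + 1)).filter fun v => ∑ i, v i = t

/-- The sorted weight decompositions, `t₁ ≥ t₂ ≥ … ≥ t_ℓ`. -/
def sortedDecomps (t ℓ μ : ℕ) : Finset (Fin ℓ → ℕ) :=
  (decomps t ℓ μ).filter fun v => ∀ i j : Fin ℓ, i ≤ j → v j ≤ v i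

/-- `δ_i(v)`: the number of entries of `v` equal to `i`. -/
def mult {ℓ : ℕ} (v : Fin ℓ → ℕ) (i : ℕ) : ℕ := (Finset.univ.filter fun j => v j = i).card

/-- Positions of the vector `u` that are not yet full. -/
def scompJ1 (ζ : ℕ) {ℓ : ℕ} (u : Fin ℓ → ℕ) : Finset (Fin ℓ) :=
  Finset.univ.filter fun i => u i ≠ ζ

/-- Among these, the positions with the largest entry of `v`. -/
def scompJ2 (ζ : ℕ) {ℓ : ℕ} (v u : Fin ℓ → ℕ) : Finset (Fin ℓ) :=
  (scompJ1 ζ u).filter fun i => ∀ j ∈ scompJ1 ζ u, v j ≤ v i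

/-- Among these, the positions with the smallest entry of `u`. -/
def scompJ3 (ζ : ℕ) {ℓ : ℕ} (v u : Fin ℓ → ℕ) : Finset (Fin ℓ) :=
  (scompJ2 ζ v u).filter fun i => ∀ j ∈ scompJ2 ζ v u, u i ≤ u j

/-- `w` is a possible value, after `d` rounds, of the randomized greedy procedure that starts
with `v` and in each round increases by one an arbitrary position of `scompJ3`. -/
def ScompReach (ζ : ℕ) {ℓ : ℕ} (v : Fin ℓ → ℕ) : ℕ → (Fin ℓ → ℕ) → Prop
  | 0, w => w = v
  | d + 1, w => ∃ u, ScompReach ζ v d u ∧ ∃ h ∈ scompJ3 ζ v u, w = Function.update u h (u h + 1)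

/-- `w` is a possible output of the randomized map `scomp_ζ` on input `(v, s)`. -/
def IsScompOutput (ζ : ℕ) {ℓ : ℕ} (v : Fin ℓ → ℕ) (s : ℕ) (w : Fin ℓ → ℕ) : Prop :=
  ScompReach ζ v (s - ∑ i, v i) w

/-- One round of the greedy procedure, with the first admissible position chosen. -/
def scompStep (ζ : ℕ) {ℓ : ℕ} (v u : Fin ℓ → ℕ) : Fin ℓ → ℕ :=
  if h : (scompJ3 ζ v u).Nonempty then
    Function.update u ((scompJ3 ζ v u).min' h) (u ((scompJ3 ζ v u).min' h) + 1)
  else u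

/-- The output of `scomp_ζ(v, s)` in which every random choice takes the first admissible
position. -/
def scomp (ζ : ℕ) {ℓ : ℕ} (v : Fin ℓ → ℕ) (s : ℕ) : Fin ℓ → ℕ :=
  (scompStep ζ v)^[s - ∑ i, v i] v

/-- `ϱ_{q,ζ}(w, v) = ∏ᵢ [wᵢ choose vᵢ]_q / [ζ choose vᵢ]_q`. -/
def rho (q ζ : ℕ) {ℓ : ℕ} (w v : Fin ℓ → ℕ) : ℚ :=
  ∏ i, (gaussBinom q (w i) (v i) : ℚ) / (gaussBinom q ζ (v i) : ℚ)

/-- `ϱ_{q,ζ,s}(v) = ϱ_{q,ζ}(scomp_ζ(v, s), v)`. -/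
def rhoS (q ζ s : ℕ) {ℓ : ℕ} (v : Fin ℓ → ℕ) : ℚ := rho q ζ (scomp ζ v s) v

/-- The quantities `M(t', ℓ', μ', s')` held by the precomputed table. -/
def tableM (q ζ t' ℓ' μ' s' : ℕ) : ℚ :=
  if 1 ≤ ℓ' ∧ t' ≤ min s' (ℓ' * μ') ∧ s' ≤ ℓ' * ζ then
    ∑ v ∈ sortedDecomps t' ℓ' μ',
      (∏ i ∈ Finset.range (μ' + 1), ((mult v i)! : ℚ))⁻¹ *
        ∏ i, (gaussBinom q ζ (v i) : ℚ) / (gaussBinom q (scomp ζ v s' i) (v i) : ℚ)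
  else if ℓ' = 0 ∧ t' = 0 ∧ s' = 0 then 1
  else 0

/-! ### The drawing algorithm -/

/-- The parameters of the drawing algorithm. -/
structure Params where
  q : ℕ
  ζ : ℕ
  t : ℕ
  s : ℕ
  ℓ : ℕ
  μ : ℕ

namespace Params

variable (P : Params)

/-- `Q = ∑_{v ∈ 𝒯_{t,ℓ,μ}} ϱ_{q,ζ,s}(v)⁻¹`. -/
def Q : ℚ := ∑ v ∈ decomps P.t P.ℓ P.μ, (rhoS P.q P.ζ P.s v)⁻¹

/-- The target distribution `p_v = ϱ_{q,ζ,s}(v)⁻¹ / Q` on `𝒯_{t,ℓ,μ}`. -/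
def target (v : Fin P.ℓ → ℕ) : ℚ :=
  if v ∈ decomps P.t P.ℓ P.μ then (rhoS P.q P.ζ P.s v)⁻¹ / P.Q else 0

/-- `ι = ℓ! (∏_{t'=0}^{μ} ∏_{s'=t'}^{ζ} [s' choose t']_q)^ℓ`. -/
def iota : ℕ :=
  P.ℓ ! * (∏ t' ∈ Finset.range (P.μ + 1), ∏ s' ∈ Finset.Icc t' P.ζ, gaussBinom P.q s' t') ^ P.ℓ

/-- `(ℓ! / ∏ᵢ δᵢ(v)!) ϱ_{q,ζ,s}(v)⁻¹`. -/
def weight (v : Fin P.ℓ → ℕ) : ℚ :=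
  (P.ℓ ! : ℚ) / (∏ i ∈ Finset.range (P.μ + 1), ((mult v i)! : ℚ)) * (rhoS P.q P.ζ P.s v)⁻¹

/-- The total weight of the sorted decompositions that begin with the list `pre`. -/
def prefixSum (pre : List ℕ) : ℚ :=
  ∑ v ∈ (sortedDecomps P.t P.ℓ P.μ).filter fun v => (List.ofFn v).take pre.length = pre, P.weight v

/-- The total weight of the sorted decompositions that begin with `pre` followed by some
entry `< c`. -/
def cumul (pre : List ℕ) (c : ℕ) : ℚ := ∑ t' ∈ Finset.range c, P.prefixSum (pre ++ [t'])

/-- The main loop: `k` further entries are appended to the entries `pre` found so far, `x`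
being the current value of the variable `x`. -/
def decodeLoop : ℕ → List ℕ → ℚ → List ℕ
  | 0, pre, _ => pre
  | k + 1, pre, x =>
      let ti := Nat.findGreatest (fun c => P.cumul pre c ≤ x) P.μ
      decodeLoop k (pre ++ [ti]) (x - P.cumul pre ti)

/-- The sorted vector found by the main loop when the integer `X` was drawn, so `x = X / ι`. -/
def decode (X : ℕ) : Fin P.ℓ → ℕ :=
  fun i => (P.decodeLoop P.ℓ [] ((X : ℚ) / (P.iota : ℚ))).getD i 0

end Params

/-- The uniform distribution on `{0,…,N-1}` (on `{0}` if `N = 0`). -/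
noncomputable def unifBelow (N : ℕ) : PMF ℕ :=
  PMF.uniformOfFinset (Finset.range (max N 1)) ⟨0, by simp⟩

/-- The distinct rearrangements of a vector. -/
def rearrangements {ℓ : ℕ} (v : Fin ℓ → ℕ) : Finset (Fin ℓ → ℕ) :=
  Finset.univ.image fun σ : Equiv.Perm (Fin ℓ) => v ∘ σ

theorem rearrangements_nonempty {ℓ : ℕ} (v : Fin ℓ → ℕ) : (rearrangements v).Nonempty :=
  Finset.univ_nonempty.image _

namespace Params

variable (P : Params)

/-- The joint law of one run of the drawing algorithm: the integer `X` drawn uniformly from the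
non-negative integers `< ι Q`, the sorted vector computed from it, and the returned vector, a
uniformly random rearrangement of the sorted one. -/
noncomputable def drawRun : PMF (ℕ × (Fin P.ℓ → ℕ) × (Fin P.ℓ → ℕ)) :=
  (unifBelow ⌈(P.iota : ℚ) * P.Q⌉₊).bind fun X =>
    (PMF.uniformOfFinset (rearrangements (P.decode X)) (rearrangements_nonempty _)).map
      fun v => (X, P.decode X, v)

/-- The law of the returned vector. -/
noncomputable def draw : PMF (Fin P.ℓ → ℕ) := P.drawRun.map fun r => r.2.2

end Params

/-! ### Random-access machines with bit costs

The machine has registers and finitely many arrays (those that the program mentions) of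
non-negative integers of arbitrary size. -/

/-- The memory of the machine: register contents and array contents. -/
structure Store where
  reg : ℕ → ℕ
  arr : ℕ → ℕ → ℕ

/-- Register assignment. -/
def Store.setReg (σ : Store) (d x : ℕ) : Store := ⟨Function.update σ.reg d x, σ.arr⟩

/-- Array assignment. -/
def Store.setArr (σ : Store) (A i x : ℕ) : Store :=
  ⟨σ.reg, Function.update σ.arr A (Function.update (σ.arr A) i x)⟩

/-- The instructions; `d, a, b` name registers, `A` names an array. -/
inductive Instr where
  | const (d c : ℕ)
  | copy (d a : ℕ)
  | add (d a b : ℕ)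
  | sub (d a b : ℕ)
  | mul (d a b : ℕ)
  | div (d a b : ℕ)
  | mod (d a b : ℕ)
  | load (d A a : ℕ)
  | store (A a b : ℕ)
  | rand (d a : ℕ)

/-- Effect of an instruction: `load d A a` is `d := A[a]`, `store A a b` is `A[a] := b`, and
`rand d a` puts into `d` a uniformly random non-negative integer smaller than the content
of `a`. -/
noncomputable def Instr.eval (σ : Store) : Instr → PMF Store
  | .const d c => PMF.pure (σ.setReg d c)
  | .copy d a => PMF.pure (σ.setReg d (σ.reg a))
  | .add d a b => PMF.pure (σ.setReg d (σ.reg a + σ.reg b))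
  | .sub d a b => PMF.pure (σ.setReg d (σ.reg a - σ.reg b))
  | .mul d a b => PMF.pure (σ.setReg d (σ.reg a * σ.reg b))
  | .div d a b => PMF.pure (σ.setReg d (σ.reg a / σ.reg b))
  | .mod d a b => PMF.pure (σ.setReg d (σ.reg a % σ.reg b))
  | .load d A a => PMF.pure (σ.setReg d (σ.arr A (σ.reg a)))
  | .store A a b => PMF.pure (σ.setArr A (σ.reg a) (σ.reg b))
  | .rand d a => (unifBelow (σ.reg a)).map fun x => σ.setReg d x

/-- The cost charged for multiplication and division of integers of total bit length `L`. -/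
def quasiLinear (L : ℕ) : ℕ := L * (Nat.log 2 L + 1)

/-- The bit cost of an instruction. Every instruction is charged the bit lengths of all integers
(contents and array addresses) that it handles, multiplication and division quasi-linearly
in these. -/
def Instr.cost (σ : Store) : Instr → ℕ
  | .const _ c => 1 + c.size
  | .copy _ a => 1 + (σ.reg a).size
  | .add _ a b => 1 + (σ.reg a).size + (σ.reg b).size
  | .sub _ a b => 1 + (σ.reg a).size + (σ.reg b).size
  | .mul _ a b => 1 + quasiLinear ((σ.reg a).size + (σ.reg b).size)
  | .div _ a b => 1 + quasiLinear ((σ.reg a).size + (σ.reg b).size)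
  | .mod _ a b => 1 + quasiLinear ((σ.reg a).size + (σ.reg b).size)
  | .load _ A a => 1 + (σ.reg a).size + (σ.arr A (σ.reg a)).size
  | .store _ a b => 1 + (σ.reg a).size + (σ.reg b).size
  | .rand _ a => 1 + (σ.reg a).size

/-- Programs; the conditions of `ite` and `loop` are that register `a` is nonzero. -/
inductive Program where
  | instr (i : Instr)
  | seq (c d : Program)
  | ite (a : ℕ) (c d : Program)
  | loop (a : ℕ) (c : Program)

/-- `Runs c σ D`: started in the store `σ`, the program `c` halts for all outcomes of its random
draws, and `D` is the joint law of the final store and of the number of bit operations. -/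
inductive Runs : Program → Store → PMF (Store × ℕ) → Prop where
  | instr (i : Instr) (σ : Store) :
      Runs (.instr i) σ ((i.eval σ).map fun τ => (τ, i.cost σ))
  | seq {c d : Program} {σ : Store} {D : PMF (Store × ℕ)} {E : Store × ℕ → PMF (Store × ℕ)}
      (hc : Runs c σ D) (hd : ∀ r ∈ D.support, Runs d r.1 (E r)) :
      Runs (.seq c d) σ (D.bind fun r => (E r).map fun r' => (r'.1, r.2 + r'.2))
  | ite_true {a : ℕ} {c d : Program} {σ : Store} {D : PMF (Store × ℕ)}
      (ha : σ.reg a ≠ 0) (hc : Runs c σ D) :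
      Runs (.ite a c d) σ (D.map fun r => (r.1, 1 + (σ.reg a).size + r.2))
  | ite_false {a : ℕ} {c d : Program} {σ : Store} {D : PMF (Store × ℕ)}
      (ha : σ.reg a = 0) (hd : Runs d σ D) :
      Runs (.ite a c d) σ (D.map fun r => (r.1, 1 + r.2))
  | loop_done {a : ℕ} {c : Program} {σ : Store} (ha : σ.reg a = 0) :
      Runs (.loop a c) σ (PMF.pure (σ, 1))
  | loop_step {a : ℕ} {c : Program} {σ : Store} {D : PMF (Store × ℕ)}
      (ha : σ.reg a ≠ 0) (h : Runs (.seq c (.loop a c)) σ D) :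
      Runs (.loop a c) σ (D.map fun r => (r.1, 1 + (σ.reg a).size + r.2))

namespace Params

variable (P : Params)

/-- Array representation of the precomputed table. The entry `M(t', ℓ', μ', s')`, for `t' ≤ t`,
`ℓ' ≤ ℓ`, `μ' ≤ μ`, `s' ≤ s`, is held in the cell
`((t' (ℓ+1) + ℓ') (μ+1) + μ') (s+1) + s'`, as the integer `ι M(t', ℓ', μ', s')`. -/
def tableCell (j : ℕ) : ℕ :=
  let s' := j % (P.s + 1)
  let μ' := j / (P.s + 1) % (P.μ + 1)
  let ℓ' := j / (P.s + 1) / (P.μ + 1) % (P.ℓ + 1)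
  let t' := j / (P.s + 1) / (P.μ + 1) / (P.ℓ + 1)
  if t' ≤ P.t then ⌊(P.iota : ℚ) * tableM P.q P.ζ t' ℓ' μ' s'⌋₊ else 0

/-- The initial store: the parameters `q, ζ, t, s, ℓ, μ` in the registers `0,…,5`, the precomputed
table in array `0`, and zeros elsewhere. -/
def input : Store where
  reg := fun i => [P.q, P.ζ, P.t, P.s, P.ℓ, P.μ].getD i 0
  arr := fun A j => if A = 0 then P.tableCell j else 0

/-- What is read off the final store: the drawn integer `X` in register `0`, the sorted vector in
the first `ℓ` cells of array `1`, the returned vector in the first `ℓ` cells of array `2`. -/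
def output (σ : Store) : ℕ × (Fin P.ℓ → ℕ) × (Fin P.ℓ → ℕ) :=
  (σ.reg 0, fun i => σ.arr 1 i, fun i => σ.arr 2 i)

end Params

/-! ### Gaussian binomials -/

/-! Everything rests on a closed form for the values `ϱ`. The greedy procedure preserves the
invariants `IsFill`. By priority, the mass that a filling `w` puts on a level set `{v = a}` depends
only on the size of that set, on the surplus and on the capacity of the higher levels
(`IsFill.sum_level`). By balance, this mass is spread as evenly as possible (`prod_of_balanced`).
Hence `∏ [wᵢ choose vᵢ] · ∏ δᵢ(v)!` equals `listDen`, which sees only the entries of `v` and the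
surplus. This gives independence of the random choices and invariance under permutations.

The closed form is multiplicative: if all entries of a prefix exceed those of the tail, the tail
only feels the surplus left over by the prefix (`listDen_append`). So for `c` below all entries
found so far, the cumulated weight `S(c + 1)` is an explicit factor of the prefix times the table
entry with `μ' = c` (`cumul_eq`). The next entry is at most the last one, `a`, so only `S(1), …,
S(a)` are needed to find it (`IsBlock.nextEntry_eq`), and these are exactly the sums that the table
provides.

For the law, `ω(u)` is the number of rearrangements of `u` times `ϱ⁻¹`, and `ι` clears all
denominators (`listDen_dvd_iota`). The main loop therefore inverts a cumulative distribution on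
integers, and exactly `ι ω(u)` draws lead to the sorted vector `u` (`card_iterate_decodeStep`). The
final rearrangement spreads this mass evenly over the orbit of `u`.

In the program the rearrangement comes from one number below `ℓ!`, whose factorial digits encode a
permutation (`shuffle_injective`). Each of the `ℓ` rounds recomputes the factor of the current block
of equal entries in `O(ℓ)` operations and inspects `O(μ)` table entries. The integers have `O(ℓ μ²
ζ² log q log ℓ)` bits, dominated by `ι`; with `O(ℓ² μ)` operations and `ℓ μ ≤ n` this gives `n³ ζ²
log q` up to logarithms. The Gaussian binomials take `O(ζ μ)` operations, which at this word size
would be cubic in `ζ`; they are computed first and charged at a smaller word size. -/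

theorem gaussBinom_pos (q : ℕ) : ∀ {a b : ℕ}, b ≤ a → 0 < gaussBinom q a b
  | a, 0, _ => by cases a <;> simp [gaussBinom]
  | 0, b + 1, h => by omega
  | a + 1, b + 1, h => by
    have := gaussBinom_pos q (a := a) (b := b) (by omega)
    simp only [gaussBinom]; omega

/-- In the Pascal recursion both summands are at most `q ^ (b + 1) * q ^ (a * (b + 2))`, and `2 ≤ q`
absorbs the sum. The bound is crude, but only the order of magnitude of its bit length enters the
running time. -/
theorem gaussBinom_le_pow {q : ℕ} (hq : 2 ≤ q) : ∀ a b : ℕ, gaussBinom q a b ≤ q ^ (a * (b + 1))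
  | a, 0 => by
    have : gaussBinom q a 0 = 1 := by cases a <;> simp [gaussBinom]
    rw [this]; exact Nat.one_le_pow _ _ (by omega)
  | 0, b + 1 => by simp [gaussBinom]
  | a + 1, b + 1 => by
    have h1 := gaussBinom_le_pow hq a b
    have h2 := gaussBinom_le_pow hq a (b + 1)
    have h3 : q ^ (a * (b + 1)) ≤ q ^ (b + 1) * q ^ (a * (b + 1 + 1)) := by
      rw [← pow_add]; exact Nat.pow_le_pow_right (by omega) (by nlinarith)
    have h4 : q ^ ((a + 1) * (b + 1 + 1)) = q * (q ^ (b + 1) * q ^ (a * (b + 1 + 1))) := by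
      rw [← pow_add, ← pow_succ']; congr 1; ring
    have h5 := Nat.mul_le_mul_left (q ^ (b + 1)) h2
    have h6 := Nat.mul_le_mul_right (q ^ (b + 1) * q ^ (a * (b + 1 + 1))) hq
    rw [h4]
    simp only [gaussBinom]
    omega

/-! ### The fillings produced by `scomp` -/

/-- The invariants of the greedy procedure `scomp`: `w` lies between `v` and `ζ`, a position is
raised only when all positions with a larger entry of `v` are full, and positions with equal
entries of `v` are raised evenly. -/
structure IsFill (ζ : ℕ) {ι : Type*} (v w : ι → ℕ) : Prop where
  le : ∀ i, v i ≤ w i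
  le_top : ∀ i, w i ≤ ζ
  priority : ∀ i j, v j < v i → v j < w j → w i = ζ
  balanced : ∀ i j, v i = v j → w i ≤ w j + 1

theorem mem_scompJ3 {ζ ℓ : ℕ} {v u : Fin ℓ → ℕ} {h : Fin ℓ} :
    h ∈ scompJ3 ζ v u ↔ u h ≠ ζ ∧ (∀ j, u j ≠ ζ → v j ≤ v h) ∧
      ∀ j, u j ≠ ζ → (∀ i, u i ≠ ζ → v i ≤ v j) → u h ≤ u j := by
  simp only [scompJ3, scompJ2, scompJ1, Finset.mem_filter, Finset.mem_univ, true_and]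
  constructor
  · rintro ⟨⟨h1, h2⟩, h3⟩; exact ⟨h1, h2, fun j hj hi => h3 j ⟨hj, hi⟩⟩
  · rintro ⟨h1, h2, h3⟩; exact ⟨⟨h1, h2⟩, fun j hj => h3 j hj.1 hj.2⟩

/-- The two selection rules are what preserves the invariants: maximality of `v h` among the
positions that are not full gives `priority`, minimality of `u h` among those with the same entry of
`v` gives `balanced`. -/
theorem IsFill.update {ζ ℓ : ℕ} {v u : Fin ℓ → ℕ} (hu : IsFill ζ v u) {h : Fin ℓ}
    (hh : h ∈ scompJ3 ζ v u) : IsFill ζ v (Function.update u h (u h + 1)) := by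
  obtain ⟨h1, h2, h3⟩ := mem_scompJ3.1 hh
  have hlt : u h < ζ := lt_of_le_of_ne (hu.le_top h) h1
  refine ⟨fun i => ?_, fun i => ?_, fun i j hij hj => ?_, fun i j hij => ?_⟩
  · rcases eq_or_ne i h with rfl | hi
    · simpa using (hu.le i).trans (Nat.le_succ _)
    · simpa [hi] using hu.le i
  · rcases eq_or_ne i h with rfl | hi
    · simpa using hlt
    · simpa [hi] using hu.le_top i
  · have key : u i = ζ := by
      rcases eq_or_ne j h with rfl | hjh
      · by_contra hne
        exact absurd (h2 i hne) (by omega)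
      · exact hu.priority i j hij (by simpa [hjh] using hj)
    have hi : i ≠ h := fun e => h1 (e ▸ key)
    simpa [hi] using key
  · rcases eq_or_ne j h with rfl | hjh
    · rcases eq_or_ne i j with rfl | hi
      · simp
      · have := hu.balanced i j hij
        simp [hi]; omega
    · rcases eq_or_ne i h with rfl | hi
      · have : u i ≤ u j := by
          by_cases hj : u j = ζ
          · rw [hj]; exact hu.le_top i
          · exact h3 j hj fun x hx => hij ▸ h2 x hx
        simp [hjh, this]
      · simpa [hi, hjh] using hu.balanced i j hij

theorem ScompReach.isFill {ζ ℓ : ℕ} {v : Fin ℓ → ℕ} (hv : ∀ i, v i ≤ ζ) :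
    ∀ {d : ℕ} {w : Fin ℓ → ℕ}, ScompReach ζ v d w → IsFill ζ v w ∧ ∑ i, w i = ∑ i, v i + d
  | 0, w, h => by
    obtain rfl : w = v := h
    exact ⟨⟨fun _ => le_rfl, hv, fun i j _ h => absurd h (lt_irrefl _), fun i j h => by omega⟩, rfl⟩
  | d + 1, w, ⟨u, hu, h, hh, hw⟩ => by
    obtain ⟨h1, h2⟩ := ScompReach.isFill hv hu
    subst hw
    refine ⟨h1.update hh, ?_⟩
    rw [Finset.sum_update_of_mem (Finset.mem_univ h), ← Finset.sum_erase_add _ u (Finset.mem_univ h)] at *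
    rw [← Finset.erase_eq]; omega

theorem scompJ3_nonempty {ζ ℓ : ℕ} (v : Fin ℓ → ℕ) {u : Fin ℓ → ℕ}
    (hs : ∑ i, u i < ℓ * ζ) : (scompJ3 ζ v u).Nonempty := by
  have h1 : (scompJ1 ζ u).Nonempty := by
    by_contra hne
    rw [Finset.not_nonempty_iff_eq_empty, scompJ1, Finset.filter_eq_empty_iff] at hne
    have : ∑ i, u i = ∑ _i : Fin ℓ, ζ := Finset.sum_congr rfl fun i hi => not_not.1 (hne hi)
    simp at this
    omega
  obtain ⟨i, hi, hmax⟩ := Finset.exists_max_image _ v h1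
  have h2 : (scompJ2 ζ v u).Nonempty := ⟨i, by rw [scompJ2, Finset.mem_filter]; exact ⟨hi, hmax⟩⟩
  obtain ⟨j, hj, hmin⟩ := Finset.exists_min_image _ u h2
  exact ⟨j, by rw [scompJ3, Finset.mem_filter]; exact ⟨hj, hmin⟩⟩

/-- Below the total capacity `ℓ * ζ` some position is always admissible, so `scompStep` never falls
into its default branch and its iterates are genuine outcomes of the randomized procedure. -/
theorem scompReach_iterate {ζ ℓ : ℕ} {v : Fin ℓ → ℕ} (hv : ∀ i, v i ≤ ζ) :
    ∀ {d : ℕ}, ∑ i, v i + d ≤ ℓ * ζ → ScompReach ζ v d ((scompStep ζ v)^[d] v)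
  | 0, _ => rfl
  | d + 1, hd => by
    have ih := scompReach_iterate hv (d := d) (by omega)
    obtain ⟨h1, h2⟩ := ih.isFill hv
    have hne := scompJ3_nonempty (ζ := ζ) v (u := (scompStep ζ v)^[d] v) (by omega)
    rw [Function.iterate_succ_apply']
    exact ⟨_, ih, _, Finset.min'_mem _ hne, by rw [scompStep, dif_pos hne]⟩

theorem scomp_isFill {ζ ℓ : ℕ} {v : Fin ℓ → ℕ} (hv : ∀ i, v i ≤ ζ) {s : ℕ} (hs : ∑ i, v i ≤ s)
    (hs' : s ≤ ℓ * ζ) : IsFill ζ v (scomp ζ v s) ∧ ∑ i, scomp ζ v s i = s := by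
  obtain ⟨h1, h2⟩ := (scompReach_iterate hv (d := s - ∑ i, v i) (by omega)).isFill hv
  exact ⟨h1, by rw [scomp, h2]; omega⟩

open Finset in
/-- The part of the mass of a filling that lies on the positions where `v` equals `a`. -/
theorem IsFill.sum_level {ζ : ℕ} {ι : Type*} [Fintype ι] {v w : ι → ℕ} (hw : IsFill ζ v w) {r : ℕ}
    (hr : ∑ i, w i = ∑ i, v i + r) (a : ℕ) :
    ∑ i with v i = a, w i =
      min (#{i | v i = a} * a + (r - ∑ i with a < v i, (ζ - v i))) (#{i | v i = a} * ζ) := by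
  have hd : ∑ i, (w i - v i) = r := by
    have : ∑ i, (w i - v i) + ∑ i, v i = ∑ i, w i := by
      rw [← sum_add_distrib]; exact sum_congr rfl fun i _ => Nat.sub_add_cancel (hw.le i)
    omega
  have hsplit : ∑ i with a < v i, (w i - v i) + (∑ i with v i = a, (w i - v i)
      + ∑ i with v i < a, (w i - v i)) = r := by
    rw [← hd, ← sum_filter_add_sum_filter_not univ (fun i => a < v i)]
    congr 1
    rw [← sum_filter_add_sum_filter_not (univ.filter fun i => ¬ a < v i) (fun i => v i = a),
      filter_filter, filter_filter]
    congr 1 <;> (congr 1; ext i; simp; omega)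
  have hB : ∑ i with v i = a, w i = #{i | v i = a} * a + ∑ i with v i = a, (w i - v i) := by
    rw [← smul_eq_mul, ← sum_const, ← sum_add_distrib]
    refine sum_congr rfl fun i hi => ?_
    have h1 := (mem_filter.1 hi).2
    have h2 := hw.le i
    omega
  have hBle : ∑ i with v i = a, w i ≤ #{i | v i = a} * ζ := by
    rw [← smul_eq_mul, ← sum_const]; exact sum_le_sum fun i _ => hw.le_top i
  have hHle : ∑ i with a < v i, (w i - v i) ≤ ∑ i with a < v i, (ζ - v i) :=
    sum_le_sum fun i _ => Nat.sub_le_sub_right (hw.le_top i) _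
  -- A position above level `a` that is not full blocks every raise at or below `a`; then `r` is at
  -- most the capacity above `a`, and the truncated difference in the claim is `0`.
  by_cases hH : ∃ i, a < v i ∧ w i ≠ ζ
  · obtain ⟨i, hi, hne⟩ := hH
    have hz : ∀ j, v j ≤ a → w j - v j = 0 := fun j hj => by
      by_contra h
      exact hne (hw.priority i j (by omega) (by omega))
    have e1 : ∑ i with v i = a, (w i - v i) = 0 :=
      sum_eq_zero fun j hj => hz j (mem_filter.1 hj).2.le
    have e2 : ∑ i with v i < a, (w i - v i) = 0 :=
      sum_eq_zero fun j hj => hz j (mem_filter.1 hj).2.le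
    omega
  · push Not at hH
    have e0 : ∑ i with a < v i, (w i - v i) = ∑ i with a < v i, (ζ - v i) :=
      sum_congr rfl fun i hi => by rw [hH i (mem_filter.1 hi).2]
    -- Now everything above is full. Either level `a` is not full, so nothing below is raised and
    -- the level receives all that remains, or it is full and the minimum is `#B * ζ`, with `B` the
    -- level set.
    by_cases hb : ∃ i, v i = a ∧ w i ≠ ζ
    · obtain ⟨i, hi, hne⟩ := hb
      have e2 : ∑ i with v i < a, (w i - v i) = 0 := sum_eq_zero fun j hj => by
        by_contra h
        have := (mem_filter.1 hj).2
        exact hne (hw.priority i j (by omega) (by omega))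
      omega
    · push Not at hb
      have e1 : ∑ i with v i = a, w i = #{i | v i = a} * ζ := by
        rw [← smul_eq_mul, ← sum_const]
        exact sum_congr rfl fun i hi => hb i (mem_filter.1 hi).2
      omega

open Finset in
-- Balanced values are the minimum `w m` or `w m + 1`, and fewer than `#B` of them are the larger
-- one. So quotient and remainder of the total by `#B` recover the minimum and the number of larger
-- values.
theorem prod_of_balanced {ι : Type*} (B : Finset ι) (w : ι → ℕ)
    (hw : ∀ i ∈ B, ∀ j ∈ B, w i ≤ w j + 1) (g : ℕ → ℕ) :
    ∏ i ∈ B, g (w i) = g ((∑ i ∈ B, w i) / #B + 1) ^ ((∑ i ∈ B, w i) % #B) *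
      g ((∑ i ∈ B, w i) / #B) ^ (#B - (∑ i ∈ B, w i) % #B) := by
  classical
  rcases B.eq_empty_or_nonempty with rfl | hne
  · simp
  obtain ⟨m, hm, hmin⟩ := exists_min_image B w hne
  have hcase : ∀ i ∈ B, w i ≠ w m + 1 → w i = w m := fun i hi h => by
    have := hmin i hi
    have := hw i hi m hm
    omega
  have hlt : #{i ∈ B | w i = w m + 1} < #B := card_lt_card <| filter_ssubset.2 ⟨m, hm, by omega⟩
  have hcard := card_filter_add_card_filter_not (s := B) (fun i => w i = w m + 1)
  have hsum : ∑ i ∈ B, w i = #B * w m + #{i ∈ B | w i = w m + 1} := by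
    have h1 : ∑ i ∈ B, w i = ∑ i ∈ B, (w m + if w i = w m + 1 then 1 else 0) :=
      sum_congr rfl fun i hi => by
        split_ifs with h
        · exact h
        · exact hcase i hi h
    rw [h1, sum_add_distrib, sum_const, smul_eq_mul, card_filter]
  have hdiv : (∑ i ∈ B, w i) / #B = w m := by
    rw [hsum, Nat.mul_add_div (by omega), Nat.div_eq_of_lt hlt, add_zero]
  have hmod : (∑ i ∈ B, w i) % #B = #{i ∈ B | w i = w m + 1} := by
    rw [hsum, Nat.mul_add_mod, Nat.mod_eq_of_lt hlt]
  rw [hdiv, hmod, ← prod_filter_mul_prod_filter_not B (fun i => w i = w m + 1)]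
  congr 1
  · rw [prod_congr rfl (g := fun _ => g (w m + 1)) fun i hi => by rw [(mem_filter.1 hi).2],
      prod_const]
  · rw [prod_congr rfl (g := fun _ => g (w m)) fun i hi => by
      rw [hcase i (mem_filter.1 hi).1 (mem_filter.1 hi).2], prod_const]
    congr 1; omega

/-! ### Closed form of the denominators -/

/-- The contribution to `∏ᵢ [wᵢ choose vᵢ]_q ∏ᵢ δᵢ(v)!` of `k` entries of `v` equal to `a`, when
the filling `w` may raise them by `r` in total. -/
def blockDen (q ζ a k r : ℕ) : ℕ :=
  k ! * (gaussBinom q (min (k * a + r) (k * ζ) / k + 1) a ^ (min (k * a + r) (k * ζ) % k) *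
    gaussBinom q (min (k * a + r) (k * ζ) / k) a ^ (k - min (k * a + r) (k * ζ) % k))

/-- The amount by which the entries of `L` above `a` can be raised. -/
def capAbove (ζ : ℕ) (L : List ℕ) (a : ℕ) : ℕ := ((L.filter (a < ·)).map (ζ - ·)).sum

/-- The amount by which the entries of `L` can be raised. -/
def listCap (ζ : ℕ) (L : List ℕ) : ℕ := (L.map (ζ - ·)).sum

/-- Closed form of `∏ᵢ [wᵢ choose vᵢ]_q ∏ᵢ δᵢ(v)!`, for the entries `L` of `v` and a filling `w`
that raises them by `r` in total. -/
def listDen (q ζ : ℕ) (L : List ℕ) (r : ℕ) : ℕ :=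
  ∏ a ∈ L.toFinset, blockDen q ζ a (L.count a) (r - capAbove ζ L a)

/-- `∏ᵢ [ζ choose vᵢ]_q` for the entries `L` of `v`. -/
def listNum (q ζ : ℕ) (L : List ℕ) : ℕ := (L.map (gaussBinom q ζ)).prod

/-- The summands of the table, as functions of the list of entries. -/
def listTerm (q ζ : ℕ) (L : List ℕ) (r : ℕ) : ℚ := listNum q ζ L / listDen q ζ L r

@[simp] theorem blockDen_zero (q ζ a r : ℕ) : blockDen q ζ a 0 r = 1 := by simp [blockDen]

theorem count_ofFn_eq_mult {ℓ : ℕ} (v : Fin ℓ → ℕ) (a : ℕ) : (List.ofFn v).count a = mult v a := by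
  rw [← Multiset.coe_count, ← Fin.univ_val_map, Multiset.count_map, mult, Finset.card_def]
  simp only [eq_comm, Finset.filter_val]

theorem capAbove_ofFn (ζ : ℕ) {ℓ : ℕ} (v : Fin ℓ → ℕ) (a : ℕ) :
    capAbove ζ (List.ofFn v) a = ∑ i with a < v i, (ζ - v i) := by
  rw [capAbove, ← Multiset.sum_coe, ← Multiset.map_coe, ← Multiset.filter_coe,
    ← Fin.univ_val_map, Multiset.filter_map, Multiset.map_map, Finset.sum, Finset.filter_val]
  rfl

open Finset in
-- Grouping by the value `a` of `v`, `sum_level` gives the mass of the level and `prod_of_balanced`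
-- its distribution; the factorial completes the factor to `blockDen`. The right side no longer
-- mentions `w`, which is the source of all independence statements.
theorem IsFill.prod_gaussBinom {ζ μ ℓ : ℕ} {v w : Fin ℓ → ℕ} (hw : IsFill ζ v w) {r : ℕ}
    (hr : ∑ i, w i = ∑ i, v i + r) (hv : ∀ i, v i ≤ μ) (q : ℕ) :
    (∏ i, gaussBinom q (w i) (v i)) * ∏ a ∈ range (μ + 1), (mult v a)! =
      listDen q ζ (List.ofFn v) r := by
  have h1 : listDen q ζ (List.ofFn v) r = ∏ a ∈ range (μ + 1),
      blockDen q ζ a ((List.ofFn v).count a) (r - capAbove ζ (List.ofFn v) a) := by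
    refine prod_subset (fun a ha => ?_) fun a _ ha => ?_
    · obtain ⟨i, rfl⟩ := (List.mem_ofFn' v a).1 (List.mem_toFinset.1 ha)
      exact mem_range.2 (Nat.lt_succ_of_le (hv i))
    · rw [List.count_eq_zero_of_not_mem (fun h => ha (List.mem_toFinset.2 h)), blockDen_zero]
  rw [h1, ← prod_fiberwise_of_maps_to (s := univ) (t := range (μ + 1)) (g := v)
    (fun i _ => mem_range.2 (Nat.lt_succ_of_le (hv i))), ← prod_mul_distrib]
  refine prod_congr rfl fun a _ => ?_
  have h2 := hw.sum_level hr a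
  have h3 := prod_of_balanced (univ.filter fun i => v i = a) w
    (fun i hi j hj => hw.balanced i j ((mem_filter.1 hi).2.trans (mem_filter.1 hj).2.symm))
    (fun x => gaussBinom q x a)
  rw [prod_congr rfl (g := fun i => gaussBinom q (w i) a) fun i hi => by rw [(mem_filter.1 hi).2],
    h3, h2, count_ofFn_eq_mult, capAbove_ofFn, mul_comm, blockDen]
  rfl

theorem capAbove_append (ζ : ℕ) (u v : List ℕ) (a : ℕ) :
    capAbove ζ (u ++ v) a = capAbove ζ u a + capAbove ζ v a := by
  simp [capAbove]

theorem capAbove_of_forall_gt {ζ : ℕ} {u : List ℕ} {a : ℕ} (h : ∀ x ∈ u, a < x) :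
    capAbove ζ u a = listCap ζ u := by
  rw [capAbove, listCap, List.filter_eq_self.2 (by simpa using h)]

theorem capAbove_of_forall_le {ζ : ℕ} {u : List ℕ} {a : ℕ} (h : ∀ x ∈ u, x ≤ a) :
    capAbove ζ u a = 0 := by
  rw [capAbove, List.filter_eq_nil_iff.2 (by simpa using h)]; rfl

/-- Capacity above an entry counts larger entries only: entries of `u` do not notice `v`, while each
entry of `v` has all of `u` above it and thus loses `listCap ζ u` of the surplus. -/
theorem listDen_append (q ζ : ℕ) {u v : List ℕ} (h : ∀ x ∈ u, ∀ y ∈ v, y < x) (r : ℕ) :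
    listDen q ζ (u ++ v) r = listDen q ζ u r * listDen q ζ v (r - listCap ζ u) := by
  have hdis : Disjoint u.toFinset v.toFinset := by
    rw [Finset.disjoint_left]
    intro x hx hy
    exact lt_irrefl _ (h x (List.mem_toFinset.1 hx) x (List.mem_toFinset.1 hy))
  rw [listDen, List.toFinset_append, Finset.prod_union hdis, listDen, listDen]
  congr 1
  · refine Finset.prod_congr rfl fun a ha => ?_
    have ha' := List.mem_toFinset.1 ha
    have hav : a ∉ v := fun hv => lt_irrefl _ (h a ha' a hv)
    rw [List.count_append, List.count_eq_zero_of_not_mem hav, capAbove_append,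
      capAbove_of_forall_le fun y hy => (h a ha' y hy).le]
    rfl
  · refine Finset.prod_congr rfl fun a ha => ?_
    have ha' := List.mem_toFinset.1 ha
    have hau : a ∉ u := fun hu => lt_irrefl _ (h a hu a ha')
    rw [List.count_append, List.count_eq_zero_of_not_mem hau, capAbove_append,
      capAbove_of_forall_gt fun x hx => h x hx a ha', Nat.sub_sub, zero_add]

@[simp] theorem listDen_nil (q ζ r : ℕ) : listDen q ζ [] r = 1 := by simp [listDen]

theorem listDen_replicate (q ζ a k r : ℕ) :
    listDen q ζ (List.replicate k a) r = blockDen q ζ a k r := by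
  rcases Nat.eq_zero_or_pos k with rfl | hk
  · simp
  · rw [listDen, List.toFinset_replicate_of_ne_zero hk.ne', Finset.prod_singleton,
      List.count_replicate_self, capAbove_of_forall_le fun x hx => (List.eq_of_mem_replicate hx).le]
    rfl

theorem listNum_append (q ζ : ℕ) (u v : List ℕ) :
    listNum q ζ (u ++ v) = listNum q ζ u * listNum q ζ v := by simp [listNum]

theorem listCap_append (ζ : ℕ) (u v : List ℕ) :
    listCap ζ (u ++ v) = listCap ζ u + listCap ζ v := by simp [listCap]

theorem listTerm_append (q ζ : ℕ) {u v : List ℕ} (h : ∀ x ∈ u, ∀ y ∈ v, y < x) (r : ℕ) :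
    listTerm q ζ (u ++ v) r = listTerm q ζ u r * listTerm q ζ v (r - listCap ζ u) := by
  rw [listTerm, listTerm, listTerm, listNum_append, listDen_append q ζ h]
  push_cast
  rw [mul_div_mul_comm]

theorem listCap_add_sum {ζ : ℕ} : ∀ {L : List ℕ}, (∀ x ∈ L, x ≤ ζ) →
    listCap ζ L + L.sum = L.length * ζ
  | [], _ => by simp [listCap]
  | x :: L, h => by
    have ih := listCap_add_sum (L := L) fun y hy => h y (List.mem_cons_of_mem _ hy)
    have hx := h x List.mem_cons_self
    simp only [listCap, List.map_cons, List.sum_cons, List.length_cons] at *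
    rw [Nat.add_mul]; omega

/-! ### Sums over sorted decompositions as sums over lists -/

/-- The entry lists of the sorted weight decompositions. -/
def sortedLists (t ℓ μ : ℕ) : Finset (List ℕ) := (sortedDecomps t ℓ μ).image List.ofFn

theorem mem_decomps {t ℓ μ : ℕ} {v : Fin ℓ → ℕ} :
    v ∈ decomps t ℓ μ ↔ (∀ i, v i ≤ μ) ∧ ∑ i, v i = t := by
  simp [decomps]

theorem mem_sortedLists {t ℓ μ : ℕ} {L : List ℕ} : L ∈ sortedLists t ℓ μ ↔
    L.length = ℓ ∧ (∀ x ∈ L, x ≤ μ) ∧ L.sum = t ∧ L.Pairwise (fun a b => b ≤ a) := by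
  simp only [sortedLists, Finset.mem_image, sortedDecomps, Finset.mem_filter, mem_decomps]
  constructor
  · rintro ⟨v, ⟨⟨h1, h2⟩, h3⟩, rfl⟩
    refine ⟨List.length_ofFn, by simpa [List.mem_ofFn] using h1, by rw [List.sum_ofFn, h2], ?_⟩
    rw [List.pairwise_ofFn]
    exact fun i j hij => h3 i j hij.le
  · rintro ⟨rfl, h2, h3, h4⟩
    refine ⟨L.get, ⟨⟨fun i => h2 _ (List.get_mem _ _), ?_⟩, fun i j hij => ?_⟩, List.ofFn_get L⟩
    · rw [← List.sum_ofFn, List.ofFn_get, h3]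
    · rcases hij.eq_or_lt with rfl | hij
      · exact le_rfl
      · exact List.pairwise_iff_get.1 h4 i j hij

theorem sum_sortedLists {t ℓ μ : ℕ} (g : List ℕ → ℚ) :
    ∑ L ∈ sortedLists t ℓ μ, g L = ∑ v ∈ sortedDecomps t ℓ μ, g (List.ofFn v) :=
  Finset.sum_image fun _ _ _ _ h => List.ofFn_injective h

theorem prod_div_scomp {q ζ μ ℓ : ℕ} (hμ : μ ≤ ζ) {v : Fin ℓ → ℕ} {t s : ℕ}
    (hv : v ∈ decomps t ℓ μ) (hts : t ≤ s) (hs : s ≤ ℓ * ζ) :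
    (∏ i ∈ Finset.range (μ + 1), ((mult v i)! : ℚ))⁻¹ *
        ∏ i, (gaussBinom q ζ (v i) : ℚ) / (gaussBinom q (scomp ζ v s i) (v i) : ℚ) =
      listTerm q ζ (List.ofFn v) (s - t) := by
  obtain ⟨h1, h2⟩ := mem_decomps.1 hv
  obtain ⟨h3, h4⟩ := scomp_isFill (fun i => (h1 i).trans hμ) (h2.trans_le hts) hs
  have h5 := h3.prod_gaussBinom (r := s - t) (by omega) h1 q
  rw [listTerm, ← h5, listNum, List.map_ofFn, List.prod_ofFn, Finset.prod_div_distrib]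
  push_cast
  simp only [Function.comp_apply]
  rw [inv_mul_eq_div, div_div]

/-- For `t' > ℓ' * μ'` the table entry is `0` and no list exists, so `s' ≤ ℓ' * ζ` is asked for only
in the other case; `cumul_eq` can provide no more. -/
theorem tableM_eq_sum {q ζ t' ℓ' μ' s' : ℕ} (hμ : μ' ≤ ζ) (hℓ : 1 ≤ ℓ') (ht : t' ≤ s')
    (ht' : t' ≤ ℓ' * μ' → s' ≤ ℓ' * ζ) :
    tableM q ζ t' ℓ' μ' s' = ∑ L ∈ sortedLists t' ℓ' μ', listTerm q ζ L (s' - t') := by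
  by_cases h : t' ≤ ℓ' * μ'
  · rw [tableM, if_pos ⟨hℓ, le_min ht h, ht' h⟩, sum_sortedLists]
    exact Finset.sum_congr rfl fun v hv =>
      prod_div_scomp hμ (Finset.mem_filter.1 hv).1 ht (ht' h)
  · rw [tableM, if_neg (fun h' => h (h'.2.1.trans (min_le_right _ _))), if_neg (by omega)]
    refine (Finset.sum_eq_zero fun L hL => ?_).symm
    obtain ⟨h1, h2, h3, -⟩ := mem_sortedLists.1 hL
    have := List.sum_le_card_nsmul L μ' h2
    rw [h3, h1, smul_eq_mul] at this
    exact absurd this h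

/-! ### Weights of sorted vectors and their cumulated sums -/

namespace Params

/-- The conditions that the statement imposes on the parameters of the algorithm. -/
structure Admissible (P : Params) : Prop where
  q_ge : 2 ≤ P.q
  ℓ_pos : 0 < P.ℓ
  μ_pos : 0 < P.μ
  μ_le : P.μ ≤ P.ζ
  t_le : P.t ≤ P.s
  s_le : P.s ≤ P.ℓ * P.μ

variable {P : Params}

theorem Admissible.s_le' (hP : P.Admissible) : P.s ≤ P.ℓ * P.ζ :=
  hP.s_le.trans (Nat.mul_le_mul_left _ hP.μ_le)

/-- The sorted weight decompositions of the algorithm. -/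
abbrev lists (P : Params) : Finset (List ℕ) := sortedLists P.t P.ℓ P.μ

/-- The weight `ω` of a list of entries. -/
def listWeight (P : Params) (L : List ℕ) : ℚ := P.ℓ ! * listTerm P.q P.ζ L (P.s - P.t)

theorem Admissible.weight_eq (hP : P.Admissible) {v : Fin P.ℓ → ℕ} (hv : v ∈ decomps P.t P.ℓ P.μ) :
    P.weight v = P.listWeight (List.ofFn v) := by
  rw [listWeight, ← prod_div_scomp hP.μ_le hv hP.t_le hP.s_le', weight, rhoS, rho, ← Finset.prod_inv_distrib,
    div_eq_mul_inv, mul_assoc]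
  simp only [inv_div]

theorem Admissible.prefixSum_eq (hP : P.Admissible) (pre : List ℕ) :
    P.prefixSum pre = ∑ L ∈ P.lists with L.take pre.length = pre, P.listWeight L := by
  rw [prefixSum, Finset.sum_filter, Finset.sum_filter, sum_sortedLists]
  refine Finset.sum_congr rfl fun v hv => ?_
  rw [hP.weight_eq (Finset.mem_filter.1 hv).1]

theorem Admissible.prefixSum_nil (hP : P.Admissible) :
    P.prefixSum [] = P.ℓ ! * tableM P.q P.ζ P.t P.ℓ P.μ P.s := by
  rw [hP.prefixSum_eq, tableM_eq_sum hP.μ_le hP.ℓ_pos hP.t_le fun _ => hP.s_le', Finset.mul_sum]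
  simp [listWeight]

/-- The cumulated weights are products of a factor of the prefix and an entry of the table. -/
theorem Admissible.cumul_eq (hP : P.Admissible) {pre : List ℕ} {c : ℕ} (hlen : pre.length < P.ℓ)
    (hsort : pre.Pairwise fun a b => b ≤ a) (hle : ∀ x ∈ pre, x ≤ P.μ) (hsum : pre.sum ≤ P.t)
    (hcμ : c < P.μ) (hc : ∀ x ∈ pre, c < x) :
    P.cumul pre (c + 1) = P.ℓ ! * listTerm P.q P.ζ pre (P.s - P.t) *
      tableM P.q P.ζ (P.t - pre.sum) (P.ℓ - pre.length) c
        (P.t - pre.sum + (P.s - P.t - listCap P.ζ pre)) := by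
  have hcap := listCap_add_sum fun x hx => (hle x hx).trans hP.μ_le
  have hs := hP.s_le'
  have hts := hP.t_le
  have hμζ := hP.μ_le
  -- The table is entered at `s' = t' + surplus`, so that `s' - t'` is the surplus left to the tail.
  -- A sorted tail has all entries `≤ c` as soon as its first entry is, so the sum over first
  -- entries `≤ c` covers exactly the tails of the table entry with `μ' = c`.
  rw [tableM_eq_sum (by omega) (by omega) (by omega), Nat.add_sub_cancel_left, Finset.mul_sum,
    ← Finset.sum_fiberwise_of_maps_to (t := Finset.range (c + 1)) (g := fun L => L.headD 0), cumul]
  · refine Finset.sum_congr rfl fun t' ht' => ?_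
    rw [hP.prefixSum_eq]
    refine Finset.sum_nbij' (fun L => L.drop pre.length) (fun L => pre ++ L) ?_ ?_ ?_ ?_ ?_
    · intro L hL
      rw [Finset.mem_filter] at hL ⊢
      obtain ⟨hL, htake⟩ := hL
      obtain ⟨h1, h2, h3, h4⟩ := mem_sortedLists.1 hL
      rw [List.length_append, List.length_singleton] at htake
      obtain ⟨M, rfl⟩ : ∃ M, L = pre ++ t' :: M := by
        refine ⟨L.drop (pre.length + 1), ?_⟩
        conv_lhs => rw [← List.take_append_drop (pre.length + 1) L, htake]
        simp
      rw [List.drop_left]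
      refine ⟨mem_sortedLists.2 ⟨?_, ?_, ?_, ?_⟩, rfl⟩
      · rw [List.length_append] at h1; omega
      · have h5 := (List.pairwise_cons.1 (List.pairwise_append.1 h4).2.1).1
        have h6 := Finset.mem_range.1 ht'
        intro x hx
        rcases List.mem_cons.1 hx with rfl | hx
        · omega
        · have := h5 x hx; omega
      · rw [List.sum_append] at h3; omega
      · exact (List.pairwise_append.1 h4).2.1
    · intro L hL
      rw [Finset.mem_filter] at hL ⊢
      obtain ⟨hL, hhead⟩ := hL
      obtain ⟨h1, h2, h3, h4⟩ := mem_sortedLists.1 hL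
      refine ⟨mem_sortedLists.2 ⟨?_, ?_, ?_, ?_⟩, ?_⟩
      · rw [List.length_append]; omega
      · intro x hx
        rcases List.mem_append.1 hx with hx | hx
        · exact hle x hx
        · have := h2 x hx; omega
      · rw [List.sum_append]; omega
      · exact List.pairwise_append.2 ⟨hsort, h4, fun x hx y hy => (h2 y hy).trans (hc x hx).le⟩
      · cases L with
        | nil => simp at h1; omega
        | cons x M =>
          simp only [List.headD_cons] at hhead
          simp [hhead, List.take_append]
    · intro L hL
      have htake := (Finset.mem_filter.1 hL).2
      rw [List.length_append, List.length_singleton] at htake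
      have : L.take pre.length = pre := by
        have := congrArg (List.take pre.length) htake
        rwa [List.take_take, min_eq_left (by omega), List.take_left'] at this
        rfl
      conv_rhs => rw [← List.take_append_drop pre.length L, this]
    · intro L _
      exact List.drop_left
    · intro L hL
      have htake := (Finset.mem_filter.1 hL).2
      obtain ⟨h1, h2, h3, h4⟩ := mem_sortedLists.1 (Finset.mem_filter.1 hL).1
      rw [List.length_append, List.length_singleton] at htake
      obtain ⟨M, rfl⟩ : ∃ M, L = pre ++ t' :: M := by
        refine ⟨L.drop (pre.length + 1), ?_⟩
        conv_lhs => rw [← List.take_append_drop (pre.length + 1) L, htake]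
        simp
      -- Entries of the prefix exceed `c` and those of the tail do not, so the term factors.
      rw [List.drop_left, listWeight, listTerm_append, mul_assoc]
      have h5 := (List.pairwise_cons.1 (List.pairwise_append.1 h4).2.1).1
      have h6 := Finset.mem_range.1 ht'
      intro x hx y hy
      have h7 := hc x hx
      rcases List.mem_cons.1 hy with rfl | hy
      · omega
      · have := h5 y hy; omega
  · intro L hL
    obtain ⟨h1, h2, -, -⟩ := mem_sortedLists.1 hL
    cases L with
    | nil => simp at h1; omega
    | cons x M => exact Finset.mem_range.2 (Nat.lt_succ_of_le (h2 x List.mem_cons_self))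
  -- If the prefix absorbs the whole surplus, then `s' = t - pre.sum`, which is bounded by means of
  -- `h`; otherwise `s ≤ ℓ * ζ` suffices.
  · intro h
    have h8 := Nat.mul_le_mul_left (P.ℓ - pre.length) (show c ≤ P.ζ by omega)
    have h9 := Nat.mul_le_mul_right P.ζ hlen.le
    have h10 := Nat.sub_mul P.ℓ pre.length P.ζ
    omega

end Params

/-! ### Independence of the random choices and of the order of the entries -/

theorem IsFill.prod_eq {ζ ℓ : ℕ} {v w w' : Fin ℓ → ℕ} (hw : IsFill ζ v w) (hw' : IsFill ζ v w')
    (h : ∑ i, w i = ∑ i, w' i) (q : ℕ) :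
    ∏ i, gaussBinom q (w i) (v i) = ∏ i, gaussBinom q (w' i) (v i) := by
  have hsum : ∑ i, v i ≤ ∑ i, w i := Finset.sum_le_sum fun i _ => hw.le i
  have hv : ∀ i, v i ≤ ζ := fun i => (hw.le i).trans (hw.le_top i)
  have h1 := hw.prod_gaussBinom (r := ∑ i, w i - ∑ i, v i) (by omega) hv q
  have h2 := hw'.prod_gaussBinom (r := ∑ i, w i - ∑ i, v i) (by omega) hv q
  exact Nat.eq_of_mul_eq_mul_right
    (Finset.prod_pos fun i _ => Nat.factorial_pos _) (h1.trans h2.symm)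

theorem IsFill.rho_eq {ζ ℓ : ℕ} {v w w' : Fin ℓ → ℕ} (hw : IsFill ζ v w) (hw' : IsFill ζ v w')
    (h : ∑ i, w i = ∑ i, w' i) (q : ℕ) : rho q ζ w v = rho q ζ w' v := by
  rw [rho, rho, Finset.prod_div_distrib, Finset.prod_div_distrib]
  congr 1
  exact_mod_cast hw.prod_eq hw' h q

theorem rho_eq_rhoS {q ζ t s ℓ μ : ℕ} (hμ : μ ≤ ζ) (hts : t ≤ s) (hs : s ≤ ℓ * ζ)
    {v : Fin ℓ → ℕ} (hv : v ∈ decomps t ℓ μ) {w : Fin ℓ → ℕ} (hw : IsScompOutput ζ v s w) :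
    rho q ζ w v = rhoS q ζ s v := by
  obtain ⟨h1, h2⟩ := mem_decomps.1 hv
  have h3 : ∀ i, v i ≤ ζ := fun i => (h1 i).trans hμ
  obtain ⟨h4, h5⟩ := hw.isFill h3
  obtain ⟨h6, h7⟩ := scomp_isFill h3 (h2.trans_le hts) hs
  exact h4.rho_eq h6 (by omega) q

theorem IsFill.comp_perm {ζ ℓ : ℕ} {v w : Fin ℓ → ℕ} (hw : IsFill ζ v w)
    (σ : Equiv.Perm (Fin ℓ)) : IsFill ζ (v ∘ σ) (w ∘ σ) :=
  ⟨fun _ => hw.le _, fun _ => hw.le_top _, fun _ _ => hw.priority _ _, fun _ _ => hw.balanced _ _⟩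

/-- `scomp` breaks ties by position and need not commute with permutations. But its permuted output
is a filling of the permuted vector with the same total, and this determines `rho`. -/
theorem rhoS_comp_perm {q ζ s ℓ : ℕ} {v : Fin ℓ → ℕ} (hv : ∀ i, v i ≤ ζ) (hs : ∑ i, v i ≤ s)
    (hs' : s ≤ ℓ * ζ) (σ : Equiv.Perm (Fin ℓ)) : rhoS q ζ s (v ∘ σ) = rhoS q ζ s v := by
  obtain ⟨h1, h2⟩ := scomp_isFill hv hs hs'
  have hsum : ∀ f : Fin ℓ → ℕ, ∑ i, (f ∘ σ) i = ∑ i, f i := fun f => Equiv.sum_comp σ f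
  obtain ⟨h3, h4⟩ := scomp_isFill (v := v ∘ σ) (fun i => hv _) ((hsum v).trans_le hs) hs'
  rw [rhoS, h3.rho_eq (h1.comp_perm σ) (by rw [hsum, h4, h2]) q, rhoS, rho, rho]
  exact Equiv.prod_comp σ fun i => (gaussBinom q (scomp ζ v s i) (v i) : ℚ) / gaussBinom q ζ (v i)

/-! ### Rearrangements -/

/-- The permutations with `u ∘ σ = u ∘ τ` form a coset of the stabilizer of `u`, which is the
product of the symmetric groups of the level sets. -/
theorem card_filter_comp_eq {ℓ : ℕ} (u : Fin ℓ → ℕ) {μ : ℕ} (hu : ∀ i, u i ≤ μ) {w : Fin ℓ → ℕ}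
    (hw : w ∈ rearrangements u) :
    (Finset.univ.filter fun σ : Equiv.Perm (Fin ℓ) => u ∘ σ = w).card =
      ∏ a ∈ Finset.range (μ + 1), (mult u a)! := by
  obtain ⟨τ, -, rfl⟩ := Finset.mem_image.1 hw
  have h1 : (Finset.univ.filter fun σ : Equiv.Perm (Fin ℓ) => u ∘ σ = u ∘ τ).card =
      (Finset.univ.filter fun σ : Equiv.Perm (Fin ℓ) => u ∘ σ = u).card := by
    refine Finset.card_nbij' (fun σ => σ * τ⁻¹) (fun σ => σ * τ) ?_ ?_ ?_ ?_
    · intro σ hσ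
      have h := (Finset.mem_filter.1 hσ).2
      simp only [Finset.coe_filter, Finset.mem_univ, true_and, Set.mem_ofPred_eq]
      ext i
      have := congrFun h (τ⁻¹ i)
      simpa using this
    · intro σ hσ
      have h := (Finset.mem_filter.1 hσ).2
      simp only [Finset.coe_filter, Finset.mem_univ, true_and, Set.mem_ofPred_eq]
      ext i
      exact congrFun h (τ i)
    · intro σ _; simp
    · intro σ _; simp
  rw [h1, ← Fintype.card_subtype, DomMulAct.stabilizer_card']
  refine (Finset.prod_congr rfl fun a _ => by rw [Fintype.card_subtype, ← mult]).trans
    (Finset.prod_subset (fun a ha => ?_) fun a _ ha => ?_)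
  · obtain ⟨i, -, rfl⟩ := Finset.mem_image.1 ha
    exact Finset.mem_range.2 (Nat.lt_succ_of_le (hu i))
  · rw [mult, Finset.card_eq_zero.2, Nat.factorial_zero]
    exact Finset.filter_eq_empty_iff.2 fun i _ h =>
      ha (Finset.mem_image.2 ⟨i, Finset.mem_univ _, h⟩)

theorem card_rearrangements {ℓ : ℕ} (u : Fin ℓ → ℕ) {μ : ℕ} (hu : ∀ i, u i ≤ μ) :
    (rearrangements u).card * ∏ a ∈ Finset.range (μ + 1), (mult u a)! = ℓ ! := by
  have hcard : (Finset.univ : Finset (Equiv.Perm (Fin ℓ))).card = ℓ ! := by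
    rw [Finset.card_univ, Fintype.card_perm, Fintype.card_fin]
  rw [← hcard, Finset.card_eq_sum_card_fiberwise (f := fun σ : Equiv.Perm (Fin ℓ) => u ∘ σ)
      (t := rearrangements u) (fun σ _ => Finset.mem_image_of_mem _ (Finset.mem_univ σ)),
    Finset.sum_congr rfl fun w hw => card_filter_comp_eq u hu hw, Finset.sum_const, smul_eq_mul]

/-- The weakly decreasing rearrangement of a vector. -/
def sortDesc {ℓ : ℕ} (v : Fin ℓ → ℕ) : Fin ℓ → ℕ := v ∘ (Fin.revPerm.trans (Tuple.sort v))

theorem antitone_sortDesc {ℓ : ℕ} (v : Fin ℓ → ℕ) : Antitone (sortDesc v) := fun i j hij => by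
  have := Tuple.monotone_sort v (Fin.rev_le_rev.2 hij)
  simpa [sortDesc] using this

theorem mem_rearrangements_comm {ℓ : ℕ} {u v : Fin ℓ → ℕ} :
    v ∈ rearrangements u ↔ ∃ σ : Equiv.Perm (Fin ℓ), u = v ∘ σ := by
  simp only [rearrangements, Finset.mem_image, Finset.mem_univ, true_and]
  constructor
  · rintro ⟨σ, rfl⟩; exact ⟨σ⁻¹, by ext i; simp⟩
  · rintro ⟨σ, rfl⟩; exact ⟨σ⁻¹, by ext i; simp⟩

/-- A decreasing rearrangement is unique, so the rearrangement classes are the fibres of `sortDesc`;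
sums over all decompositions split accordingly. -/
theorem mem_rearrangements_iff {ℓ : ℕ} {u v : Fin ℓ → ℕ} (hu : Antitone u) :
    v ∈ rearrangements u ↔ u = sortDesc v := by
  rw [mem_rearrangements_comm]
  refine ⟨?_, fun h => ⟨_, h⟩⟩
  rintro ⟨σ, rfl⟩
  exact Tuple.unique_antitone hu (antitone_sortDesc v)

theorem comp_mem_decomps {t ℓ μ : ℕ} {v : Fin ℓ → ℕ} (hv : v ∈ decomps t ℓ μ)
    (σ : Equiv.Perm (Fin ℓ)) : v ∘ σ ∈ decomps t ℓ μ := by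
  obtain ⟨h1, h2⟩ := mem_decomps.1 hv
  exact mem_decomps.2 ⟨fun i => h1 _, (Equiv.sum_comp σ v).trans h2⟩

theorem sortDesc_mem {t ℓ μ : ℕ} {v : Fin ℓ → ℕ} (hv : v ∈ decomps t ℓ μ) :
    sortDesc v ∈ sortedDecomps t ℓ μ :=
  Finset.mem_filter.2 ⟨comp_mem_decomps hv _, fun _ _ h => antitone_sortDesc v h⟩

/-! ### The normalizing constant as a sum over sorted vectors -/

namespace Params

variable {P : Params}

theorem weight_eq_card {v : Fin P.ℓ → ℕ}
    (hv : v ∈ decomps P.t P.ℓ P.μ) :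
    P.weight v = (rearrangements v).card * (rhoS P.q P.ζ P.s v)⁻¹ := by
  have h := card_rearrangements v (mem_decomps.1 hv).1
  have h0 : (∏ a ∈ Finset.range (P.μ + 1), (mult v a)! : ℚ) ≠ 0 :=
    Finset.prod_ne_zero_iff.2 fun a _ => by exact_mod_cast (Nat.factorial_pos _).ne'
  rw [weight, div_eq_iff h0 |>.2]
  exact_mod_cast h.symm

theorem Admissible.rhoS_comp_perm (hP : P.Admissible) {v : Fin P.ℓ → ℕ}
    (hv : v ∈ decomps P.t P.ℓ P.μ) (σ : Equiv.Perm (Fin P.ℓ)) :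
    rhoS P.q P.ζ P.s (v ∘ σ) = rhoS P.q P.ζ P.s v :=
  _root_.rhoS_comp_perm (fun i => ((mem_decomps.1 hv).1 i).trans hP.μ_le)
    ((mem_decomps.1 hv).2.trans_le hP.t_le) hP.s_le' σ

/-- On each fibre of `sortDesc` the value `ϱ⁻¹` is constant, so the fibre contributes its size times
`ϱ⁻¹`, which is `weight`. -/
theorem Admissible.Q_eq (hP : P.Admissible) : P.Q = P.prefixSum [] := by
  rw [Q, ← Finset.sum_fiberwise_of_maps_to (t := sortedDecomps P.t P.ℓ P.μ) (g := sortDesc)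
    fun v hv => sortDesc_mem hv, prefixSum]
  simp only [List.length_nil, List.take_zero, Finset.filter_true]
  refine Finset.sum_congr rfl fun u hu => ?_
  obtain ⟨hu1, hu2⟩ := Finset.mem_filter.1 hu
  have hfib : (decomps P.t P.ℓ P.μ).filter (fun v => sortDesc v = u) = rearrangements u := by
    ext v
    rw [Finset.mem_filter, mem_rearrangements_iff fun i j h => hu2 i j h, eq_comm]
    refine and_iff_right_of_imp fun h => ?_
    obtain ⟨σ, -, rfl⟩ := Finset.mem_image.1 ((mem_rearrangements_iff fun i j h => hu2 i j h).2 h)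
    exact comp_mem_decomps hu1 σ
  rw [hfib, weight_eq_card hu1, ← nsmul_eq_mul, ← Finset.sum_const]
  refine Finset.sum_congr rfl fun v hv => ?_
  obtain ⟨σ, -, rfl⟩ := Finset.mem_image.1 hv
  rw [hP.rhoS_comp_perm hu1]

end Params

/-! ### Integrality -/

theorem blockDen_pos {q ζ a k : ℕ} (ha : a ≤ ζ) (r : ℕ) : 0 < blockDen q ζ a k r := by
  rcases Nat.eq_zero_or_pos k with rfl | hk
  · simp
  · have h1 : a ≤ min (k * a + r) (k * ζ) / k := by
      rw [Nat.le_div_iff_mul_le hk, mul_comm]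
      exact le_min (by omega) (Nat.mul_le_mul_left _ ha)
    exact Nat.mul_pos (Nat.factorial_pos _) (Nat.mul_pos
      (Nat.pow_pos (gaussBinom_pos q (by omega))) (Nat.pow_pos (gaussBinom_pos q h1)))

theorem listDen_pos {q ζ : ℕ} {L : List ℕ} (hL : ∀ x ∈ L, x ≤ ζ) (r : ℕ) : 0 < listDen q ζ L r :=
  Finset.prod_pos fun a ha => blockDen_pos (hL a (List.mem_toFinset.1 ha)) _

theorem listNum_pos {q ζ : ℕ} {L : List ℕ} (hL : ∀ x ∈ L, x ≤ ζ) : 0 < listNum q ζ L :=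
  List.prod_pos fun y hy => by
    obtain ⟨x, hx, rfl⟩ := List.mem_map.1 hy
    exact gaussBinom_pos q (hL x hx)

namespace Params

variable {P : Params}

theorem iota_pos (P : Params) : 0 < P.iota :=
  Nat.mul_pos (Nat.factorial_pos _) <| Nat.pow_pos <| Finset.prod_pos fun _ _ =>
    Finset.prod_pos fun _ hs => gaussBinom_pos _ (Finset.mem_Icc.1 hs).1

/-- Written as `∏ δᵢ! · ∏ [wᵢ choose vᵢ]` for a filling `w`, the denominator divides `ι` factor by
factor: `∏ δᵢ!` divides `ℓ'!`, and each of the `ℓ'` binomials is a factor of the double product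
whose `ℓ`-th power is in `ι`. The bound on `t' + r` ensures that such a filling exists. -/
theorem Admissible.listDen_dvd_iota (hP : P.Admissible) {t' ℓ' μ' r : ℕ} {L : List ℕ}
    (hL : L ∈ sortedLists t' ℓ' μ') (hℓ : ℓ' ≤ P.ℓ) (hμ : μ' ≤ P.μ) (hr : t' + r ≤ ℓ' * P.ζ) :
    listDen P.q P.ζ L r ∣ P.iota := by
  obtain ⟨v, hv, rfl⟩ := Finset.mem_image.1 hL
  obtain ⟨h1, h2⟩ := mem_decomps.1 (Finset.mem_filter.1 hv).1
  have hvζ : ∀ i, v i ≤ P.ζ := fun i => ((h1 i).trans hμ).trans hP.μ_le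
  obtain ⟨h3, h4⟩ := scomp_isFill (s := t' + r) hvζ (by omega) hr
  rw [← h3.prod_gaussBinom (by omega) h1, mul_comm, iota]
  refine mul_dvd_mul ?_ ?_
  · refine (Nat.prod_factorial_dvd_factorial_sum _ _).trans (Nat.factorial_dvd_factorial ?_)
    refine le_trans (le_of_eq ?_) hℓ
    simp only [mult]
    rw [← Finset.card_eq_sum_card_fiberwise (f := v) (s := Finset.univ)
      fun i _ => Finset.mem_range.2 (Nat.lt_succ_of_le (h1 i))]
    simp
  · refine dvd_trans ?_ (pow_dvd_pow _ hℓ)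
    have hpow : ∀ g : ℕ, g ^ ℓ' = ∏ _i : Fin ℓ', g := fun g => by simp
    rw [hpow]
    refine Finset.prod_dvd_prod_of_dvd _ _ fun i _ => ?_
    refine dvd_trans ?_ (Finset.dvd_prod_of_mem _
      (Finset.mem_range.2 (Nat.lt_succ_of_le ((h1 i).trans hμ))))
    exact Finset.dvd_prod_of_mem (fun s' => gaussBinom P.q s' (v i))
      (Finset.mem_Icc.2 ⟨h3.le i, h3.le_top i⟩)

theorem Admissible.exists_iota_mul_tableM (hP : P.Admissible) {t' ℓ' μ' s' : ℕ} (hℓ : ℓ' ≤ P.ℓ)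
    (hμ : μ' ≤ P.μ) : ∃ m : ℕ, (P.iota : ℚ) * tableM P.q P.ζ t' ℓ' μ' s' = m := by
  by_cases h : 1 ≤ ℓ' ∧ t' ≤ min s' (ℓ' * μ') ∧ s' ≤ ℓ' * P.ζ
  · obtain ⟨h1, h2, h3⟩ := h
    have h4 : t' ≤ s' := h2.trans (min_le_left _ _)
    rw [tableM_eq_sum (hμ.trans hP.μ_le) h1 h4 fun _ => h3, Finset.mul_sum]
    refine ⟨∑ L ∈ sortedLists t' ℓ' μ', P.iota * listNum P.q P.ζ L / listDen P.q P.ζ L (s' - t'), ?_⟩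
    push_cast
    refine Finset.sum_congr rfl fun L hL => ?_
    have h5 := hP.listDen_dvd_iota (r := s' - t') hL hℓ hμ (by omega)
    have h6 : 0 < listDen P.q P.ζ L (s' - t') := listDen_pos (fun x hx =>
      ((mem_sortedLists.1 hL).2.1 x hx).trans (hμ.trans hP.μ_le)) _
    rw [Nat.cast_div (h5.mul_right _) (by exact_mod_cast h6.ne'), listTerm, Nat.cast_mul,
      mul_div_assoc]
  · rw [tableM, if_neg h]
    split_ifs
    · exact ⟨P.iota, by simp⟩
    · exact ⟨0, by simp⟩

/-! ### The weights as integers -/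

/-- The integer `ι ω(L)`. -/
def natWeight (P : Params) (L : List ℕ) : ℕ :=
  P.ℓ ! * (P.iota * listNum P.q P.ζ L / listDen P.q P.ζ L (P.s - P.t))

/-- The total integer weight of the sorted decompositions that begin with `pre`. -/
def prefixCount (P : Params) (pre : List ℕ) : ℕ :=
  ∑ L ∈ P.lists with L.take pre.length = pre, P.natWeight L

/-- The total integer weight of the sorted decompositions that begin with `pre` and an
entry `< c`. -/
def cumulCount (P : Params) (pre : List ℕ) (c : ℕ) : ℕ :=
  ∑ t' ∈ Finset.range c, P.prefixCount (pre ++ [t'])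

theorem Admissible.natWeight_cast (hP : P.Admissible) {L : List ℕ} (hL : L ∈ P.lists) :
    (P.natWeight L : ℚ) = P.iota * P.listWeight L := by
  have h5 := hP.listDen_dvd_iota (r := P.s - P.t) hL le_rfl le_rfl
    (by have := hP.s_le'; have := hP.t_le; omega)
  have h6 : 0 < listDen P.q P.ζ L (P.s - P.t) := listDen_pos (fun x hx =>
    ((mem_sortedLists.1 hL).2.1 x hx).trans hP.μ_le) _
  rw [natWeight, Nat.cast_mul, Nat.cast_div (h5.mul_right _) (by exact_mod_cast h6.ne'),
    listWeight, listTerm, Nat.cast_mul]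
  ring

theorem Admissible.natWeight_pos (hP : P.Admissible) {L : List ℕ} (hL : L ∈ P.lists) :
    0 < P.natWeight L := by
  have h5 := hP.listDen_dvd_iota (r := P.s - P.t) hL le_rfl le_rfl
    (by have := hP.s_le'; have := hP.t_le; omega)
  have h0 : ∀ x ∈ L, x ≤ P.ζ := fun x hx => ((mem_sortedLists.1 hL).2.1 x hx).trans hP.μ_le
  have h7 := Nat.mul_pos P.iota_pos (listNum_pos (q := P.q) h0)
  exact Nat.mul_pos (Nat.factorial_pos _)
    (Nat.div_pos (Nat.le_of_dvd h7 (h5.mul_right _)) (listDen_pos h0 _))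

theorem Admissible.prefixCount_cast (hP : P.Admissible) (pre : List ℕ) :
    (P.prefixCount pre : ℚ) = P.iota * P.prefixSum pre := by
  rw [prefixCount, hP.prefixSum_eq, Finset.mul_sum]
  push_cast
  exact Finset.sum_congr rfl fun L hL => hP.natWeight_cast (Finset.mem_filter.1 hL).1

theorem Admissible.cumulCount_cast (hP : P.Admissible) (pre : List ℕ) (c : ℕ) :
    (P.cumulCount pre c : ℚ) = P.iota * P.cumul pre c := by
  rw [cumulCount, cumul, Finset.mul_sum]
  push_cast
  exact Finset.sum_congr rfl fun _ _ => hP.prefixCount_cast _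

theorem cumulCount_succ (P : Params) (pre : List ℕ) (c : ℕ) :
    P.cumulCount pre (c + 1) = P.cumulCount pre c + P.prefixCount (pre ++ [c]) :=
  Finset.sum_range_succ _ _

/-- No entry exceeds `μ`, so splitting the continuations by their next entry exhausts them. -/
theorem prefixCount_eq_cumulCount (P : Params) {pre : List ℕ} (h : pre.length < P.ℓ) :
    P.prefixCount pre = P.cumulCount pre (P.μ + 1) := by
  have key : ∀ L ∈ P.lists, L.take pre.length = pre →
      ∃ x ≤ P.μ, ∃ M, L = pre ++ x :: M := fun L hL htake => by
    obtain ⟨h1, h2, -, -⟩ := mem_sortedLists.1 hL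
    have hL' := List.take_append_drop pre.length L
    rw [htake] at hL'
    match hM : L.drop pre.length, hL' with
    | [], hL' => rw [List.append_nil] at hL'; rw [hL'] at h; omega
    | x :: M, hL' => exact ⟨x, h2 x (by rw [← hL']; simp), M, hL'.symm⟩
  rw [prefixCount, cumulCount, ← Finset.sum_fiberwise_of_maps_to
    (t := Finset.range (P.μ + 1)) (g := fun L => L.getD pre.length 0)]
  · refine Finset.sum_congr rfl fun t' _ => ?_
    rw [Finset.filter_filter, prefixCount]
    refine Finset.sum_congr (Finset.filter_congr fun L hL => ?_) fun _ _ => rfl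
    constructor
    · rintro ⟨h1, h2⟩
      obtain ⟨x, -, M, rfl⟩ := key L hL h1
      simp at h2
      simp [List.take_append, h2]
    · intro h1
      have h2 : L.take pre.length = pre := by
        have := congrArg (List.take pre.length) h1
        rwa [List.take_take, List.length_append, min_eq_left (by omega), List.take_left'] at this
        rfl
      obtain ⟨x, -, M, rfl⟩ := key L hL h2
      simp [List.take_append] at h1
      simp [h1]
  · intro L hL
    obtain ⟨x, hx, M, rfl⟩ := key L (Finset.mem_filter.1 hL).1 (Finset.mem_filter.1 hL).2
    simp
    omega

/-! ### The main loop with integers -/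

/-- The next entry found by the main loop. -/
def nextEntry (P : Params) (pre : List ℕ) (x : ℕ) : ℕ :=
  Nat.findGreatest (fun c => P.cumulCount pre c ≤ x) P.μ

/-- One round of the main loop, on integers. -/
def decodeStep (P : Params) (r : List ℕ × ℕ) : List ℕ × ℕ :=
  (r.1 ++ [P.nextEntry r.1 r.2], r.2 - P.cumulCount r.1 (P.nextEntry r.1 r.2))

theorem decodeStep_mk (P : Params) (pre : List ℕ) (x : ℕ) : P.decodeStep (pre, x) =
    (pre ++ [P.nextEntry pre x], x - P.cumulCount pre (P.nextEntry pre x)) := rfl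

theorem cumulCount_nextEntry_le (P : Params) (pre : List ℕ) (x : ℕ) :
    P.cumulCount pre (P.nextEntry pre x) ≤ x :=
  Nat.findGreatest_spec (P := fun c => P.cumulCount pre c ≤ x) (Nat.zero_le _)
    (by simp [cumulCount])

theorem nextEntry_le (P : Params) (pre : List ℕ) (x : ℕ) : P.nextEntry pre x ≤ P.μ :=
  Nat.findGreatest_le _

/-- This preserves the loop invariant `x < prefixCount pre`: the upper bound on `x` comes from
maximality of the chosen entry, or from the full count if that entry is `μ`. -/
theorem sub_cumulCount_nextEntry_lt (P : Params) {pre : List ℕ} (h : pre.length < P.ℓ) {x : ℕ}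
    (hx : x < P.prefixCount pre) : x - P.cumulCount pre (P.nextEntry pre x) <
      P.prefixCount (pre ++ [P.nextEntry pre x]) := by
  have h1 := P.cumulCount_nextEntry_le pre x
  have h2 : x < P.cumulCount pre (P.nextEntry pre x + 1) := by
    rcases (P.nextEntry_le pre x).eq_or_lt with he | hlt
    · rwa [he, ← P.prefixCount_eq_cumulCount h]
    · exact not_le.1 (Nat.findGreatest_is_greatest (P := fun c => P.cumulCount pre c ≤ x)
        (Nat.lt_succ_self _) hlt)
  rw [cumulCount_succ] at h2
  omega

/-- Scaling by `ι` turns the rational loop into one on natural numbers; the subtraction there is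
never truncated, as the subtracted count is at most `x`. -/
theorem Admissible.decodeLoop_eq (hP : P.Admissible) : ∀ (k : ℕ) (pre : List ℕ) (x : ℕ),
    P.decodeLoop k pre ((x : ℚ) / P.iota) = (P.decodeStep^[k] (pre, x)).1
  | 0, pre, x => rfl
  | k + 1, pre, x => by
    have hι : (0 : ℚ) < P.iota := by exact_mod_cast P.iota_pos
    have h1 : ∀ c, P.cumul pre c ≤ (x : ℚ) / P.iota ↔ P.cumulCount pre c ≤ x := fun c => by
      rw [le_div_iff₀ hι, mul_comm, ← hP.cumulCount_cast]; exact Nat.cast_le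
    have h2 : Nat.findGreatest (fun c => P.cumul pre c ≤ (x : ℚ) / P.iota) P.μ =
        P.nextEntry pre x := by simp only [h1]; rfl
    have h3 : (x : ℚ) / P.iota - P.cumul pre (P.nextEntry pre x) =
        ((x - P.cumulCount pre (P.nextEntry pre x) : ℕ) : ℚ) / P.iota := by
      rw [Nat.cast_sub (P.cumulCount_nextEntry_le pre x), hP.cumulCount_cast]
      field_simp
    rw [Function.iterate_succ_apply, decodeLoop]
    simp only [h2]
    rw [h3, hP.decodeLoop_eq k]
    rfl

theorem cumulCount_mono (P : Params) (pre : List ℕ) : Monotone (P.cumulCount pre) :=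
  monotone_nat_of_le_succ fun c => by rw [cumulCount_succ]; omega

theorem iterate_decodeStep_mem (P : Params) : ∀ (k : ℕ) {pre : List ℕ} {x : ℕ},
    pre.length + k = P.ℓ → x < P.prefixCount pre → (P.decodeStep^[k] (pre, x)).1 ∈ P.lists
  | 0, pre, x, hlen, hx => by
    obtain ⟨L, hL⟩ := Finset.nonempty_of_sum_ne_zero (Nat.ne_zero_of_lt hx)
    obtain ⟨h1, h2⟩ := Finset.mem_filter.1 hL
    rw [add_zero] at hlen
    rw [hlen, ← (mem_sortedLists.1 h1).1, List.take_length] at h2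
    exact h2 ▸ h1
  | k + 1, pre, x, hlen, hx => by
    rw [Function.iterate_succ_apply, decodeStep_mk]
    exact P.iterate_decodeStep_mem k (by simp; omega) (P.sub_cumulCount_nextEntry_lt (by omega) hx)

theorem nextEntry_eq_iff (P : Params) {pre : List ℕ} (h : pre.length < P.ℓ) {x : ℕ}
    (hx : x < P.prefixCount pre) (c : ℕ) : P.nextEntry pre x = c ↔
      P.cumulCount pre c ≤ x ∧ x < P.cumulCount pre (c + 1) := by
  have h1 := P.cumulCount_nextEntry_le pre x
  have h2 := P.sub_cumulCount_nextEntry_lt h hx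
  have h3 := P.cumulCount_succ pre (P.nextEntry pre x)
  constructor
  · rintro rfl; omega
  · rintro ⟨h4, h5⟩
    by_contra hne
    rcases lt_or_gt_of_ne hne with hlt | hlt
    · have := P.cumulCount_mono pre (Nat.succ_le_of_lt hlt)
      simp only [Nat.succ_eq_add_one] at this
      omega
    · have := P.cumulCount_mono pre (Nat.succ_le_of_lt hlt)
      simp only [Nat.succ_eq_add_one] at this
      omega

/-- Inversion of the cumulative distribution: the draws that select the next entry `c` of `L` form
an interval of length `prefixCount (pre ++ [c])`, on which the remaining rounds act as on a fresh
range. After the last round the range has length `natWeight L`. -/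
theorem card_iterate_decodeStep (P : Params) {L : List ℕ} (hL : L ∈ P.lists) :
    ∀ (k : ℕ) {pre : List ℕ}, pre.length + k = P.ℓ → L.take pre.length = pre →
      ((Finset.range (P.prefixCount pre)).filter fun x =>
        (P.decodeStep^[k] (pre, x)).1 = L).card = P.natWeight L
  | 0, pre, hlen, htake => by
    have h1 : pre = L := by
      rw [← htake, List.take_of_length_le]
      have := (mem_sortedLists.1 hL).1
      omega
    subst h1
    simp only [Function.iterate_zero, id_eq, Finset.filter_true, Finset.card_range, prefixCount]
    refine Finset.sum_eq_single_of_mem pre (Finset.mem_filter.2 ⟨hL, htake⟩) ?_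
    intro M hM hne
    obtain ⟨h2, h3⟩ := Finset.mem_filter.1 hM
    rw [(mem_sortedLists.1 hL).1, ← (mem_sortedLists.1 h2).1, List.take_length] at h3
    exact absurd h3 hne
  | k + 1, pre, hlen, htake => by
    have hk : pre.length < L.length := by have := (mem_sortedLists.1 hL).1; omega
    have htake' : L.take (pre ++ [L[pre.length]]).length = pre ++ [L[pre.length]] := by
      rw [List.length_append, List.length_singleton, List.take_add_one, htake]
      simp [hk]
    have ih := P.card_iterate_decodeStep hL k (pre := pre ++ [L[pre.length]])
      (by simp; omega) htake'
    generalize L[pre.length] = c at ih htake'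
    rw [← ih]
    have hle : P.cumulCount pre (c + 1) ≤ P.prefixCount pre := by
      rw [P.prefixCount_eq_cumulCount (by omega)]
      refine P.cumulCount_mono pre (Nat.succ_le_succ ((mem_sortedLists.1 hL).2.1 c ?_))
      have hmem : c ∈ L.take (pre ++ [c]).length := by rw [htake']; simp
      exact List.mem_of_mem_take hmem
    rw [cumulCount_succ] at hle
    -- Later rounds only append, so the outcome `L` forces the present round to choose `c`.
    have hstep : ∀ x, x < P.prefixCount pre →
        (P.decodeStep^[k + 1] (pre, x)).1 = L → P.nextEntry pre x = c := fun x hx h => by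
      rw [Function.iterate_succ_apply] at h
      have hpre : ∀ (j : ℕ) (r : List ℕ × ℕ), ∃ M, (P.decodeStep^[j] r).1 = r.1 ++ M := by
        intro j
        induction j with
        | zero => exact fun r => ⟨[], by simp⟩
        | succ j ih =>
          intro r
          obtain ⟨M, hM⟩ := ih (P.decodeStep r)
          exact ⟨_ :: M, by rw [Function.iterate_succ_apply, hM, decodeStep, List.append_assoc]; rfl⟩
      obtain ⟨M, hM⟩ := hpre k (P.decodeStep (pre, x))
      rw [h] at hM
      rw [hM, decodeStep] at htake'
      simp [List.take_append] at htake'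
      exact htake'
    -- The shift by `cumulCount pre c` identifies the range of the next round with the interval of
    -- draws that select `c`.
    refine (Finset.card_nbij (fun x => P.cumulCount pre c + x) ?_ ?_ ?_).symm
    · intro x hx
      obtain ⟨h1, h2⟩ := Finset.mem_filter.1 hx
      have h1 := Finset.mem_range.1 h1
      have hn := (P.nextEntry_eq_iff (pre := pre) (by omega) (x := P.cumulCount pre c + x)
        (by omega) c).2
        ⟨by omega, by rw [cumulCount_succ]; omega⟩
      change P.cumulCount pre c + x ∈ _
      refine Finset.mem_filter.2 ⟨Finset.mem_range.2 (by omega), ?_⟩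
      rw [Function.iterate_succ_apply, decodeStep_mk, hn, Nat.add_sub_cancel_left]
      exact h2
    · intro x _ y _ h
      simpa using h
    · intro y hy
      obtain ⟨h1, h2⟩ := Finset.mem_filter.1 hy
      have h1 := Finset.mem_range.1 h1
      have hn := hstep y h1 h2
      obtain ⟨h3, h4⟩ := (P.nextEntry_eq_iff (by omega) h1 c).1 hn
      rw [cumulCount_succ] at h4
      refine ⟨y - P.cumulCount pre c, Finset.mem_filter.2 ⟨Finset.mem_range.2 (by omega), ?_⟩,
        by simp; omega⟩
      rw [Function.iterate_succ_apply, decodeStep_mk, hn] at h2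
      exact h2

end Params

/-! ### The number of draws that lead to a given sorted vector -/

namespace Params

variable {P : Params}

/-- The sorted vector found by the main loop, as a list. -/
def decodeList (P : Params) (X : ℕ) : List ℕ := (P.decodeStep^[P.ℓ] ([], X)).1

theorem decodeList_mem (P : Params) {X : ℕ} (hX : X < P.prefixCount []) :
    P.decodeList X ∈ P.lists :=
  P.iterate_decodeStep_mem P.ℓ (by simp) hX

theorem Admissible.decode_apply (hP : P.Admissible) (X : ℕ) (i : Fin P.ℓ) :
    P.decode X i = (P.decodeList X).getD i 0 := by
  rw [decode, hP.decodeLoop_eq]; rfl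

theorem Admissible.ofFn_decode (hP : P.Admissible) {X : ℕ} (hX : X < P.prefixCount []) :
    List.ofFn (P.decode X) = P.decodeList X := by
  have hlen := (mem_sortedLists.1 (P.decodeList_mem hX)).1
  refine List.ext_getElem (by simp [hlen]) fun i h1 h2 => ?_
  rw [List.getElem_ofFn, hP.decode_apply]
  simp [h2]

theorem Admissible.decode_mem (hP : P.Admissible) {X : ℕ} (hX : X < P.prefixCount []) :
    P.decode X ∈ sortedDecomps P.t P.ℓ P.μ := by
  obtain ⟨v, hv, hv'⟩ := Finset.mem_image.1 (P.decodeList_mem hX)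
  rw [← hP.ofFn_decode hX] at hv'
  exact List.ofFn_injective hv' ▸ hv

theorem Admissible.iota_mul_Q (hP : P.Admissible) : (P.iota : ℚ) * P.Q = P.prefixCount [] := by
  rw [hP.Q_eq, hP.prefixCount_cast]

theorem Admissible.ceil_iota_mul_Q (hP : P.Admissible) :
    ⌈(P.iota : ℚ) * P.Q⌉₊ = P.prefixCount [] := by
  rw [hP.iota_mul_Q, Nat.ceil_natCast]

theorem Admissible.card_decode_eq (hP : P.Admissible) {u : Fin P.ℓ → ℕ}
    (hu : u ∈ sortedDecomps P.t P.ℓ P.μ) :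
    (((Finset.range (P.prefixCount [])).filter fun X => P.decode X = u).card : ℚ) =
      P.iota * P.weight u := by
  have hL : List.ofFn u ∈ P.lists := Finset.mem_image_of_mem _ hu
  rw [hP.weight_eq (Finset.mem_filter.1 hu).1, ← hP.natWeight_cast hL,
    ← P.card_iterate_decodeStep hL P.ℓ (pre := []) (by simp) (by simp)]
  congr 2
  refine Finset.filter_congr fun X hX => ?_
  rw [← decodeList, ← hP.ofFn_decode (Finset.mem_range.1 hX), List.ofFn_inj]

theorem Admissible.prefixCount_nil_pos (hP : P.Admissible) {v : Fin P.ℓ → ℕ}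
    (hv : v ∈ decomps P.t P.ℓ P.μ) : 0 < P.prefixCount [] := by
  have hL : List.ofFn (sortDesc v) ∈ P.lists := Finset.mem_image_of_mem _ (sortDesc_mem hv)
  exact (hP.natWeight_pos hL).trans_le <| Finset.single_le_sum (f := P.natWeight)
    (fun _ _ => Nat.zero_le _) (Finset.mem_filter.2 ⟨hL, by simp⟩)

end Params

/-! ### Uniform draws and the law of the returned vector -/

theorem unifBelow_eq {N : ℕ} (hN : 0 < N) :
    unifBelow N = PMF.uniformOfFinset (Finset.range N) (Finset.nonempty_range_iff.2 hN.ne') := by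
  have h : unifBelow N = PMF.uniformOfFinset (Finset.range (max N 1)) ⟨0, by simp⟩ := rfl
  rw [h]
  congr 2
  exact max_eq_left hN

theorem unifBelow_apply {N : ℕ} (hN : 0 < N) (x : ℕ) :
    unifBelow N x = if x ∈ Finset.range N then (N : ENNReal)⁻¹ else 0 := by
  rw [unifBelow_eq hN, PMF.uniformOfFinset_apply, Finset.card_range]
  congr

theorem unifBelow_bind_apply {α : Type*} {N : ℕ} (hN : 0 < N) (f : ℕ → PMF α) (a : α) :
    (unifBelow N).bind f a = ∑ x ∈ Finset.range N, (N : ENNReal)⁻¹ * f x a := by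
  rw [PMF.bind_apply, tsum_eq_sum (s := Finset.range N)]
  · exact Finset.sum_congr rfl fun x hx => by rw [unifBelow_apply hN, if_pos hx]
  · intro x hx
    rw [unifBelow_apply hN, if_neg hx, zero_mul]

theorem mem_support_unifBelow {N : ℕ} (hN : 0 < N) {x : ℕ} :
    x ∈ (unifBelow N).support ↔ x < N := by
  rw [unifBelow_eq hN, PMF.mem_support_uniformOfFinset_iff, Finset.mem_range]

namespace Params

variable {P : Params}

theorem draw_eq_bind (P : Params) : P.draw = (unifBelow ⌈(P.iota : ℚ) * P.Q⌉₊).bind fun X =>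
    PMF.uniformOfFinset (rearrangements (P.decode X)) (rearrangements_nonempty _) := by
  rw [draw, drawRun, PMF.map_bind]
  congr 1
  ext1 X
  rw [PMF.map_comp]
  exact PMF.map_id _

/-- The vector `v` can be returned only if `decode X = sortDesc v`, which holds for `ι ω` of the `ι
Q` draws, and is then returned with probability one over the orbit size. As `ω` is the orbit size
times `ϱ⁻¹`, the orbit size and `ι` cancel. -/
theorem Admissible.draw_toReal (hP : P.Admissible) (hne : 0 < P.prefixCount [])
    (v : Fin P.ℓ → ℕ) : (P.draw v).toReal = (P.target v : ℝ) := by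
  have hmem : ∀ X ∈ Finset.range (P.prefixCount []),
      (v ∈ rearrangements (P.decode X) ↔ P.decode X = sortDesc v) := fun X hX =>
    mem_rearrangements_iff fun i j h =>
      (Finset.mem_filter.1 (hP.decode_mem (Finset.mem_range.1 hX))).2 i j h
  have hdraw : P.draw v = (((Finset.range (P.prefixCount [])).filter fun X =>
      P.decode X = sortDesc v).card : ENNReal) *
        ((P.prefixCount [] : ENNReal)⁻¹ * ((rearrangements (sortDesc v)).card : ENNReal)⁻¹) := by
    rw [draw_eq_bind, hP.ceil_iota_mul_Q, unifBelow_bind_apply hne, ← nsmul_eq_mul,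
      ← Finset.sum_const, Finset.sum_filter]
    refine Finset.sum_congr rfl fun X hX => ?_
    rw [PMF.uniformOfFinset_apply]
    by_cases h : P.decode X = sortDesc v
    · rw [if_pos ((hmem X hX).2 h), if_pos h, h]
    · rw [if_neg (mt (hmem X hX).1 h), if_neg h, mul_zero]
  rw [hdraw, target]
  split_ifs with hv
  · have hs := sortDesc_mem hv
    have hs' := (Finset.mem_filter.1 hs).1
    have h1 := hP.card_decode_eq hs
    have hc : ((rearrangements (sortDesc v)).card : ℝ) ≠ 0 := by
      exact_mod_cast (Finset.card_pos.2 (rearrangements_nonempty _)).ne'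
    have hι : (P.iota : ℝ) ≠ 0 := by exact_mod_cast P.iota_pos.ne'
    have hr : rhoS P.q P.ζ P.s (sortDesc v) = rhoS P.q P.ζ P.s v := hP.rhoS_comp_perm hv _
    have hQ : (P.prefixCount [] : ℝ) = P.iota * P.Q := by exact_mod_cast hP.iota_mul_Q.symm
    have hQ0 : (P.Q : ℝ) ≠ 0 := fun h => by
      rw [h, mul_zero] at hQ
      exact hne.ne' (by exact_mod_cast hQ)
    rw [weight_eq_card hs', hr] at h1
    have h2 : (((Finset.range (P.prefixCount [])).filter fun X => P.decode X = sortDesc v).card : ℝ)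
        = P.iota * ((rearrangements (sortDesc v)).card * ((rhoS P.q P.ζ P.s v : ℚ) : ℝ)⁻¹) := by
      exact_mod_cast congrArg (fun x : ℚ => (x : ℝ)) h1
    simp only [ENNReal.toReal_mul, ENNReal.toReal_inv, ENNReal.toReal_natCast]
    rw [h2, hQ]
    push_cast
    field_simp
  · rw [Finset.filter_eq_empty_iff.2]
    · simp
    · intro X hX h
      obtain ⟨σ, -, hσ⟩ := Finset.mem_image.1 ((hmem X hX).2 h)
      exact hv (hσ ▸ comp_mem_decomps
        (Finset.mem_filter.1 (hP.decode_mem (Finset.mem_range.1 hX))).1 σ)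

/-- There is a weight decomposition. -/
theorem Admissible.decomps_nonempty (hP : P.Admissible) : (decomps P.t P.ℓ P.μ).Nonempty := by
  have key : ∀ ℓ t : ℕ, t ≤ ℓ * P.μ → ∃ L : List ℕ, L.length = ℓ ∧ (∀ x ∈ L, x ≤ P.μ) ∧ L.sum = t := by
    intro ℓ
    induction ℓ with
    | zero => exact fun t ht => ⟨[], rfl, by simp, by simp at ht ⊢; omega⟩
    | succ ℓ ih =>
      intro t ht
      rw [Nat.succ_mul] at ht
      obtain ⟨L, h1, h2, h3⟩ := ih (t - min t P.μ) (by omega)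
      refine ⟨min t P.μ :: L, by simp [h1], ?_, by simp [h3]⟩
      intro x hx
      rcases List.mem_cons.1 hx with rfl | hx
      · exact min_le_right _ _
      · exact h2 x hx
  obtain ⟨L, h1, h2, h3⟩ := key P.ℓ P.t (hP.t_le.trans hP.s_le)
  rw [← h3]
  have : ∀ ℓ, L.length = ℓ → (decomps L.sum ℓ P.μ).Nonempty := by
    rintro ℓ rfl
    exact ⟨L.get, mem_decomps.2 ⟨fun i => h2 _ (List.get_mem _ _), by
      rw [← List.sum_ofFn, List.ofFn_get]⟩⟩
  exact this _ h1

theorem Admissible.prefixCount_pos (hP : P.Admissible) : 0 < P.prefixCount [] :=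
  let ⟨_, hv⟩ := hP.decomps_nonempty
  hP.prefixCount_nil_pos hv

end Params

/-! ### Uniform permutations from factorial digits -/

/-- One round of the shuffle: the state is a permutation of `ℕ` and the remaining digits, and
round `i` exchanges `i` with a digit `≤ i`. -/
def shuffleStep (i : ℕ) (r : Equiv.Perm ℕ × ℕ) : Equiv.Perm ℕ × ℕ :=
  (r.1 * Equiv.swap i (r.2 % (i + 1)), r.2 / (i + 1))

/-- The state of the shuffle after `k` rounds. -/
def shuffle : ℕ → ℕ → Equiv.Perm ℕ × ℕ
  | 0, R => (1, R)
  | k + 1, R => shuffleStep k (shuffle k R)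

theorem shuffle_apply_of_le : ∀ {k j : ℕ} (R : ℕ), k ≤ j → (shuffle k R).1 j = j
  | 0, j, R, _ => rfl
  | k + 1, j, R, h => by
    have : (shuffle k R).2 % (k + 1) < k + 1 := Nat.mod_lt _ (by omega)
    rw [shuffle, shuffleStep, Equiv.Perm.mul_apply,
      Equiv.swap_apply_of_ne_of_ne (by omega) (by omega), shuffle_apply_of_le R (by omega)]

theorem shuffle_snd : ∀ k R : ℕ, (shuffle k R).2 = R / k !
  | 0, R => by simp [shuffle]
  | k + 1, R => by
    rw [shuffle, shuffleStep, shuffle_snd k, Nat.div_div_eq_div_mul, Nat.factorial_succ, mul_comm]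

/-- The last digit can be read off: `k` is fixed by the first `k` rounds, so after the exchange the
digit is the preimage of `k`. Undoing the exchange leads back to the previous state. -/
theorem shuffle_injective : ∀ k : ℕ, Function.Injective (shuffle k)
  | 0 => fun R S h => congrArg Prod.snd h
  | k + 1 => fun R S h => by
    refine shuffle_injective k ?_
    have h1 : (shuffleStep k (shuffle k R)) = shuffleStep k (shuffle k S) := h
    have hfix : ∀ R, (shuffleStep k (shuffle k R)).1 ((shuffle k R).2 % (k + 1)) = k := fun R => by
      rw [shuffleStep, Equiv.Perm.mul_apply, Equiv.swap_apply_right, shuffle_apply_of_le R le_rfl]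
    have hd : (shuffle k R).2 % (k + 1) = (shuffle k S).2 % (k + 1) := by
      refine (shuffleStep k (shuffle k R)).1.injective ?_
      rw [hfix R, h1, hfix S]
    have h2 := congrArg Prod.snd h1
    have h3 := congrArg Prod.fst h1
    simp only [shuffleStep] at h2 h3
    rw [hd] at h3
    refine Prod.ext (mul_right_cancel h3) ?_
    rw [← Nat.div_add_mod (shuffle k R).2 (k + 1), h2, hd, Nat.div_add_mod]

theorem shuffle_apply_lt {k j : ℕ} (R : ℕ) (h : j < k) : (shuffle k R).1 j < k := by
  by_contra hc
  have h1 := shuffle_apply_of_le R (not_lt.1 hc)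
  have := (shuffle k R).1.injective h1
  omega

/-- The permutation of `{0,…,ℓ-1}` described by `R`. -/
noncomputable def shufflePerm (ℓ R : ℕ) : Equiv.Perm (Fin ℓ) :=
  Equiv.ofBijective (fun i => ⟨(shuffle ℓ R).1 i, shuffle_apply_lt R i.2⟩)
    (Finite.injective_iff_bijective.1 fun i j h =>
      Fin.ext ((shuffle ℓ R).1.injective (by simpa using h)))

theorem shufflePerm_val {ℓ : ℕ} (R : ℕ) (i : Fin ℓ) :
    (shufflePerm ℓ R i : ℕ) = (shuffle ℓ R).1 i := rfl

/-- For `R < ℓ!` the digits are used up and nothing remains of `R`, so the permutation alone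
determines it. Counting then yields all permutations. -/
theorem shufflePerm_injOn (ℓ : ℕ) : Set.InjOn (shufflePerm ℓ) (Finset.range ℓ !) := by
  intro R hR S hS h
  refine shuffle_injective ℓ (Prod.ext (Equiv.ext fun j => ?_) ?_)
  · rcases lt_or_ge j ℓ with hj | hj
    · have := congrArg (fun σ => (σ ⟨j, hj⟩ : ℕ)) h
      simpa only [shufflePerm_val] using this
    · rw [shuffle_apply_of_le _ hj, shuffle_apply_of_le _ hj]
  · simp only [Finset.coe_range, Set.mem_Iio] at hR hS
    rw [shuffle_snd, shuffle_snd, Nat.div_eq_of_lt hR, Nat.div_eq_of_lt hS]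

theorem image_shufflePerm (ℓ : ℕ) : (Finset.range ℓ !).image (shufflePerm ℓ) = Finset.univ := by
  refine Finset.eq_univ_of_card _ ?_
  rw [Finset.card_image_of_injOn (shufflePerm_injOn ℓ), Finset.card_range, Fintype.card_perm,
    Fintype.card_fin]

/-- A uniformly random number below `ℓ!` yields a uniformly random rearrangement. -/
theorem map_shufflePerm {ℓ : ℕ} (u : Fin ℓ → ℕ) :
    (unifBelow ℓ !).map (fun R => u ∘ shufflePerm ℓ R) =
      PMF.uniformOfFinset (rearrangements u) (rearrangements_nonempty u) := by
  ext w
  rw [PMF.map, unifBelow_bind_apply (Nat.factorial_pos ℓ), PMF.uniformOfFinset_apply]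
  have h1 : ∑ R ∈ Finset.range ℓ !,
      ((ℓ ! : ℕ) : ENNReal)⁻¹ * (PMF.pure ∘ fun R => u ∘ shufflePerm ℓ R) R w =
      ∑ σ : Equiv.Perm (Fin ℓ), if u ∘ σ = w then ((ℓ ! : ℕ) : ENNReal)⁻¹ else 0 := by
    rw [← image_shufflePerm, Finset.sum_image (shufflePerm_injOn ℓ)]
    refine Finset.sum_congr rfl fun R _ => ?_
    rw [Function.comp_apply, PMF.pure_apply, mul_ite, mul_one, mul_zero]
    simp only [eq_comm]
    congr
  rw [h1, ← Finset.sum_filter, Finset.sum_const, nsmul_eq_mul]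
  obtain ⟨μ, hμ⟩ : ∃ μ, ∀ i, u i ≤ μ := ⟨∑ i, u i, fun i =>
    Finset.single_le_sum (fun _ _ => Nat.zero_le _) (Finset.mem_univ i)⟩
  split_ifs with hw
  -- Each rearrangement arises from `∏ δᵢ!` of the `ℓ!` permutations, which leaves the reciprocal of
  -- the number of rearrangements.
  · rw [card_filter_comp_eq u hμ hw, ← card_rearrangements u hμ]
    have h2 : (∏ a ∈ Finset.range (μ + 1), (mult u a)!) ≠ 0 :=
      Finset.prod_ne_zero_iff.2 fun a _ => (Nat.factorial_pos _).ne'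
    rw [Nat.cast_mul, ENNReal.mul_inv (Or.inr (ENNReal.natCast_ne_top _)) (Or.inr (by exact_mod_cast h2)),
      mul_comm, mul_assoc, ENNReal.inv_mul_cancel (by exact_mod_cast h2)
        (ENNReal.natCast_ne_top _), mul_one]
  · rw [Finset.filter_eq_empty_iff.2]
    · simp
    · intro σ _ h
      exact hw (Finset.mem_image.2 ⟨σ, Finset.mem_univ _, h⟩)

/-! ### Reasoning about deterministic programs -/

/-- The registers and addresses handled by the machine have at most `W` bits. -/
def Store.Bounded (W : ℕ) (σ : Store) : Prop := ∀ r, σ.reg r < 2 ^ W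

/-- The largest cost of an operation on integers of at most `W` bits. -/
def opCost (W : ℕ) : ℕ := 1 + quasiLinear (2 * W)

@[simp] theorem Store.setReg_reg (σ : Store) (d x r : ℕ) :
    (σ.setReg d x).reg r = if r = d then x else σ.reg r := by
  simp [Store.setReg, Function.update_apply]

@[simp] theorem Store.setReg_arr (σ : Store) (d x : ℕ) : (σ.setReg d x).arr = σ.arr := rfl

@[simp] theorem Store.setArr_reg (σ : Store) (A i x : ℕ) : (σ.setArr A i x).reg = σ.reg := rfl

@[simp] theorem Store.setArr_arr (σ : Store) (A i x B j : ℕ) :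
    (σ.setArr A i x).arr B j = if B = A then if j = i then x else σ.arr A j else σ.arr B j := by
  simp only [Store.setArr, Function.update_apply]
  split_ifs <;> simp_all

/-- The effect of a deterministic instruction. -/
def Instr.step (σ : Store) : Instr → Store
  | .const d c => σ.setReg d c
  | .copy d a => σ.setReg d (σ.reg a)
  | .add d a b => σ.setReg d (σ.reg a + σ.reg b)
  | .sub d a b => σ.setReg d (σ.reg a - σ.reg b)
  | .mul d a b => σ.setReg d (σ.reg a * σ.reg b)
  | .div d a b => σ.setReg d (σ.reg a / σ.reg b)
  | .mod d a b => σ.setReg d (σ.reg a % σ.reg b)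
  | .load d A a => σ.setReg d (σ.arr A (σ.reg a))
  | .store A a b => σ.setArr A (σ.reg a) (σ.reg b)
  | .rand _ _ => σ

/-- The instruction is deterministic and its result has at most `W` bits. -/
def Instr.Safe (W : ℕ) (σ : Store) : Instr → Prop
  | .const _ c => c < 2 ^ W
  | .add _ a b => σ.reg a + σ.reg b < 2 ^ W
  | .mul _ a b => σ.reg a * σ.reg b < 2 ^ W
  | .load _ A a => σ.arr A (σ.reg a) < 2 ^ W
  | .rand _ _ => False
  | _ => True

theorem quasiLinear_mono : Monotone quasiLinear := fun _ _ h =>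
  Nat.mul_le_mul h (Nat.succ_le_succ (Nat.log_mono_right h))

theorem le_quasiLinear (L : ℕ) : L ≤ quasiLinear L := Nat.le_mul_of_pos_right _ (Nat.succ_pos _)

theorem Store.Bounded.setReg {W : ℕ} {σ : Store} (h : σ.Bounded W) {d x : ℕ} (hx : x < 2 ^ W) :
    (σ.setReg d x).Bounded W := fun r => by
  rw [Store.setReg_reg]; split_ifs
  exacts [hx, h r]

theorem Instr.eval_eq {W : ℕ} {σ : Store} {i : Instr} (h : i.Safe W σ) :
    i.eval σ = PMF.pure (i.step σ) := by
  cases i <;> first | rfl | exact h.elim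

theorem Instr.step_bounded {W : ℕ} {σ : Store} (hσ : σ.Bounded W) {i : Instr} (h : i.Safe W σ) :
    (i.step σ).Bounded W := by
  cases i with
  | const d c => exact hσ.setReg h
  | copy d a => exact hσ.setReg (hσ a)
  | add d a b => exact hσ.setReg h
  | sub d a b => exact hσ.setReg ((Nat.sub_le _ _).trans_lt (hσ a))
  | mul d a b => exact hσ.setReg h
  | div d a b => exact hσ.setReg ((Nat.div_le_self _ _).trans_lt (hσ a))
  | mod d a b => exact hσ.setReg ((Nat.mod_le _ _).trans_lt (hσ a))
  | load d A a => exact hσ.setReg h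
  | store A a b => exact fun r => hσ r
  | rand d a => exact hσ

theorem Instr.cost_le {W : ℕ} {σ : Store} (hσ : σ.Bounded W) {i : Instr} (h : i.Safe W σ) :
    i.cost σ ≤ opCost W := by
  have hs : ∀ r, (σ.reg r).size ≤ W := fun r => Nat.size_le.2 (hσ r)
  have hW := le_quasiLinear (2 * W)
  have hq : ∀ a b, quasiLinear ((σ.reg a).size + (σ.reg b).size) ≤ quasiLinear (2 * W) :=
    fun a b => quasiLinear_mono (by have := hs a; have := hs b; omega)
  cases i with
  | const d c =>
    have : c.size ≤ W := Nat.size_le.2 h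
    simp only [Instr.cost, opCost]; omega
  | copy d a => have := hs a; simp only [Instr.cost, opCost]; omega
  | add d a b => have := hs a; have := hs b; simp only [Instr.cost, opCost]; omega
  | sub d a b => have := hs a; have := hs b; simp only [Instr.cost, opCost]; omega
  | mul d a b => have := hq a b; simp only [Instr.cost, opCost]; omega
  | div d a b => have := hq a b; simp only [Instr.cost, opCost]; omega
  | mod d a b => have := hq a b; simp only [Instr.cost, opCost]; omega
  | load d A a =>
    have h1 := hs a
    have h2 : (σ.arr A (σ.reg a)).size ≤ W := Nat.size_le.2 h
    simp only [Instr.cost, opCost]; omega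
  | store A a b => have := hs a; have := hs b; simp only [Instr.cost, opCost]; omega
  | rand d a => exact h.elim

/-- Started in `σ` with registers of at most `W` bits, `c` runs deterministically, with cost at
most `T * opCost W`, to a store with registers of at most `W` bits that satisfies `Q`. -/
def Ok (W : ℕ) (c : Program) (σ : Store) (T : ℕ) (Q : Store → Prop) : Prop :=
  σ.Bounded W → ∃ τ k, Runs c σ (PMF.pure (τ, k)) ∧ k ≤ T * opCost W ∧ τ.Bounded W ∧ Q τ

theorem Ok.mono {W : ℕ} {c : Program} {σ : Store} {T T' : ℕ} {Q Q' : Store → Prop}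
    (h : Ok W c σ T Q) (hT : T ≤ T') (hQ : ∀ τ, Q τ → Q' τ) : Ok W c σ T' Q' := fun hσ =>
  let ⟨τ, k, h1, h2, h3, h4⟩ := h hσ
  ⟨τ, k, h1, h2.trans (Nat.mul_le_mul_right _ hT), h3, hQ τ h4⟩

theorem Ok.instr {W : ℕ} {i : Instr} {σ : Store} {Q : Store → Prop} (hi : i.Safe W σ)
    (hQ : Q (i.step σ)) : Ok W (.instr i) σ 1 Q := fun hσ => by
  refine ⟨i.step σ, i.cost σ, ?_, by simpa using Instr.cost_le hσ hi, Instr.step_bounded hσ hi, hQ⟩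
  have := Runs.instr i σ
  rwa [Instr.eval_eq hi, PMF.pure_map] at this

theorem Runs.seq_pure {c d : Program} {σ τ : Store} {k : ℕ} {D : PMF (Store × ℕ)}
    (hc : Runs c σ (PMF.pure (τ, k))) (hd : Runs d τ D) :
    Runs (.seq c d) σ (D.map fun r => (r.1, k + r.2)) := by
  have := Runs.seq (E := fun _ => D) hc fun r hr => by
    obtain rfl : r = (τ, k) := by simpa using hr
    exact hd
  rwa [PMF.pure_bind] at this

theorem Ok.seq {W : ℕ} {c d : Program} {σ : Store} {T T' : ℕ} {R Q : Store → Prop}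
    (hc : Ok W c σ T R) (hd : ∀ τ, R τ → Ok W d τ T' Q) : Ok W (.seq c d) σ (T + T') Q := fun hσ => by
  obtain ⟨τ, k, h1, h2, h3, h4⟩ := hc hσ
  obtain ⟨υ, l, h5, h6, h7, h8⟩ := hd τ h4 h3
  refine ⟨υ, k + l, ?_, by rw [Nat.add_mul]; omega, h7, h8⟩
  have := h1.seq_pure h5
  rwa [PMF.pure_map] at this

theorem size_le_opCost {W x : ℕ} (h : x < 2 ^ W) : 1 + x.size ≤ opCost W := by
  have h1 : x.size ≤ W := Nat.size_le.2 h
  have h2 := le_quasiLinear (2 * W)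
  rw [opCost]; omega

theorem Ok.ite {W a : ℕ} {c d : Program} {σ : Store} {T : ℕ} {Q : Store → Prop}
    (hc : σ.reg a ≠ 0 → Ok W c σ T Q) (hd : σ.reg a = 0 → Ok W d σ T Q) :
    Ok W (.ite a c d) σ (T + 1) Q := fun hσ => by
  have hs := size_le_opCost (hσ a)
  by_cases ha : σ.reg a = 0
  · obtain ⟨τ, k, h1, h2, h3, h4⟩ := hd ha hσ
    refine ⟨τ, 1 + k, ?_, by rw [Nat.add_mul]; omega, h3, h4⟩
    have := Runs.ite_false (c := c) ha h1
    rwa [PMF.pure_map] at this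
  · obtain ⟨τ, k, h1, h2, h3, h4⟩ := hc ha hσ
    refine ⟨τ, 1 + (σ.reg a).size + k, ?_, by rw [Nat.add_mul]; omega, h3, h4⟩
    have := Runs.ite_true (d := d) ha h1
    rwa [PMF.pure_map] at this

/-- Termination is built into the invariant: its index is the content of the loop register and drops
by one per round. Every test of that register, including the final one, is charged one further
`opCost W`. -/
theorem Ok.loop {W a : ℕ} {c : Program} {T : ℕ} {I : ℕ → Store → Prop}
    (hI : ∀ n σ, I n σ → σ.reg a = n) (hc : ∀ n σ, I (n + 1) σ → Ok W c σ T (I n)) :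
    ∀ n σ, I n σ → Ok W (.loop a c) σ (n * (T + 1) + 1) (I 0)
  | 0, σ, h => fun hσ => by
    have hs := size_le_opCost (hσ a)
    exact ⟨σ, 1, Runs.loop_done (hI 0 σ h), by omega, hσ, h⟩
  | n + 1, σ, h => fun hσ => by
    obtain ⟨τ, k, h1, h2, h3, h4⟩ := (hc n σ h).seq (Ok.loop hI hc n) hσ
    have hs := size_le_opCost (hσ a)
    refine ⟨τ, 1 + (σ.reg a).size + k, ?_, ?_, h3, h4⟩
    · have := Runs.loop_step (by rw [hI _ σ h]; omega) h1
      rwa [PMF.pure_map] at this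
    · calc 1 + (σ.reg a).size + k ≤ opCost W + (T + (n * (T + 1) + 1)) * opCost W := by omega
        _ = ((n + 1) * (T + 1) + 1) * opCost W := by ring

/-! ### Straight-line code -/

/-- A sequence of instructions. -/
def Program.block : List Instr → Program
  -- A program without effect; it accounts for the `+ 1` in the cost of blocks.
  | [] => .instr (.copy 9 9)
  | i :: is => .seq (.instr i) (block is)

/-- The condition under which a sequence of instructions leads to a store that satisfies `Q`. -/
def blockPre (W : ℕ) (Q : Store → Prop) : List Instr → Store → Prop
  | [], σ => Q σ
  | i :: is, σ => i.Safe W σ ∧ blockPre W Q is (i.step σ)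

/-- Straight-line code is reduced to symbolic execution: unfolding `blockPre` leaves size conditions
and the claim about the final store. -/
theorem Ok.block {W : ℕ} {Q : Store → Prop} : ∀ {is : List Instr} {σ : Store},
    blockPre W Q is σ → Ok W (.block is) σ (is.length + 1) Q
  | [], σ, h => Ok.instr trivial (by
      have : Instr.step σ (.copy 9 9) = σ := by simp [Instr.step, Store.setReg]
      rw [this]; exact h)
  | i :: is, σ, h => ((Ok.instr h.1 h.2).seq fun _ => Ok.block).mono
      (by rw [List.length_cons]; omega) fun _ => id

/-! ### Frames -/

/-- The registers that an instruction may change. -/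
def Instr.regs : Instr → List ℕ
  | .const d _ | .copy d _ | .add d _ _ | .sub d _ _ | .mul d _ _ | .div d _ _ | .mod d _ _
  | .load d _ _ | .rand d _ => [d]
  | .store _ _ _ => []

/-- The arrays that an instruction may change. -/
def Instr.arrs : Instr → List ℕ
  | .store A _ _ => [A]
  | _ => []

/-- The registers that a program may change. -/
def Program.regs : Program → List ℕ
  | .instr i => i.regs
  | .seq c d => c.regs ++ d.regs
  | .ite _ c d => c.regs ++ d.regs
  | .loop _ c => c.regs

/-- The arrays that a program may change. -/
def Program.arrs : Program → List ℕ
  | .instr i => i.arrs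
  | .seq c d => c.arrs ++ d.arrs
  | .ite _ c d => c.arrs ++ d.arrs
  | .loop _ c => c.arrs

/-- The stores `σ` and `τ` agree on what the program `c` cannot change. -/
structure Frame (c : Program) (σ τ : Store) : Prop where
  reg : ∀ r, r ∉ c.regs → τ.reg r = σ.reg r
  arr : ∀ A, A ∉ c.arrs → τ.arr A = σ.arr A

theorem Frame.refl (c : Program) (σ : Store) : Frame c σ σ := ⟨fun _ _ => rfl, fun _ _ => rfl⟩

theorem Frame.trans {c : Program} {σ τ υ : Store} (h : Frame c σ τ) (h' : Frame c τ υ) :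
    Frame c σ υ :=
  ⟨fun r hr => (h'.reg r hr).trans (h.reg r hr), fun A hA => (h'.arr A hA).trans (h.arr A hA)⟩

theorem Frame.weaken {c d : Program} {σ τ : Store} (h : Frame c σ τ)
    (hr : ∀ r ∈ c.regs, r ∈ d.regs) (hA : ∀ A ∈ c.arrs, A ∈ d.arrs) : Frame d σ τ :=
  ⟨fun r h' => h.reg r fun h'' => h' (hr r h''), fun A h' => h.arr A fun h'' => h' (hA A h'')⟩

theorem frame_setReg {i : Instr} {σ : Store} {d x : ℕ} (h : d ∈ i.regs) :
    Frame (.instr i) σ (σ.setReg d x) :=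
  ⟨fun r hr => by
    rw [Store.setReg_reg, if_neg]
    rintro rfl
    exact hr h, fun _ _ => rfl⟩

theorem Instr.frame {i : Instr} {σ τ : Store} (h : τ ∈ (i.eval σ).support) :
    Frame (.instr i) σ τ := by
  cases i with
  | store A a b =>
    obtain rfl : τ = σ.setArr A (σ.reg a) (σ.reg b) := by simpa [Instr.eval] using h
    refine ⟨fun _ _ => rfl, fun B hB => ?_⟩
    have : B ≠ A := by
      rintro rfl
      exact hB (by simp [Program.arrs, Instr.arrs])
    simp [Store.setArr, this]
  | rand d a =>
    rw [Instr.eval, PMF.support_map] at h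
    obtain ⟨x, -, rfl⟩ := h
    exact frame_setReg (by simp [Instr.regs])
  | _ =>
    rw [Instr.eval, PMF.support_pure, Set.mem_singleton_iff] at h
    subst h
    exact frame_setReg (by simp [Instr.regs])

/-- What a program may change is read off its syntax, so the side conditions are settled by
`decide`, and a correctness lemma only describes what does change. -/
theorem Runs.frame {c : Program} {σ : Store} {D : PMF (Store × ℕ)} (h : Runs c σ D) :
    ∀ r ∈ D.support, Frame c σ r.1 := by
  induction h with
  | instr i σ =>
    intro r hr
    rw [PMF.support_map] at hr
    obtain ⟨τ, hτ, rfl⟩ := hr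
    exact Instr.frame hτ
  | seq _ _ ih1 ih2 =>
    intro r hr
    rw [PMF.mem_support_bind_iff] at hr
    obtain ⟨p, hp, hr⟩ := hr
    rw [PMF.support_map] at hr
    obtain ⟨p', hp', rfl⟩ := hr
    exact ((ih1 p hp).weaken (by simp +contextual [Program.regs])
      (by simp +contextual [Program.arrs])).trans ((ih2 p hp p' hp').weaken
      (by simp +contextual [Program.regs]) (by simp +contextual [Program.arrs]))
  | ite_true _ _ ih =>
    intro r hr
    rw [PMF.support_map] at hr
    obtain ⟨p, hp, rfl⟩ := hr
    exact (ih p hp).weaken (by simp +contextual [Program.regs])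
      (by simp +contextual [Program.arrs])
  | ite_false _ _ ih =>
    intro r hr
    rw [PMF.support_map] at hr
    obtain ⟨p, hp, rfl⟩ := hr
    exact (ih p hp).weaken (by simp +contextual [Program.regs])
      (by simp +contextual [Program.arrs])
  | loop_done _ =>
    intro r hr
    rw [PMF.support_pure, Set.mem_singleton_iff] at hr
    subst hr
    exact Frame.refl _ _
  | loop_step _ _ ih =>
    intro r hr
    rw [PMF.support_map] at hr
    obtain ⟨p, hp, rfl⟩ := hr
    exact (ih p hp).weaken (by simp [Program.regs]) (by simp [Program.arrs])

theorem Ok.frame {W : ℕ} {c : Program} {σ : Store} {T : ℕ} {Q : Store → Prop}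
    (h : Ok W c σ T Q) : Ok W c σ T fun τ => Q τ ∧ Frame c σ τ := fun hσ =>
  let ⟨τ, k, h1, h2, h3, h4⟩ := h hσ
  ⟨τ, k, h1, h2, h3, h4, h1.frame (τ, k) (by simp)⟩

/-- The rule for loops whose register `a` counts down the rounds. -/
theorem Ok.loop_frame {W a : ℕ} {c : Program} {T : ℕ} {I : ℕ → Store → Prop} {n : ℕ} {σ : Store}
    (hI : ∀ n τ, I n τ → τ.reg a = n)
    (hc : ∀ n τ, I (n + 1) τ → Frame c σ τ → Ok W c τ T (I n)) (h : I n σ) :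
    Ok W (.loop a c) σ (n * (T + 1) + 1) fun τ => I 0 τ ∧ Frame c σ τ :=
  Ok.loop (I := fun n τ => I n τ ∧ Frame c σ τ) (fun n τ h => hI n τ h.1)
    (fun n τ h => (hc n τ h.1 h.2).frame.mono le_rfl fun _ h' => ⟨h'.1, h.2.trans h'.2⟩) n σ
    ⟨h, Frame.refl _ _⟩

/-! ### The table of Gaussian binomials -/

/-- The table of Gaussian binomials, stored in rows of length `m`. -/
def pascal (q m j : ℕ) : ℕ := gaussBinom q (j / m) (j % m)

theorem pascal_mul_add (q : ℕ) {m a b : ℕ} (hb : b < m) :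
    pascal q m (a * m + b) = gaussBinom q a b := by
  rw [pascal, mul_comm, Nat.mul_add_div (by omega), Nat.div_eq_of_lt hb, Nat.mul_add_mod,
    Nat.mod_eq_of_lt hb, add_zero]

theorem gaussBinom_le_top {q ζ μ a b : ℕ} (hq : 2 ≤ q) (ha : a ≤ ζ + 1) (hb : b ≤ μ) :
    gaussBinom q a b ≤ q ^ ((ζ + 1) * (μ + 1)) :=
  (gaussBinom_le_pow hq a b).trans
    (Nat.pow_le_pow_right (by omega) (Nat.mul_le_mul ha (Nat.succ_le_succ hb)))

/-- One entry of a row of the table. -/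
def pascalBody : Program := .block [.load 17 3 15, .add 15 15 6, .load 18 3 15, .mul 18 13 18,
  .add 17 17 18, .add 16 16 6, .store 3 16 17, .mul 13 13 0, .sub 14 14 6]

/-- One row of the table. -/
def pascalRow : Program :=
  .seq (.block [.add 12 11 7, .store 3 12 6, .copy 13 0, .copy 14 5, .copy 15 11, .copy 16 12])
    (.seq (.loop 14 pascalBody) (.block [.copy 11 12, .sub 10 10 6]))

/-- The table of the numbers `[a choose b]_q`, `a ≤ ζ + 1`, `b ≤ μ`, is written to array `3`. -/
def pascalProg : Program :=
  -- From here on registers `6`, `7`, `8` hold `1`, `μ + 1`, `0`. Array `3` is initially zero, so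
  -- row `0` needs only its first cell.
  .seq (.block [.const 6 1, .add 7 5 6, .store 3 8 6, .add 10 1 6, .copy 11 8])
    (.loop 10 pascalRow)

/-- Registers `15` and `16` point to column `b` of the rows `a` and `a + 1`, and register `13` holds
the coefficient `q ^ (b + 1)` of the recursion. -/
theorem pascalBody_ok {W q ζ μ a b n : ℕ} (hq : 2 ≤ q) (ha : a ≤ ζ)
    (hS : (ζ + 2) * (μ + 1) < 2 ^ W) (hΓ : q ^ ((ζ + 1) * (μ + 1)) < 2 ^ W) (hb : b + (n + 1) = μ)
    {σ : Store} (h0 : σ.reg 0 = q) (h6 : σ.reg 6 = 1) (h13 : σ.reg 13 = q ^ (b + 1))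
    (h14 : σ.reg 14 = n + 1) (h15 : σ.reg 15 = a * (μ + 1) + b)
    (h16 : σ.reg 16 = (a + 1) * (μ + 1) + b)
    (h3 : ∀ j ≤ (a + 1) * (μ + 1) + b, σ.arr 3 j = pascal q (μ + 1) j) :
    Ok W pascalBody σ 10 fun τ => τ.reg 14 = n ∧ τ.reg 13 = q ^ (b + 1 + 1) ∧
      τ.reg 15 = a * (μ + 1) + (b + 1) ∧ τ.reg 16 = (a + 1) * (μ + 1) + (b + 1) ∧
      ∀ j ≤ (a + 1) * (μ + 1) + (b + 1), τ.arr 3 j = pascal q (μ + 1) j := by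
  have hrow : (a + 1) * (μ + 1) = a * (μ + 1) + (μ + 1) := by ring
  have hmul := Nat.mul_le_mul_right (μ + 1) (show a + 2 ≤ ζ + 2 by omega)
  have hrow2 : (a + 2) * (μ + 1) = a * (μ + 1) + (μ + 1) + (μ + 1) := by ring
  have e1 : σ.arr 3 (a * (μ + 1) + b) = gaussBinom q a b := by
    rw [h3 _ (by omega), pascal_mul_add _ (by omega)]
  have e2 : σ.arr 3 (a * (μ + 1) + b + 1) = gaussBinom q a (b + 1) := by
    rw [h3 _ (by omega), add_assoc, pascal_mul_add _ (by omega)]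
  have e3 : pascal q (μ + 1) ((a + 1) * (μ + 1) + b + 1) =
      gaussBinom q a b + q ^ (b + 1) * gaussBinom q a (b + 1) := by
    rw [add_assoc, pascal_mul_add _ (by omega)]; rfl
  have l1 := gaussBinom_le_top (ζ := ζ) (μ := μ) (a := a + 1) (b := b + 1) hq (by omega) (by omega)
  have l2 := gaussBinom_le_top (ζ := ζ) (μ := μ) (a := a) (b := b + 1) hq (by omega) (by omega)
  -- The power prepared for the next column must fit too; `b + 2 ≤ μ + 1` suffices.
  have l3 : q ^ (b + 1) * q ≤ q ^ ((ζ + 1) * (μ + 1)) := by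
    rw [← pow_succ]
    refine Nat.pow_le_pow_right (by omega) ?_
    have := Nat.mul_le_mul_right (μ + 1) (show 1 ≤ ζ + 1 by omega)
    omega
  simp only [gaussBinom] at l1
  refine (Ok.block ?_).mono (T := 10) le_rfl fun _ => id
  simp only [blockPre, Instr.Safe, Instr.step, Store.setReg_reg, Store.setReg_arr,
    Store.setArr_arr, Store.setArr_reg, h0, h6, h13, h14, h15, h16, e1, e2, Nat.reduceEqDiff,
    if_true, if_false, OfNat.zero_ne_ofNat, true_and]
  refine ⟨by omega, by omega, by omega, by omega, by omega, by omega, by omega, by omega, ?_, rfl,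
    by omega, fun j hj => ?_⟩
  · exact (pow_succ _ _).symm
  · split_ifs with hj'
    · rw [hj', e3]
    · exact h3 j (by omega)

theorem pascalRow_ok {W q ζ μ a n : ℕ} (hq : 2 ≤ q) (ha : a + (n + 1) = ζ + 1)
    (hS : (ζ + 2) * (μ + 1) < 2 ^ W) (hΓ : q ^ ((ζ + 1) * (μ + 1)) < 2 ^ W)
    {σ : Store} (h0 : σ.reg 0 = q) (h5 : σ.reg 5 = μ) (h6 : σ.reg 6 = 1) (h7 : σ.reg 7 = μ + 1)
    (h10 : σ.reg 10 = n + 1) (h11 : σ.reg 11 = a * (μ + 1))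
    (h3 : ∀ j < (a + 1) * (μ + 1), σ.arr 3 j = pascal q (μ + 1) j) :
    Ok W pascalRow σ (11 + μ * 11) fun τ => τ.reg 10 = n ∧ τ.reg 11 = (a + 1) * (μ + 1) ∧
      ∀ j < (a + 2) * (μ + 1), τ.arr 3 j = pascal q (μ + 1) j := by
  have hrow : (a + 1) * (μ + 1) = a * (μ + 1) + (μ + 1) := by ring
  have hmul := Nat.mul_le_mul_right (μ + 1) (show a + 2 ≤ ζ + 2 by omega)
  have hrow2 : (a + 2) * (μ + 1) = a * (μ + 1) + (μ + 1) + (μ + 1) := by ring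
  have e0 : pascal q (μ + 1) ((a + 1) * (μ + 1)) = 1 := by
    rw [← add_zero ((a + 1) * (μ + 1)), pascal_mul_add _ (by omega)]; rfl
  refine (Ok.seq (R := fun τ => (τ.reg 14 = μ ∧ τ.reg 13 = q ∧ τ.reg 15 = a * (μ + 1) ∧
      τ.reg 16 = (a + 1) * (μ + 1) ∧ τ.reg 12 = (a + 1) * (μ + 1) ∧
      ∀ j ≤ (a + 1) * (μ + 1), τ.arr 3 j = pascal q (μ + 1) j) ∧ Frame (.block _) σ τ)
    (Ok.block ?_).frame (T' := μ * 11 + 4) fun τ => ?_).mono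
    (by simp only [List.length_cons, List.length_nil]; omega) fun _ => id
  · simp only [blockPre, Instr.Safe, Instr.step, Store.setReg_reg, Store.setReg_arr,
      Store.setArr_arr, Store.setArr_reg, h0, h5, h6, h7, h11, Nat.reduceEqDiff,
      if_true, if_false, OfNat.zero_ne_ofNat, true_and]
    refine ⟨by omega, by omega, by omega, fun j hj => ?_⟩
    split_ifs with hj'
    · rw [hj', ← hrow, e0]
    · exact h3 j (by omega)
  · rintro ⟨⟨h14, h13, h15, h16, h12, h3'⟩, hf⟩
    have f0 := (hf.reg 0 (by decide)).trans h0
    have f6 := (hf.reg 6 (by decide)).trans h6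
    have f10 := (hf.reg 10 (by decide)).trans h10
    have hloop := Ok.loop_frame (W := W) (a := 14) (c := pascalBody) (T := 10) (n := μ) (σ := τ)
      (I := fun m υ => ∃ b, b + m = μ ∧ υ.reg 14 = m ∧ υ.reg 13 = q ^ (b + 1) ∧
        υ.reg 15 = a * (μ + 1) + b ∧ υ.reg 16 = (a + 1) * (μ + 1) + b ∧
        ∀ j ≤ (a + 1) * (μ + 1) + b, υ.arr 3 j = pascal q (μ + 1) j)
      (fun m υ ⟨b, _, h, _⟩ => h)
      (fun m υ ⟨b, hb, g14, g13, g15, g16, g3⟩ hf' =>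
        (pascalBody_ok hq (by omega) hS hΓ hb ((hf'.reg 0 (by decide)).trans f0)
          ((hf'.reg 6 (by decide)).trans f6) g13 g14 g15 g16 g3).mono le_rfl fun ω hω =>
            ⟨b + 1, by omega, hω.1, hω.2⟩)
      ⟨0, by omega, h14, by simpa using h13, by simpa using h15, by simpa using h16,
        by simpa using h3'⟩
    refine (hloop.seq fun υ => ?_).mono (T := μ * 11 + 1 + 3) (by omega) fun _ => id
    rintro ⟨⟨b, hb, -, -, -, -, g3⟩, hf'⟩
    refine (Ok.block ?_).mono (T := 3) le_rfl fun _ => id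
    simp only [blockPre, Instr.Safe, Instr.step, Store.setReg_reg, Store.setReg_arr,
      (hf'.reg 12 (by decide)).trans h12, (hf'.reg 10 (by decide)).trans f10,
      (hf'.reg 6 (by decide)).trans f6, Nat.reduceEqDiff, if_true, if_false, true_and]
    exact ⟨by omega, fun j hj => g3 j (by omega)⟩

/-- Row `ζ + 1` is included because `blockDen` refers to the row after the quotient. The quotient
can be `ζ`; the exponent is then `0`, but the program loads the cell all the same. -/
theorem pascalProg_ok {W q ζ μ : ℕ} (hq : 2 ≤ q)
    (hS : (ζ + 2) * (μ + 1) < 2 ^ W) (hΓ : q ^ ((ζ + 1) * (μ + 1)) < 2 ^ W)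
    {σ : Store} (h0 : σ.reg 0 = q) (h1 : σ.reg 1 = ζ) (h5 : σ.reg 5 = μ) (h8 : σ.reg 8 = 0)
    (h3 : ∀ j, σ.arr 3 j = 0) :
    Ok W pascalProg σ (7 + (ζ + 1) * (12 + μ * 11)) fun τ => τ.reg 6 = 1 ∧ τ.reg 7 = μ + 1 ∧
      ∀ j < (ζ + 2) * (μ + 1), τ.arr 3 j = pascal q (μ + 1) j := by
  have hm : (ζ + 2) * (μ + 1) = ζ * (μ + 1) + 2 * μ + 2 := by ring
  have hm' : ζ ≤ ζ * (μ + 1) := Nat.le_mul_of_pos_right _ (by omega)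
  refine (Ok.seq (R := fun τ => (τ.reg 6 = 1 ∧ τ.reg 7 = μ + 1 ∧ τ.reg 10 = ζ + 1 ∧
      τ.reg 11 = 0 ∧ ∀ j < μ + 1, τ.arr 3 j = pascal q (μ + 1) j) ∧ Frame (.block _) σ τ)
    (Ok.block ?_).frame (T' := (ζ + 1) * (12 + μ * 11) + 1) fun τ => ?_).mono
    (by simp only [List.length_cons, List.length_nil]; omega) fun _ => id
  · simp only [blockPre, Instr.Safe, Instr.step, Store.setReg_reg, Store.setReg_arr,
      Store.setArr_arr, Store.setArr_reg, h1, h5, h8, h3, Nat.reduceEqDiff,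
      if_true, if_false, OfNat.one_ne_ofNat, true_and]
    refine ⟨by omega, by omega, by omega, fun j hj => ?_⟩
    have := pascal_mul_add q (a := 0) hj
    rw [zero_mul, zero_add] at this
    rw [this]
    cases j <;> simp [gaussBinom]
  · rintro ⟨⟨h6, h7, h10, h11, h3'⟩, hf⟩
    have hloop := Ok.loop_frame (W := W) (a := 10) (c := pascalRow) (T := 11 + μ * 11) (n := ζ + 1)
      (σ := τ) (I := fun n υ => ∃ a, a + n = ζ + 1 ∧ υ.reg 10 = n ∧ υ.reg 11 = a * (μ + 1) ∧
        ∀ j < (a + 1) * (μ + 1), υ.arr 3 j = pascal q (μ + 1) j)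
      (fun m υ ⟨b, _, h, _⟩ => h)
      (fun n υ ⟨a, ha, g10, g11, g3⟩ hf' =>
        (pascalRow_ok hq ha hS hΓ ((hf'.reg 0 (by decide)).trans ((hf.reg 0 (by decide)).trans h0))
          ((hf'.reg 5 (by decide)).trans ((hf.reg 5 (by decide)).trans h5))
          ((hf'.reg 6 (by decide)).trans h6) ((hf'.reg 7 (by decide)).trans h7) g10 g11 g3).mono
            le_rfl fun ω hω => ⟨a + 1, by omega, hω.1, hω.2⟩)
      ⟨0, by omega, h10, by simpa using h11, by simpa using h3'⟩
    refine hloop.mono (by rw [show 11 + μ * 11 + 1 = 12 + μ * 11 by ring]) fun υ => ?_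
    rintro ⟨⟨a, ha, -, -, g3⟩, hf'⟩
    exact ⟨(hf'.reg 6 (by decide)).trans h6, (hf'.reg 7 (by decide)).trans h7,
      fun j hj => g3 j (by rw [show a + 1 = ζ + 2 by omega]; exact hj)⟩

namespace Params

/-- The address of an entry of the precomputed table. -/
def cell (P : Params) (t' ℓ' μ' s' : ℕ) : ℕ :=
  ((t' * (P.ℓ + 1) + ℓ') * (P.μ + 1) + μ') * (P.s + 1) + s'

/-- The integers `ι M(t', ℓ', μ', s')` of the precomputed table. -/
def entry (P : Params) (t' ℓ' μ' s' : ℕ) : ℕ := ⌊(P.iota : ℚ) * tableM P.q P.ζ t' ℓ' μ' s'⌋₊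

/-- An upper bound for the Gaussian binomials in use. -/
def binomBound (P : Params) : ℕ := P.q ^ ((P.ζ + 1) * (P.μ + 1))

/-- All integers that occur in the algorithm have at most `W` bits. -/
structure Fits (P : Params) (W : ℕ) : Prop where
  index : ((P.s + 1) * (P.ℓ + 1) + 2) * (P.μ + 1) * (P.s + 1) < 2 ^ W
  index' : (P.ζ + 2) * (P.μ + 1) < 2 ^ W
  mass : P.ℓ * P.ζ + P.ℓ * P.μ + P.s < 2 ^ W
  den : (P.ℓ * P.binomBound) ^ P.ℓ < 2 ^ W
  num : P.ℓ ! * P.binomBound ^ P.ℓ < 2 ^ W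
  table : ∀ j, P.tableCell j * (P.ℓ ! * P.binomBound ^ P.ℓ) < 2 ^ W

variable {P : Params}

theorem tableCell_cell {t' ℓ' μ' s' : ℕ} (ht : t' ≤ P.t) (hℓ : ℓ' ≤ P.ℓ) (hμ : μ' ≤ P.μ)
    (hs : s' ≤ P.s) : P.tableCell (P.cell t' ℓ' μ' s') = P.entry t' ℓ' μ' s' := by
  have key : ∀ {a b m : ℕ}, b ≤ m → (a * (m + 1) + b) % (m + 1) = b ∧
      (a * (m + 1) + b) / (m + 1) = a := fun {a b m} h => by
    rw [mul_comm, Nat.mul_add_mod, Nat.mul_add_div (by omega)]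
    exact ⟨Nat.mod_eq_of_lt (by omega), by rw [Nat.div_eq_of_lt (by omega), add_zero]⟩
  rw [tableCell, cell]
  simp only [(key hs).1, (key hs).2, (key hμ).1, (key hμ).2, (key hℓ).1, (key hℓ).2, if_pos ht]
  rfl

/-- Addresses are evaluated by Horner's rule, so the intermediate values have to fit as well. -/
theorem Fits.index_lt {W : ℕ} (hW : P.Fits W) {A c x : ℕ} (hA : A ≤ (P.s + 1) * (P.ℓ + 1))
    (hc : c ≤ P.μ + 1) (hx : x ≤ P.s) : (A * (P.μ + 1) + c) * (P.s + 1) + x < 2 ^ W ∧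
      A * (P.μ + 1) + c < 2 ^ W ∧ A < 2 ^ W := by
  have h1 := Nat.mul_le_mul_right (P.μ + 1) hA
  have h2 : A * (P.μ + 1) + c ≤ ((P.s + 1) * (P.ℓ + 1) + 1) * (P.μ + 1) := by
    rw [Nat.succ_mul _ (P.μ + 1)]; omega
  have h3 := Nat.mul_le_mul_right (P.s + 1) h2
  have h4 : ((P.s + 1) * (P.ℓ + 1) + 2) * (P.μ + 1) * (P.s + 1) =
    ((P.s + 1) * (P.ℓ + 1) + 1) * (P.μ + 1) * (P.s + 1) + (P.μ + 1) * (P.s + 1) := by ring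
  have h5 := Nat.le_mul_of_pos_left (P.s + 1) (Nat.succ_pos P.μ)
  have h6 := Nat.le_mul_of_pos_right (A * (P.μ + 1) + c) (Nat.succ_pos P.s)
  have h7 := Nat.le_mul_of_pos_right A (Nat.succ_pos P.μ)
  have h8 := hW.index
  simp only [Nat.succ_eq_add_one] at h5 h6 h7
  refine ⟨by omega, by omega, by omega⟩

theorem Admissible.entry_cast (hP : P.Admissible) {t' ℓ' μ' s' : ℕ} (hℓ : ℓ' ≤ P.ℓ)
    (hμ : μ' ≤ P.μ) : (P.entry t' ℓ' μ' s' : ℚ) = P.iota * tableM P.q P.ζ t' ℓ' μ' s' := by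
  obtain ⟨m, hm⟩ := hP.exists_iota_mul_tableM (t' := t') (s' := s') hℓ hμ
  rw [entry, hm, Nat.floor_natCast]

/-- Since `Q = ℓ! * M(t, ℓ, μ, s)`, the range of the first draw is a single table entry times `ℓ!`.
-/
theorem Admissible.prefixCount_nil (hP : P.Admissible) :
    P.prefixCount [] = P.entry P.t P.ℓ P.μ P.s * P.ℓ ! := by
  have h : (P.prefixCount [] : ℚ) = (P.entry P.t P.ℓ P.μ P.s * P.ℓ ! : ℕ) := by
    rw [hP.prefixCount_cast, hP.prefixSum_nil, Nat.cast_mul, hP.entry_cast le_rfl le_rfl]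
    ring
  exact_mod_cast h

theorem Admissible.binomBound_pos (hP : P.Admissible) : 0 < P.binomBound :=
  Nat.pow_pos (by have := hP.q_ge; omega)

theorem Admissible.gaussBinom_le (hP : P.Admissible) {a b : ℕ} (ha : a ≤ P.ζ + 1) (hb : b ≤ P.μ) :
    gaussBinom P.q a b ≤ P.binomBound := gaussBinom_le_top hP.q_ge ha hb

theorem Fits.binomBound_lt {W : ℕ} (hW : P.Fits W) (hP : P.Admissible) :
    P.binomBound < 2 ^ W :=
  ((Nat.le_self_pow hP.ℓ_pos.ne' _).trans
    (Nat.le_mul_of_pos_left _ (Nat.factorial_pos P.ℓ))).trans_lt hW.num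

end Params

/-! ### The factorial and the range of the first draw -/

/-- `ℓ!` is computed in register `19`. -/
def factProg : Program :=
  .seq (.block [.copy 19 6, .copy 20 4]) (.loop 20 (.block [.mul 19 19 20, .sub 20 20 6]))

/-- The number `ι Q` is computed in register `24`. -/
def rangeProg : Program :=
  .seq factProg (.block [.add 21 4 6, .add 22 3 6, .mul 23 2 21, .add 23 23 4, .mul 23 23 7,
    .add 23 23 5, .mul 23 23 22, .add 23 23 3, .load 24 0 23, .mul 24 24 19])

theorem factProg_ok {W ℓ : ℕ} (hW : ℓ ! < 2 ^ W) {σ : Store} (h4 : σ.reg 4 = ℓ)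
    (h6 : σ.reg 6 = 1) : Ok W factProg σ (4 + ℓ * 4) fun τ => τ.reg 19 = ℓ ! := by
  refine (Ok.seq (R := fun τ => (τ.reg 19 = 1 ∧ τ.reg 20 = ℓ) ∧ Frame (.block _) σ τ)
    (Ok.block ?_).frame (T' := ℓ * 4 + 1) fun τ => ?_).mono
    (by simp only [List.length_cons, List.length_nil]; omega) fun _ => id
  · simp [blockPre, Instr.Safe, Instr.step, h4, h6]
  · rintro ⟨⟨h19, h20⟩, hf⟩
    have hloop := Ok.loop_frame (W := W) (a := 20) (c := .block [.mul 19 19 20, .sub 20 20 6])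
      (T := 3) (n := ℓ) (σ := τ) (I := fun n υ => υ.reg 20 = n ∧ υ.reg 19 * n ! = ℓ !)
      (fun n υ h => h.1) (fun n υ ⟨g20, g19⟩ hf' => (Ok.block (by
        have g6 := (hf'.reg 6 (by decide)).trans ((hf.reg 6 (by decide)).trans h6)
        rw [Nat.factorial_succ, ← mul_assoc] at g19
        have := Nat.le_mul_of_pos_right (υ.reg 19 * (n + 1)) (Nat.factorial_pos n)
        simp only [blockPre, Instr.Safe, Instr.step, Store.setReg_reg, g20, g6,
          Nat.reduceEqDiff, if_true, if_false, true_and]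
        exact ⟨by omega, by omega, g19⟩)).mono le_rfl fun _ => id)
      ⟨h20, by rw [h19, one_mul]⟩
    exact hloop.mono le_rfl fun υ h => by simpa using h.1.2

theorem rangeProg_ok {P : Params} (hP : P.Admissible) {W : ℕ} (hW : P.Fits W) {σ : Store}
    (h2 : σ.reg 2 = P.t) (h3 : σ.reg 3 = P.s) (h4 : σ.reg 4 = P.ℓ) (h5 : σ.reg 5 = P.μ)
    (h6 : σ.reg 6 = 1) (h7 : σ.reg 7 = P.μ + 1) (h0 : σ.arr 0 = P.tableCell) :
    Ok W rangeProg σ (15 + P.ℓ * 4) fun τ => τ.reg 19 = P.ℓ ! ∧ τ.reg 21 = P.ℓ + 1 ∧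
      τ.reg 22 = P.s + 1 ∧ τ.reg 24 = P.prefixCount [] := by
  have hb := Nat.pow_pos (n := P.ℓ) hP.binomBound_pos
  have hfact : P.ℓ ! < 2 ^ W := (Nat.le_mul_of_pos_right _ hb).trans_lt hW.num
  refine ((factProg_ok hfact h4 h6).frame.seq (T' := 11) fun τ => ?_).mono (by omega) fun _ => id
  rintro ⟨h19, hf⟩
  have htab := hW.table (P.cell P.t P.ℓ P.μ P.s)
  have hts := Nat.mul_le_mul_right (P.ℓ + 1) hP.t_le
  obtain ⟨i1, i2, i3⟩ := hW.index_lt (A := P.t * (P.ℓ + 1) + P.ℓ) (c := P.μ) (x := P.s)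
    (by rw [Nat.succ_mul]; omega) (by omega) le_rfl
  obtain ⟨-, -, i5⟩ := hW.index_lt (A := (P.s + 1) * (P.ℓ + 1)) (c := 0) (x := 0)
    le_rfl (by omega) (by omega)
  have i6 := Nat.le_mul_of_pos_left (P.ℓ + 1) (Nat.succ_pos P.s)
  have i7 := Nat.le_mul_of_pos_right (P.s + 1) (Nat.succ_pos P.ℓ)
  simp only [Nat.succ_eq_add_one] at i6 i7
  have l1 : P.tableCell (P.cell P.t P.ℓ P.μ P.s) * P.ℓ ! < 2 ^ W := by
    rw [← mul_assoc] at htab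
    exact (Nat.le_mul_of_pos_right _ hb).trans_lt htab
  have l2 := (Nat.le_mul_of_pos_right _ (Nat.factorial_pos P.ℓ)).trans_lt l1
  rw [Params.tableCell_cell le_rfl le_rfl le_rfl le_rfl, ← hP.prefixCount_nil] at l1
  rw [Params.tableCell_cell le_rfl le_rfl le_rfl le_rfl] at l2
  have htc := Params.tableCell_cell (P := P) (t' := P.t) (s' := P.s) le_rfl le_rfl le_rfl le_rfl
  rw [Params.cell] at htc
  have g2 := (hf.reg 2 (by decide)).trans h2
  have g3 := (hf.reg 3 (by decide)).trans h3
  have g4 := (hf.reg 4 (by decide)).trans h4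
  have g5 := (hf.reg 5 (by decide)).trans h5
  have g6 := (hf.reg 6 (by decide)).trans h6
  have g7 := (hf.reg 7 (by decide)).trans h7
  have g0 := (hf.arr 0 (by decide)).trans h0
  refine (Ok.block ?_).mono (T := 11) le_rfl fun _ => id
  simp only [blockPre, Instr.Safe, Instr.step, Store.setReg_reg, Store.setReg_arr, g2, g3, g4, g5,
    g6, g7, g0, h19, htc, ← hP.prefixCount_nil, Nat.reduceEqDiff, if_true, if_false, true_and]
  exact ⟨by omega, by omega, by omega, i3, by omega, i2, by omega, i1, l2, l1, trivial⟩

/-! ### The shuffle -/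

/-- One exchange of the shuffle. -/
def shuffleBody : Program := .block [.load 63 1 61, .add 61 61 6, .mod 64 60 61, .div 60 60 61,
  .load 65 2 64, .sub 66 61 6, .store 2 66 65, .store 2 64 63, .sub 62 62 6]

/-- The rearrangement described by register `60` of the vector in array `1` is written to
array `2`. -/
def shuffleProg : Program :=
  .seq (.block [.copy 61 8, .copy 62 4]) (.loop 62 shuffleBody)

/-- Round `i` moves the content of cell `d` to cell `i` and puts `v i` into cell `d`; this is right
multiplication by the exchange of `i` and `d`, as `i` was fixed before. If `d = i`, the loaded
content is meaningless and overwritten at once, but it must fit, so all of array `2` is assumed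
small. -/
theorem shuffleProg_ok {W ℓ R : ℕ} (v : ℕ → ℕ) (hW : ℓ < 2 ^ W) {σ : Store} (h4 : σ.reg 4 = ℓ)
    (h6 : σ.reg 6 = 1) (h8 : σ.reg 8 = 0) (h60 : σ.reg 60 = R) (h1 : ∀ j < ℓ, σ.arr 1 j = v j)
    (hv : ∀ j < ℓ, v j < 2 ^ W) (h2 : ∀ j, σ.arr 2 j < 2 ^ W) :
    Ok W shuffleProg σ (4 + ℓ * 11) fun τ => ∀ j < ℓ, τ.arr 2 j = v ((shuffle ℓ R).1 j) := by
  refine (Ok.seq (R := fun τ => (τ.reg 61 = 0 ∧ τ.reg 62 = ℓ) ∧ Frame (.block _) σ τ)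
    (Ok.block ?_).frame (T' := ℓ * 11 + 1) fun τ => ?_).mono
    (by simp only [List.length_cons, List.length_nil]; omega) fun _ => id
  · simp [blockPre, Instr.Safe, Instr.step, h4, h8]
  · rintro ⟨⟨h61, h62⟩, hf⟩
    have hloop := Ok.loop_frame (W := W) (a := 62) (c := shuffleBody) (T := 10) (n := ℓ) (σ := τ)
      (I := fun n υ => ∃ i, i + n = ℓ ∧ υ.reg 62 = n ∧ υ.reg 61 = i ∧
        υ.reg 60 = (shuffle i R).2 ∧ (∀ j < i, υ.arr 2 j = v ((shuffle i R).1 j)) ∧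
        ∀ j, υ.arr 2 j < 2 ^ W)
      (fun n υ ⟨_, _, h, _⟩ => h) (fun n υ ⟨i, hi, g62, g61, g60, g2, g2'⟩ hf' =>
        (Ok.block (by
          have g6 := (hf'.reg 6 (by decide)).trans ((hf.reg 6 (by decide)).trans h6)
          have g1 : υ.arr 1 i = v i := by
            rw [hf'.arr 1 (by decide), hf.arr 1 (by decide)]; exact h1 i (by omega)
          have hd : (shuffle i R).2 % (i + 1) < i + 1 := Nat.mod_lt _ (by omega)
          have hvi := hv i (by omega)
          simp only [blockPre, Instr.Safe, Instr.step, Store.setReg_reg, Store.setReg_arr,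
            Store.setArr_arr, Store.setArr_reg, g1, g6, g60, g61, g62, Nat.reduceEqDiff, if_true,
            if_false, true_and, Nat.add_sub_cancel]
          refine ⟨hvi, by omega, g2' _, i + 1, by omega, rfl, rfl, fun j hj => ?_,
            fun j => ?_⟩
          · rw [shuffle, shuffleStep, Equiv.Perm.mul_apply]
            split_ifs with hjd hji
            · rw [hjd, Equiv.swap_apply_right, shuffle_apply_of_le R le_rfl]
            · rw [hji, Equiv.swap_apply_left, g2 _ (by omega)]
            · rw [Equiv.swap_apply_of_ne_of_ne hji hjd, g2 _ (by omega)]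
          · split_ifs
            exacts [hvi, g2' _, g2' _])).mono le_rfl fun _ => id)
      ⟨0, by omega, h62, h61, by rw [hf.reg 60 (by decide)]; exact h60, by simp,
        by rw [hf.arr 2 (by decide)]; exact h2⟩
    refine hloop.mono le_rfl fun υ h => ?_
    obtain ⟨⟨i, hi, -, -, -, g2, -⟩, -⟩ := h
    obtain rfl : i = ℓ := by omega
    exact g2

/-! ### The blocks of equal entries -/

namespace Params

variable {P : Params}

theorem prefix_of_prefixCount_pos {pre : List ℕ} (h : 0 < P.prefixCount pre) :
    pre.length ≤ P.ℓ ∧ pre.Pairwise (fun a b => b ≤ a) ∧ (∀ x ∈ pre, x ≤ P.μ) ∧ pre.sum ≤ P.t := by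
  obtain ⟨L, hL⟩ := Finset.nonempty_of_sum_ne_zero h.ne'
  obtain ⟨h1, h2⟩ := Finset.mem_filter.1 hL
  obtain ⟨h3, h4, h5, h6⟩ := mem_sortedLists.1 h1
  obtain ⟨M, rfl⟩ : ∃ M, L = pre ++ M :=
    ⟨L.drop pre.length, by conv_lhs => rw [← List.take_append_drop pre.length L, h2]⟩
  refine ⟨by rw [List.length_append] at h3; omega, (List.pairwise_append.1 h6).1,
    fun x hx => h4 x (List.mem_append_left _ hx), by rw [List.sum_append] at h5; omega⟩

/-- The entries `pre` found so far consist of larger entries `pre₀` and `k` entries `a`. -/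
structure IsBlock (P : Params) (pre pre₀ : List ℕ) (a k : ℕ) : Prop where
  eq : pre = pre₀ ++ List.replicate k a
  gt : ∀ y ∈ pre₀, a < y
  le : a ≤ P.μ
  start : k = 0 → a = P.μ ∧ pre₀ = []

variable {pre pre₀ : List ℕ} {a k x : ℕ}

theorem IsBlock.ge (h : P.IsBlock pre pre₀ a k) : ∀ y ∈ pre, a ≤ y := fun y hy => by
  rw [h.eq, List.mem_append] at hy
  rcases hy with hy | hy
  · exact (h.gt y hy).le
  · exact (List.eq_of_mem_replicate hy).ge

/-- The prefix extended by the next entry has positive count, hence begins a sorted vector. For the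
empty block `a` is `μ`. -/
theorem IsBlock.nextEntry_le (h : P.IsBlock pre pre₀ a k) (hlen : pre.length < P.ℓ)
    (hx : x < P.prefixCount pre) : P.nextEntry pre x ≤ a := by
  have h1 := (P.sub_cumulCount_nextEntry_lt hlen hx)
  obtain ⟨-, h2, h3, -⟩ := prefix_of_prefixCount_pos (pos_of_gt h1)
  rcases Nat.eq_zero_or_pos k with hk | hk
  · rw [(h.start hk).1]; exact P.nextEntry_le pre x
  · refine (List.pairwise_append.1 h2).2.2 a ?_ _ (List.mem_singleton_self _)
    rw [h.eq]
    exact List.mem_append_right _ (List.mem_replicate.2 ⟨hk.ne', rfl⟩)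

/-- The product formula for `S(c + 1)` requires all entries found to exceed `c`, so it covers `c <
a` only. The search may stop at `a`, and no further sum is needed. -/
theorem IsBlock.nextEntry_eq (h : P.IsBlock pre pre₀ a k) (hlen : pre.length < P.ℓ)
    (hx : x < P.prefixCount pre) :
    P.nextEntry pre x = Nat.findGreatest (fun c => P.cumulCount pre c ≤ x) a := by
  refine (Nat.findGreatest_eq_iff.2 ⟨h.nextEntry_le hlen hx,
    fun _ => P.cumulCount_nextEntry_le pre x, fun n hn hn' => ?_⟩).symm
  exact Nat.findGreatest_is_greatest (P := fun c => P.cumulCount pre c ≤ x) hn (hn'.trans h.le)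

theorem IsBlock.snoc_eq (h : P.IsBlock pre pre₀ a k) : P.IsBlock (pre ++ [a]) pre₀ a (k + 1) :=
  ⟨by rw [h.eq, List.replicate_succ', List.append_assoc], h.gt, h.le, fun h0 => by omega⟩

theorem IsBlock.snoc_lt (h : P.IsBlock pre pre₀ a k) {b : ℕ} (hb : b < a) :
    P.IsBlock (pre ++ [b]) pre b 1 :=
  ⟨rfl, fun y hy => hb.trans_le (h.ge y hy), hb.le.trans h.le, fun h0 => by omega⟩

theorem IsBlock.listDen (h : P.IsBlock pre pre₀ a k) (q ζ r : ℕ) : listDen q ζ pre r =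
    listDen q ζ pre₀ r * blockDen q ζ a k (r - listCap ζ pre₀) := by
  rw [h.eq, listDen_append, listDen_replicate]
  intro y hy z hz
  rw [List.eq_of_mem_replicate hz]
  exact h.gt y hy

theorem IsBlock.listNum (h : P.IsBlock pre pre₀ a k) (q ζ : ℕ) :
    listNum q ζ pre = listNum q ζ pre₀ * gaussBinom q ζ a ^ k := by
  rw [h.eq, listNum_append, _root_.listNum, _root_.listNum, List.map_replicate,
    List.prod_replicate]

theorem IsBlock.sum (h : P.IsBlock pre pre₀ a k) : pre.sum = pre₀.sum + k * a := by
  rw [h.eq, List.sum_append, List.sum_replicate, smul_eq_mul]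

theorem IsBlock.length (h : P.IsBlock pre pre₀ a k) : pre.length = pre₀.length + k := by
  rw [h.eq, List.length_append, List.length_replicate]

/-- The surplus is updated blockwise: what exceeds `k * ζ` after the block has received everything
is passed on. -/
theorem IsBlock.sub_listCap (h : P.IsBlock pre pre₀ a k) {ζ : ℕ} (hζ : P.μ ≤ ζ) (r : ℕ) :
    r - listCap ζ pre = k * a + (r - listCap ζ pre₀) - k * ζ := by
  have h1 := Nat.mul_sub k ζ a
  have h2 := Nat.mul_le_mul_left k (h.le.trans hζ)
  rw [h.eq, listCap_append, listCap, listCap, List.map_replicate, List.sum_replicate, smul_eq_mul]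
  omega

/-- This is `cumul_eq` with denominators cleared. The division is exact, so the floor division of
the machine returns the cumulated weight itself. -/
theorem Admissible.entry_mul_div (hP : P.Admissible) (hlen : pre.length < P.ℓ)
    (hpos : 0 < P.prefixCount pre) {c : ℕ} (hcμ : c < P.μ) (hc : ∀ y ∈ pre, c < y) :
    P.entry (P.t - pre.sum) (P.ℓ - pre.length) c
        (P.t - pre.sum + (P.s - P.t - listCap P.ζ pre)) * (listNum P.q P.ζ pre * P.ℓ !) /
      listDen P.q P.ζ pre (P.s - P.t) = P.cumulCount pre (c + 1) := by
  obtain ⟨-, h1, h2, h3⟩ := prefix_of_prefixCount_pos hpos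
  have h4 : 0 < listDen P.q P.ζ pre (P.s - P.t) :=
    listDen_pos (fun y hy => (h2 y hy).trans hP.μ_le) _
  refine Nat.div_eq_of_eq_mul_left h4 ?_
  have h5 := hP.cumul_eq hlen h1 h2 h3 hcμ hc
  have h6 : (listDen P.q P.ζ pre (P.s - P.t) : ℚ) ≠ 0 := by exact_mod_cast h4.ne'
  have h7 : ((P.entry (P.t - pre.sum) (P.ℓ - pre.length) c
      (P.t - pre.sum + (P.s - P.t - listCap P.ζ pre)) * (listNum P.q P.ζ pre * P.ℓ !) : ℕ) : ℚ) =
      ((P.cumulCount pre (c + 1) * listDen P.q P.ζ pre (P.s - P.t) : ℕ) : ℚ) := by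
    rw [Nat.cast_mul, Nat.cast_mul, Nat.cast_mul, hP.cumulCount_cast, h5,
      hP.entry_cast (by omega) hcμ.le, listTerm]
    field_simp
  exact_mod_cast h7

end Params

/-! ### Closing a block -/

/-- Preparation of the factors of the current block. -/
def closeInit : Program := .block [.mul 34 31 30, .sub 35 28 34, .add 36 34 29, .mul 37 31 1,
  .sub 38 36 37, .sub 39 36 38, .div 40 39 31, .mod 41 39 31, .mul 42 40 7, .add 42 42 30,
  .load 43 3 42, .add 42 42 7, .load 44 3 42, .mul 42 1 7, .add 42 42 30, .load 45 3 42,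
  .copy 46 26, .copy 47 27, .copy 48 8, .copy 49 31]

/-- The factors of one entry of the current block. -/
def closeBody : Program :=
  .seq (.block [.add 48 48 6, .mul 47 47 48, .mul 46 46 45])
    (.seq (.ite 41 (.block [.mul 47 47 44, .sub 41 41 6]) (.block [.mul 47 47 43]))
      (.block [.sub 49 49 6]))

/-- The numerator and the denominator of the entries found so far are computed in the
registers `46` and `47`, the remaining sum and surplus in the registers `35` and `38`. -/
def closeProg : Program := .seq closeInit (.loop 49 closeBody)

theorem closeInit_ok {P : Params} (hP : P.Admissible) {W : ℕ} (hW : P.Fits W) {a k r t₀ N D : ℕ}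
    (ha : a ≤ P.μ) (hk : k ≤ P.ℓ) (hr : r ≤ P.s) {σ : Store} (h1 : σ.reg 1 = P.ζ)
    (h7 : σ.reg 7 = P.μ + 1) (h8 : σ.reg 8 = 0)
    (h26 : σ.reg 26 = N) (h27 : σ.reg 27 = D) (h28 : σ.reg 28 = t₀) (h29 : σ.reg 29 = r)
    (h30 : σ.reg 30 = a) (h31 : σ.reg 31 = k)
    (h3 : ∀ j < (P.ζ + 2) * (P.μ + 1), σ.arr 3 j = pascal P.q (P.μ + 1) j) :
    Ok W closeInit σ 21 fun τ => τ.reg 35 = t₀ - k * a ∧ τ.reg 38 = k * a + r - k * P.ζ ∧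
      τ.reg 41 = min (k * a + r) (k * P.ζ) % k ∧
      τ.reg 43 = gaussBinom P.q (min (k * a + r) (k * P.ζ) / k) a ∧
      τ.reg 44 = gaussBinom P.q (min (k * a + r) (k * P.ζ) / k + 1) a ∧
      τ.reg 45 = gaussBinom P.q P.ζ a ∧ τ.reg 46 = N ∧ τ.reg 47 = D ∧ τ.reg 48 = 0 ∧
      τ.reg 49 = k := by
  -- The minimum is obtained by two truncated subtractions. For the empty block, `k = 0`, it is `0`,
  -- and division by zero gives quotient and remainder `0`.
  have hmin : k * a + r - (k * a + r - k * P.ζ) = min (k * a + r) (k * P.ζ) := by omega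
  have hb : min (k * a + r) (k * P.ζ) / k ≤ P.ζ := Nat.div_le_of_le_mul (min_le_right _ _)
  generalize min (k * a + r) (k * P.ζ) = T at hmin hb ⊢
  have hbm := Nat.mul_le_mul_right (P.μ + 1) hb
  have hζm : (P.ζ + 2) * (P.μ + 1) = P.ζ * (P.μ + 1) + (P.μ + 1) + (P.μ + 1) := by ring
  have hindex := hW.index'
  have hmass := hW.mass
  have hka := Nat.mul_le_mul hk ha
  have hkζ := Nat.mul_le_mul_right P.ζ hk
  have hΓ := hW.binomBound_lt hP
  have e1 : σ.arr 3 (T / k * (P.μ + 1) + a) = gaussBinom P.q (T / k) a := by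
    rw [h3 _ (by omega), pascal_mul_add _ (by omega)]
  have e2 : σ.arr 3 (T / k * (P.μ + 1) + a + (P.μ + 1)) = gaussBinom P.q (T / k + 1) a := by
    rw [show T / k * (P.μ + 1) + a + (P.μ + 1) = (T / k + 1) * (P.μ + 1) + a by ring,
      h3 _ (by rw [Nat.succ_mul]; omega), pascal_mul_add _ (by omega)]
  have e3 : σ.arr 3 (P.ζ * (P.μ + 1) + a) = gaussBinom P.q P.ζ a := by
    rw [h3 _ (by omega), pascal_mul_add _ (by omega)]
  have l1 := hP.gaussBinom_le (a := T / k) (b := a) (by omega) ha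
  have l2 := hP.gaussBinom_le (a := T / k + 1) (b := a) (by omega) ha
  have l3 := hP.gaussBinom_le (a := P.ζ) (b := a) (by omega) ha
  refine (Ok.block ?_).mono (T := 21) le_rfl fun _ => id
  simp only [blockPre, Instr.Safe, Instr.step, Store.setReg_reg, Store.setReg_arr, h1, h7, h8, h26,
    h27, h28, h29, h30, h31, hmin, e1, e2, e3, Nat.reduceEqDiff, if_true, if_false, true_and]
  generalize T / k = b at *
  refine ⟨by omega, by omega, by omega, by omega, by omega, by omega, by omega, by omega, by omega,
    by omega, by omega, trivial⟩

/-- Of the `k` entries the first `e` contribute the larger binomial `g₁` and the others `g₀`, which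
explains the exponents `min j e` and `j - e`; the factor `j + 1` builds up the factorial. An entry
costs a factor of at most `P.binomBound` in the numerator and `P.ℓ * P.binomBound` in the
denominator. -/
theorem closeBody_ok {P : Params} (hP : P.Admissible) {W : ℕ} (hW : P.Fits W)
    {p k j e g₀ g₁ g₂ N D : ℕ} (hp : p + k ≤ P.ℓ) (hj : j < k) (h0 : g₀ ≤ P.binomBound)
    (h1 : g₁ ≤ P.binomBound) (h2 : g₂ ≤ P.binomBound) {σ : Store} (h6 : σ.reg 6 = 1)
    (h41 : σ.reg 41 = e - j) (h43 : σ.reg 43 = g₀) (h44 : σ.reg 44 = g₁) (h45 : σ.reg 45 = g₂)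
    (h46 : σ.reg 46 = N * g₂ ^ j) (h47 : σ.reg 47 = D * (j ! * (g₁ ^ min j e * g₀ ^ (j - e))))
    (h46' : N * g₂ ^ j ≤ P.binomBound ^ (p + j))
    (h47' : D * (j ! * (g₁ ^ min j e * g₀ ^ (j - e))) ≤ (P.ℓ * P.binomBound) ^ (p + j))
    (h48 : σ.reg 48 = j) (h49 : σ.reg 49 = k - j) :
    Ok W closeBody σ 10 fun τ => τ.reg 49 = k - (j + 1) ∧ τ.reg 48 = j + 1 ∧
      τ.reg 41 = e - (j + 1) ∧ τ.reg 46 = N * g₂ ^ (j + 1) ∧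
      τ.reg 47 = D * ((j + 1)! * (g₁ ^ min (j + 1) e * g₀ ^ (j + 1 - e))) ∧
      N * g₂ ^ (j + 1) ≤ P.binomBound ^ (p + (j + 1)) ∧
      D * ((j + 1)! * (g₁ ^ min (j + 1) e * g₀ ^ (j + 1 - e))) ≤
        (P.ℓ * P.binomBound) ^ (p + (j + 1)) := by
  have hY : ∀ x, p + j + x ≤ P.ℓ → (P.ℓ * P.binomBound) ^ (p + j + x) < 2 ^ W := fun x hx =>
    (Nat.pow_le_pow_right (Nat.mul_pos hP.ℓ_pos hP.binomBound_pos) hx).trans_lt hW.den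
  have hY1 := hY 1 (by omega)
  have hN1 : N * g₂ ^ j * g₂ ≤ P.binomBound ^ (p + j + 1) := Nat.mul_le_mul h46' h2
  have hN2 := (Nat.pow_le_pow_right hP.binomBound_pos (show p + j + 1 ≤ P.ℓ by omega)).trans
    (Nat.le_mul_of_pos_left _ (Nat.factorial_pos P.ℓ))
  have hN3 := hW.num
  have hD1 := Nat.mul_le_mul h47' (show j + 1 ≤ P.ℓ by omega)
  have hD2 : ∀ g ≤ P.binomBound, D * (j ! * (g₁ ^ min j e * g₀ ^ (j - e))) * (j + 1) * g ≤
      (P.ℓ * P.binomBound) ^ (p + j + 1) := fun g hg => by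
    rw [pow_succ, ← mul_assoc ((P.ℓ * P.binomBound) ^ (p + j))]
    exact Nat.mul_le_mul hD1 hg
  have hD3 : D * (j ! * (g₁ ^ min j e * g₀ ^ (j - e))) * (j + 1) ≤
      (P.ℓ * P.binomBound) ^ (p + j + 1) := by
    have := hD2 _ le_rfl
    exact (Nat.le_mul_of_pos_right _ hP.binomBound_pos).trans this
  have hjW : j + 1 < 2 ^ W := by
    have := hW.mass
    have h9 := Nat.le_mul_of_pos_right P.ℓ hP.μ_pos
    omega
  have hcase : ∀ g, (e - j ≠ 0 → g = g₁) → (e - j = 0 → g = g₀) →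
      D * (j ! * (g₁ ^ min j e * g₀ ^ (j - e))) * (j + 1) * g =
        D * ((j + 1)! * (g₁ ^ min (j + 1) e * g₀ ^ (j + 1 - e))) := fun g hg1 hg0 => by
    rw [Nat.factorial_succ]
    by_cases he : e - j = 0
    · rw [hg0 he, min_eq_right (by omega), min_eq_right (by omega),
        show j + 1 - e = j - e + 1 by omega]
      ring
    · rw [hg1 he, min_eq_left (by omega), min_eq_left (by omega),
        show j + 1 - e = j - e by omega]
      ring
  refine (Ok.seq (R := fun τ => (τ.reg 48 = j + 1 ∧
      τ.reg 47 = D * (j ! * (g₁ ^ min j e * g₀ ^ (j - e))) * (j + 1) ∧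
      τ.reg 46 = N * g₂ ^ j * g₂) ∧ Frame (.block _) σ τ)
    (Ok.block ?_).frame (T' := 6) fun τ => ?_).mono
    (by simp only [List.length_cons, List.length_nil]; omega) fun _ => id
  · simp only [blockPre, Instr.Safe, Instr.step, Store.setReg_reg, h6, h45, h46, h47, h48,
      Nat.reduceEqDiff, if_true, if_false, and_true]
    exact ⟨by omega, by omega, by omega⟩
  · rintro ⟨⟨f48, f47, f46⟩, hf⟩
    have f6 := (hf.reg 6 (by decide)).trans h6
    have f41 := (hf.reg 41 (by decide)).trans h41
    refine (Ok.seq (R := fun υ => (υ.reg 41 = e - (j + 1) ∧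
      υ.reg 47 = D * ((j + 1)! * (g₁ ^ min (j + 1) e * g₀ ^ (j + 1 - e)))) ∧ Frame (.ite _ _ _) τ υ)
      (Ok.ite (T := 3) (fun hne => ?_) (fun heq => ?_)).frame (T' := 2) fun υ => ?_).mono
      (by omega) fun _ => id
    · have f44 := (hf.reg 44 (by decide)).trans h44
      rw [f41] at hne
      have h9 := hD2 _ h1
      refine (Ok.block ?_).mono (T := 3) le_rfl fun _ => id
      simp only [blockPre, Instr.Safe, Instr.step, Store.setReg_reg, f6, f41, f44, f47,
        Nat.reduceEqDiff, if_true, if_false, true_and]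
      exact ⟨by omega, by omega, hcase _ (fun _ => rfl) fun h => absurd h hne⟩
    · have f43 := (hf.reg 43 (by decide)).trans h43
      rw [f41] at heq
      have h9 := hD2 _ h0
      refine (Ok.block ?_).mono (T := 2) (by omega) fun _ => id
      simp only [blockPre, Instr.Safe, Instr.step, Store.setReg_reg, f41, f43, f47,
        Nat.reduceEqDiff, if_true, if_false]
      exact ⟨by omega, by omega, hcase _ (fun h => absurd heq h) fun _ => rfl⟩
    · rintro ⟨⟨k41, k47⟩, hf'⟩
      have k49 := (hf'.reg 49 (by decide)).trans ((hf.reg 49 (by decide)).trans h49)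
      have k48 := (hf'.reg 48 (by decide)).trans f48
      have k46 := (hf'.reg 46 (by decide)).trans f46
      have k6 := (hf'.reg 6 (by decide)).trans f6
      refine (Ok.block ?_).mono (T := 2) le_rfl fun _ => id
      simp only [blockPre, Instr.Safe, Instr.step, Store.setReg_reg, k41, k46, k47, k48, k49, k6,
        Nat.reduceEqDiff, if_true, if_false, true_and]
      refine ⟨by omega, by rw [pow_succ, mul_assoc], by rw [pow_succ, ← mul_assoc]; exact hN1, ?_⟩
      by_cases he : e - j = 0
      · rw [← hcase g₀ (fun h => absurd he h) fun _ => rfl]; exact hD2 _ h0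
      · rw [← hcase g₁ (fun _ => rfl) fun h => absurd h he]; exact hD2 _ h1

theorem closeProg_ok {P : Params} (hP : P.Admissible) {W : ℕ} (hW : P.Fits W)
    {p a k r t₀ N D : ℕ} (ha : a ≤ P.μ) (hp : p + k ≤ P.ℓ) (hr : r ≤ P.s)
    (hN : N ≤ P.binomBound ^ p) (hD : D ≤ (P.ℓ * P.binomBound) ^ p) {σ : Store}
    (h1 : σ.reg 1 = P.ζ) (h6 : σ.reg 6 = 1) (h7 : σ.reg 7 = P.μ + 1) (h8 : σ.reg 8 = 0)
    (h26 : σ.reg 26 = N) (h27 : σ.reg 27 = D) (h28 : σ.reg 28 = t₀) (h29 : σ.reg 29 = r)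
    (h30 : σ.reg 30 = a) (h31 : σ.reg 31 = k)
    (h3 : ∀ j < (P.ζ + 2) * (P.μ + 1), σ.arr 3 j = pascal P.q (P.μ + 1) j) :
    Ok W closeProg σ (22 + k * 11) fun τ => τ.reg 35 = t₀ - k * a ∧
      τ.reg 38 = k * a + r - k * P.ζ ∧ τ.reg 46 = N * gaussBinom P.q P.ζ a ^ k ∧
      τ.reg 47 = D * blockDen P.q P.ζ a k r ∧
      N * gaussBinom P.q P.ζ a ^ k ≤ P.binomBound ^ (p + k) ∧
      D * blockDen P.q P.ζ a k r ≤ (P.ℓ * P.binomBound) ^ (p + k) := by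
  have hb : min (k * a + r) (k * P.ζ) / k ≤ P.ζ := Nat.div_le_of_le_mul (min_le_right _ _)
  have he : min (k * a + r) (k * P.ζ) % k ≤ k := by
    rcases Nat.eq_zero_or_pos k with rfl | hk
    · simp
    · exact (Nat.mod_lt _ hk).le
  refine ((closeInit_ok hP hW ha (by omega) hr h1 h7 h8 h26 h27 h28 h29 h30 h31 h3).frame.seq
    (T' := k * 11 + 1) fun τ => ?_).mono (by omega) fun _ => id
  rintro ⟨⟨g35, g38, g41, g43, g44, g45, g46, g47, g48, g49⟩, hf⟩
  have hloop := Ok.loop_frame (W := W) (a := 49) (c := closeBody) (T := 10) (n := k) (σ := τ)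
    (I := fun n υ => ∃ j, j + n = k ∧ υ.reg 49 = k - j ∧ υ.reg 48 = j ∧
      υ.reg 41 = min (k * a + r) (k * P.ζ) % k - j ∧ υ.reg 46 = N * gaussBinom P.q P.ζ a ^ j ∧
      υ.reg 47 = D * (j ! * (gaussBinom P.q (min (k * a + r) (k * P.ζ) / k + 1) a ^
        min j (min (k * a + r) (k * P.ζ) % k) *
        gaussBinom P.q (min (k * a + r) (k * P.ζ) / k) a ^
          (j - min (k * a + r) (k * P.ζ) % k))) ∧
      N * gaussBinom P.q P.ζ a ^ j ≤ P.binomBound ^ (p + j) ∧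
      D * (j ! * (gaussBinom P.q (min (k * a + r) (k * P.ζ) / k + 1) a ^
        min j (min (k * a + r) (k * P.ζ) % k) *
        gaussBinom P.q (min (k * a + r) (k * P.ζ) / k) a ^
          (j - min (k * a + r) (k * P.ζ) % k))) ≤ (P.ℓ * P.binomBound) ^ (p + j))
    (fun n υ ⟨j, hj, h, _⟩ => by omega)
    (fun n υ ⟨j, hj, k49, k48, k41, k46, k47, k46', k47'⟩ hf' =>
      (closeBody_ok hP hW hp (by omega) (hP.gaussBinom_le (by omega) ha)
        (hP.gaussBinom_le (by omega) ha) (hP.gaussBinom_le (by omega) ha)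
        ((hf'.reg 6 (by decide)).trans ((hf.reg 6 (by decide)).trans h6)) k41
        ((hf'.reg 43 (by decide)).trans g43) ((hf'.reg 44 (by decide)).trans g44)
        ((hf'.reg 45 (by decide)).trans g45) k46 k47 k46' k47' k48 k49).mono le_rfl fun ω hω =>
          ⟨j + 1, by omega, hω⟩)
    ⟨0, by omega, by simpa using g49, g48, by simpa using g41, by simpa using g46,
      by simpa using g47, by simpa using hN, by simpa using hD⟩
  refine hloop.mono le_rfl fun υ h => ?_
  obtain ⟨⟨j, hj, -, -, -, k46, k47, k46', k47'⟩, hf'⟩ := h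
  obtain rfl : j = k := by omega
  rw [min_eq_right he] at k47 k47'
  exact ⟨(hf'.reg 35 (by decide)).trans g35, (hf'.reg 38 (by decide)).trans g38, k46, k47, k46',
    k47'⟩

/-! ### Looking up the cumulated weights -/

/-- Preparation of the table address. -/
def lookupInit : Program := .block [.mul 50 46 19, .mul 51 35 21, .add 51 51 4, .sub 51 51 32,
  .mul 51 51 7, .mul 51 51 22, .add 51 51 35, .add 51 51 38, .copy 53 8, .copy 54 8, .copy 55 8,
  .copy 56 30]

/-- One comparison of a cumulated weight with the drawn number. -/
def lookupBody : Program :=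
  .seq (.block [.load 57 0 51, .mul 57 57 50, .div 57 57 47, .add 53 53 6, .add 51 51 22,
    .sub 58 57 25]) (.seq (.ite 58 (.block []) (.block [.copy 54 53, .copy 55 57]))
      (.block [.sub 56 56 6]))

/-- The next entry is computed in register `54`, the corresponding cumulated weight in
register `55`. -/
def lookupProg : Program := .seq lookupInit (.loop 56 lookupBody)

/-- A linear search that follows the recursion of `Nat.findGreatest`, so monotonicity of `S` plays
no role. The test `S (c + 1) ≤ x` is the vanishing of a truncated difference. -/
theorem lookupProg_ok {P : Params} (hP : P.Admissible) {W : ℕ} (hW : P.Fits W)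
    {a p t₁ r₁ N D x : ℕ} {S : ℕ → ℕ} (hS0 : S 0 = 0)
    (hS : ∀ c < a, P.entry t₁ (P.ℓ - p) c (t₁ + r₁) * (N * P.ℓ !) / D = S (c + 1))
    (ha : a ≤ P.μ) (hp : p ≤ P.ℓ) (ht : t₁ ≤ P.t) (htr : t₁ + r₁ ≤ P.s)
    (hN : N ≤ P.binomBound ^ P.ℓ) {σ : Store} (h4 : σ.reg 4 = P.ℓ) (h6 : σ.reg 6 = 1)
    (h7 : σ.reg 7 = P.μ + 1) (h8 : σ.reg 8 = 0) (h19 : σ.reg 19 = P.ℓ !)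
    (h21 : σ.reg 21 = P.ℓ + 1) (h22 : σ.reg 22 = P.s + 1) (h25 : σ.reg 25 = x)
    (h30 : σ.reg 30 = a) (h32 : σ.reg 32 = p) (h35 : σ.reg 35 = t₁) (h38 : σ.reg 38 = r₁)
    (h46 : σ.reg 46 = N) (h47 : σ.reg 47 = D) (h0 : σ.arr 0 = P.tableCell) :
    Ok W lookupProg σ (14 + a * 15) fun τ =>
      τ.reg 54 = Nat.findGreatest (fun c => S c ≤ x) a ∧
      τ.reg 55 = S (Nat.findGreatest (fun c => S c ≤ x) a) := by
  have hNf : N * P.ℓ ! ≤ P.ℓ ! * P.binomBound ^ P.ℓ := by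
    rw [mul_comm]; exact Nat.mul_le_mul_left _ hN
  have hNW := hW.num
  have hA : t₁ * (P.ℓ + 1) + P.ℓ ≤ (P.s + 1) * (P.ℓ + 1) := by
    have := Nat.mul_le_mul_right (P.ℓ + 1) (ht.trans hP.t_le)
    rw [Nat.succ_mul]; omega
  have hA' : t₁ * (P.ℓ + 1) + P.ℓ - p = t₁ * (P.ℓ + 1) + (P.ℓ - p) := by omega
  have hcell : ∀ c, P.cell t₁ (P.ℓ - p) c (t₁ + r₁) =
      ((t₁ * (P.ℓ + 1) + (P.ℓ - p)) * (P.μ + 1) + c) * (P.s + 1) + (t₁ + r₁) := fun c => rfl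
  have hcell' : ∀ c, P.cell t₁ (P.ℓ - p) (c + 1) (t₁ + r₁) =
      P.cell t₁ (P.ℓ - p) c (t₁ + r₁) + (P.s + 1) := fun c => by rw [hcell, hcell]; ring
  have hcellW : ∀ c ≤ P.μ + 1, P.cell t₁ (P.ℓ - p) c (t₁ + r₁) < 2 ^ W := fun c hc => by
    rw [hcell]; exact (hW.index_lt (by omega) hc htr).1
  have hval : ∀ c ≤ P.μ, P.tableCell (P.cell t₁ (P.ℓ - p) c (t₁ + r₁)) =
      P.entry t₁ (P.ℓ - p) c (t₁ + r₁) := fun c hc =>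
    Params.tableCell_cell ht (Nat.sub_le _ _) hc htr
  have htab : ∀ c ≤ P.μ, P.entry t₁ (P.ℓ - p) c (t₁ + r₁) * (P.ℓ ! * P.binomBound ^ P.ℓ) < 2 ^ W :=
    fun c hc => hval c hc ▸ hW.table _
  have hpos : 0 < P.ℓ ! * P.binomBound ^ P.ℓ :=
    Nat.mul_pos (Nat.factorial_pos _) (Nat.pow_pos hP.binomBound_pos)
  refine (Ok.seq (R := fun τ => (τ.reg 50 = N * P.ℓ ! ∧
      τ.reg 51 = P.cell t₁ (P.ℓ - p) 0 (t₁ + r₁) ∧ τ.reg 53 = 0 ∧ τ.reg 54 = 0 ∧ τ.reg 55 = 0 ∧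
      τ.reg 56 = a) ∧ Frame lookupInit σ τ)
    (Ok.block ?_).frame (T' := a * 15 + 1) fun τ => ?_).mono
    (by simp only [List.length_cons, List.length_nil]; omega) fun _ => id
  · obtain ⟨i1, i2, i3⟩ := hW.index_lt hA (show 0 ≤ P.μ + 1 by omega) htr
    obtain ⟨j1, j2, j3⟩ := hW.index_lt (A := t₁ * (P.ℓ + 1) + (P.ℓ - p)) (by omega)
      (show 0 ≤ P.μ + 1 by omega) htr
    simp only [blockPre, Instr.Safe, Instr.step, Store.setReg_reg, h4, h7, h8, h19, h21, h22,
      h30, h32, h35, h38, h46, hA', hcell, Nat.reduceEqDiff, if_true, if_false, true_and, and_true]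
    simp only [add_zero] at j1 j2 ⊢
    refine ⟨by omega, by omega, by omega, by omega, by omega, by omega, by omega, by omega⟩
  · rintro ⟨⟨g50, g51, g53, g54, g55, g56⟩, hf⟩
    have hloop := Ok.loop_frame (W := W) (a := 56) (c := lookupBody) (T := 14) (n := a) (σ := τ)
      (I := fun n υ => ∃ c, c + n = a ∧ υ.reg 56 = n ∧ υ.reg 53 = c ∧
        υ.reg 51 = P.cell t₁ (P.ℓ - p) c (t₁ + r₁) ∧
        υ.reg 54 = Nat.findGreatest (fun c => S c ≤ x) c ∧
        υ.reg 55 = S (Nat.findGreatest (fun c => S c ≤ x) c))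
      (fun n υ ⟨c, _, h, _⟩ => h)
      (fun n υ ⟨c, hc, k56, k53, k51, k54, k55⟩ hf' => by
        have k6 := (hf'.reg 6 (by decide)).trans ((hf.reg 6 (by decide)).trans h6)
        have k22 := (hf'.reg 22 (by decide)).trans ((hf.reg 22 (by decide)).trans h22)
        have k25 := (hf'.reg 25 (by decide)).trans ((hf.reg 25 (by decide)).trans h25)
        have k47 := (hf'.reg 47 (by decide)).trans ((hf.reg 47 (by decide)).trans h47)
        have k50 := (hf'.reg 50 (by decide)).trans g50
        have k0 := (hf'.arr 0 (by decide)).trans ((hf.arr 0 (by decide)).trans h0)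
        have l1 := htab c (by omega)
        have l2 := Nat.mul_le_mul_left (P.entry t₁ (P.ℓ - p) c (t₁ + r₁)) hNf
        have l3 := Nat.le_mul_of_pos_right (P.entry t₁ (P.ℓ - p) c (t₁ + r₁)) hpos
        have l4 := hcellW (c + 1) (by omega)
        have l5 := hcell' c
        have l6 := hW.index'
        have l7 := Nat.le_mul_of_pos_left (P.μ + 1) (show 0 < P.ζ + 2 by omega)
        refine (Ok.seq (R := fun ω => (ω.reg 57 = S (c + 1) ∧ ω.reg 58 = S (c + 1) - x ∧
          ω.reg 53 = c + 1 ∧ ω.reg 51 = P.cell t₁ (P.ℓ - p) (c + 1) (t₁ + r₁)) ∧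
            Frame (.block _) υ ω) (Ok.block ?_).frame (T' := 6) fun ω => ?_).mono
          (by simp only [List.length_cons, List.length_nil]; omega) fun _ => id
        · simp only [blockPre, Instr.Safe, Instr.step, Store.setReg_reg, k0, k6,
            k22, k25, k47, k50, k51, k53, hval c (by omega), hS c (by omega), Nat.reduceEqDiff,
            if_true, if_false, true_and]
          exact ⟨by omega, by omega, by omega, by omega, by omega⟩
        · rintro ⟨⟨m57, m58, m53, m51⟩, hf''⟩
          have m54 := (hf''.reg 54 (by decide)).trans k54
          have m55 := (hf''.reg 55 (by decide)).trans k55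
          refine (Ok.seq (R := fun ρ => (
            ρ.reg 54 = Nat.findGreatest (fun c => S c ≤ x) (c + 1) ∧
            ρ.reg 55 = S (Nat.findGreatest (fun c => S c ≤ x) (c + 1))) ∧ Frame (.ite _ _ _) ω ρ)
            (Ok.ite (T := 3) (fun hne => ?_) (fun heq => ?_)).frame (T' := 2) fun ρ => ?_).mono
            le_rfl fun _ => id
          · rw [m58] at hne
            rw [Nat.findGreatest_of_not (P := fun c => S c ≤ x) (by omega)]
            refine (Ok.block ?_).mono (T := 1) (by omega) fun _ => id
            exact ⟨m54, m55⟩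
          · rw [m58] at heq
            rw [Nat.findGreatest_eq (P := fun c => S c ≤ x) (by omega)]
            refine (Ok.block ?_).mono (T := 3) le_rfl fun _ => id
            simp [blockPre, Instr.Safe, Instr.step, m53, m57]
          · rintro ⟨⟨n54, n55⟩, hf₃⟩
            refine (Ok.block ?_).mono (T := 2) le_rfl fun _ => id
            simp only [blockPre, Instr.Safe, Instr.step, Store.setReg_reg, n54, n55,
              (hf₃.reg 56 (by decide)).trans ((hf''.reg 56 (by decide)).trans k56),
              (hf₃.reg 6 (by decide)).trans ((hf''.reg 6 (by decide)).trans k6),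
              (hf₃.reg 53 (by decide)).trans m53, (hf₃.reg 51 (by decide)).trans m51,
              Nat.reduceEqDiff, if_true, if_false, true_and]
            exact ⟨c + 1, by omega, by omega, rfl, rfl, rfl, rfl⟩)
      ⟨0, by omega, g56, g53, g51, by simpa using g54, by simpa [hS0] using g55⟩
    refine hloop.mono le_rfl fun υ h => ?_
    obtain ⟨⟨c, hc, -, -, -, k54, k55⟩, -⟩ := h
    obtain rfl : c = a := by omega
    exact ⟨k54, k55⟩

/-! ### The main loop -/

/-- The found entry is appended and the block data are updated. -/
def updateProg : Program :=
  .seq (.block [.sub 25 25 55, .store 1 32 54, .sub 59 30 54])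
    (.seq (.ite 59 (.block [.copy 26 46, .copy 27 47, .copy 28 35, .copy 29 38, .copy 30 54,
      .copy 31 6]) (.block [.add 31 31 6])) (.block [.add 32 32 6, .sub 33 33 6]))

/-- One round of the main loop. -/
def decodeBody : Program := .seq closeProg (.seq lookupProg updateProg)

/-- The main loop. -/
def decodeProg : Program :=
  .seq (.block [.copy 25 0, .copy 26 6, .copy 27 6, .copy 28 2, .sub 29 3 2, .copy 30 5,
    .copy 31 8, .copy 32 8, .copy 33 4]) (.loop 33 decodeBody)

/-- The contents of the memory when the entries `pre` have been found. -/
structure DecodeInv (P : Params) (pre : List ℕ) (x : ℕ) (pre₀ : List ℕ) (a k : ℕ) (σ : Store) :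
    Prop where
  block : P.IsBlock pre pre₀ a k
  lt : x < P.prefixCount pre
  num_le : listNum P.q P.ζ pre₀ ≤ P.binomBound ^ pre₀.length
  den_le : listDen P.q P.ζ pre₀ (P.s - P.t) ≤ (P.ℓ * P.binomBound) ^ pre₀.length
  r25 : σ.reg 25 = x
  r26 : σ.reg 26 = listNum P.q P.ζ pre₀
  r27 : σ.reg 27 = listDen P.q P.ζ pre₀ (P.s - P.t)
  r28 : σ.reg 28 = P.t - pre₀.sum
  r29 : σ.reg 29 = P.s - P.t - listCap P.ζ pre₀
  r30 : σ.reg 30 = a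
  r31 : σ.reg 31 = k
  r32 : σ.reg 32 = pre.length
  r33 : σ.reg 33 = P.ℓ - pre.length
  arr : ∀ j < pre.length, σ.arr 1 j = pre.getD j 0

/-- The memory contents that the main loop uses but does not change. -/
structure DecodeEnv (P : Params) (σ : Store) : Prop where
  r1 : σ.reg 1 = P.ζ
  r4 : σ.reg 4 = P.ℓ
  r6 : σ.reg 6 = 1
  r7 : σ.reg 7 = P.μ + 1
  r8 : σ.reg 8 = 0
  r19 : σ.reg 19 = (P.ℓ !)
  r21 : σ.reg 21 = P.ℓ + 1
  r22 : σ.reg 22 = P.s + 1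
  table : σ.arr 0 = P.tableCell
  binom : ∀ j < (P.ζ + 2) * (P.μ + 1), σ.arr 3 j = pascal P.q (P.μ + 1) j

theorem DecodeEnv.frame {P : Params} {σ τ : Store} (h : DecodeEnv P σ) {c : Program}
    (hf : Frame c σ τ) (hr : ∀ r ∈ [1, 4, 6, 7, 8, 19, 21, 22], r ∉ c.regs)
    (hA : ∀ A ∈ [0, 3], A ∉ c.arrs) : DecodeEnv P τ where
  r1 := (hf.reg 1 (hr 1 (by simp))).trans h.r1
  r4 := (hf.reg 4 (hr 4 (by simp))).trans h.r4
  r6 := (hf.reg 6 (hr 6 (by simp))).trans h.r6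
  r7 := (hf.reg 7 (hr 7 (by simp))).trans h.r7
  r8 := (hf.reg 8 (hr 8 (by simp))).trans h.r8
  r19 := (hf.reg 19 (hr 19 (by simp))).trans h.r19
  r21 := (hf.reg 21 (hr 21 (by simp))).trans h.r21
  r22 := (hf.reg 22 (hr 22 (by simp))).trans h.r22
  table := (hf.arr 0 (hA 0 (by simp))).trans h.table
  binom := by rw [hf.arr 3 (hA 3 (by simp))]; exact h.binom

/-- A smaller next entry closes the block: the factors just computed for the whole prefix are saved
and a block of length one begins. An equal entry only raises `k` and keeps the saved data of `pre₀`,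
because `blockDen` must be recomputed for the longer block. -/
theorem updateProg_ok {P : Params} {W : ℕ} (hW : P.Fits W) {pre pre₀ : List ℕ} {x a k : ℕ}
    (hlen : pre.length < P.ℓ) {σ : Store} (he : DecodeEnv P σ) (h : DecodeInv P pre x pre₀ a k σ)
    (hN : listNum P.q P.ζ pre ≤ P.binomBound ^ pre.length)
    (hD : listDen P.q P.ζ pre (P.s - P.t) ≤ (P.ℓ * P.binomBound) ^ pre.length)
    (h35 : σ.reg 35 = P.t - pre.sum) (h38 : σ.reg 38 = P.s - P.t - listCap P.ζ pre)
    (h46 : σ.reg 46 = listNum P.q P.ζ pre) (h47 : σ.reg 47 = listDen P.q P.ζ pre (P.s - P.t))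
    (h54 : σ.reg 54 = P.nextEntry pre x)
    (h55 : σ.reg 55 = P.cumulCount pre (P.nextEntry pre x)) :
    Ok W updateProg σ 15 fun τ => ∃ pre₀' a' k', DecodeInv P (pre ++ [P.nextEntry pre x])
      (x - P.cumulCount pre (P.nextEntry pre x)) pre₀' a' k' τ := by
  have hle := h.block.nextEntry_le hlen h.lt
  have hlt := P.sub_cumulCount_nextEntry_lt hlen h.lt
  have hmass := hW.mass
  have hindex := hW.index_lt (A := 0) (c := 0) (x := 0) (by omega) (by omega) (by omega)
  have hklen := h.block.length
  have hℓW : P.ℓ < 2 ^ W := by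
    have h1 := hW.index_lt (A := (P.s + 1) * (P.ℓ + 1)) (c := 0) (x := 0) le_rfl (by omega)
      (by omega)
    have h2 := Nat.le_mul_of_pos_left (P.ℓ + 1) (show 0 < P.s + 1 by omega)
    omega
  generalize P.nextEntry pre x = b at *
  have hb6 := he.r6
  refine (Ok.seq (R := fun τ => (τ.reg 25 = x - P.cumulCount pre b ∧ τ.reg 59 = a - b ∧
      ∀ j < pre.length + 1, τ.arr 1 j = (pre ++ [b]).getD j 0) ∧ Frame (.block _) σ τ)
    (Ok.block ?_).frame (T' := 11) fun τ => ?_).mono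
    (by simp only [List.length_cons, List.length_nil]; omega) fun _ => id
  · simp only [blockPre, Instr.Safe, Instr.step, Store.setReg_reg, Store.setReg_arr,
      Store.setArr_arr, Store.setArr_reg, h.r25, h.r30, h.r32, h54, h55, Nat.reduceEqDiff, if_true,
      if_false, true_and]
    intro j hj
    split_ifs with hj'
    · simp [hj']
    · rw [h.arr j (by omega), List.getD_append _ _ _ _ (by omega)]
  · rintro ⟨⟨g25, g59, g1⟩, hf⟩
    have he' := he.frame hf (by decide) (by decide)
    refine (Ok.seq (R := fun υ => (∃ pre₀' a' k', P.IsBlock (pre ++ [b]) pre₀' a' k' ∧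
      listNum P.q P.ζ pre₀' ≤ P.binomBound ^ pre₀'.length ∧
      listDen P.q P.ζ pre₀' (P.s - P.t) ≤ (P.ℓ * P.binomBound) ^ pre₀'.length ∧
      υ.reg 26 = listNum P.q P.ζ pre₀' ∧ υ.reg 27 = listDen P.q P.ζ pre₀' (P.s - P.t) ∧
      υ.reg 28 = P.t - pre₀'.sum ∧ υ.reg 29 = P.s - P.t - listCap P.ζ pre₀' ∧ υ.reg 30 = a' ∧
      υ.reg 31 = k') ∧ Frame (.ite _ _ _) τ υ)
      (Ok.ite (T := 7) (fun hne => ?_) (fun heq => ?_)).frame (T' := 3) fun υ => ?_).mono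
      le_rfl fun _ => id
    · rw [g59] at hne
      refine (Ok.block ?_).mono (T := 7) le_rfl fun _ => id
      simp only [blockPre, Instr.Safe, Instr.step, Store.setReg_reg,
        (hf.reg 46 (by decide)).trans h46, (hf.reg 47 (by decide)).trans h47,
        (hf.reg 35 (by decide)).trans h35, (hf.reg 38 (by decide)).trans h38,
        (hf.reg 54 (by decide)).trans h54, he'.r6, Nat.reduceEqDiff, if_true, if_false, true_and]
      exact ⟨pre, b, 1, h.block.snoc_lt (by omega), hN, hD, rfl, rfl, rfl, rfl, rfl, rfl⟩
    · rw [g59] at heq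
      obtain rfl : b = a := by omega
      refine (Ok.block ?_).mono (T := 2) (by omega) fun _ => id
      simp only [blockPre, Instr.Safe, Instr.step, Store.setReg_reg,
        (hf.reg 26 (by decide)).trans h.r26, (hf.reg 27 (by decide)).trans h.r27,
        (hf.reg 28 (by decide)).trans h.r28, (hf.reg 29 (by decide)).trans h.r29,
        (hf.reg 30 (by decide)).trans h.r30, (hf.reg 31 (by decide)).trans h.r31,
        he'.r6, Nat.reduceEqDiff, if_true, if_false]
      exact ⟨by omega, pre₀, b, k + 1, h.block.snoc_eq, h.num_le, h.den_le, rfl, rfl, rfl, rfl,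
        rfl, rfl⟩
    · rintro ⟨⟨pre₀', a', k', m1, m2, m3, m26, m27, m28, m29, m30, m31⟩, hf'⟩
      have m25 := (hf'.reg 25 (by decide)).trans g25
      have m32 := (hf'.reg 32 (by decide)).trans ((hf.reg 32 (by decide)).trans h.r32)
      have m33 := (hf'.reg 33 (by decide)).trans ((hf.reg 33 (by decide)).trans h.r33)
      have m6 := (hf'.reg 6 (by decide)).trans he'.r6
      refine (Ok.block ?_).mono (T := 3) le_rfl fun _ => id
      simp only [blockPre, Instr.Safe, Instr.step, Store.setReg_reg, m6, m32, m33,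
        Nat.reduceEqDiff, if_false, true_and]
      refine ⟨by omega, pre₀', a', k', m1, hlt, m2, m3, ?_, ?_, ?_, ?_, ?_, ?_, ?_, ?_, ?_, ?_⟩
      · simpa using m25
      · simpa using m26
      · simpa using m27
      · simpa using m28
      · simpa using m29
      · simpa using m30
      · simpa using m31
      · simp
      · simp only [Store.setReg_reg, if_true, List.length_append, List.length_singleton]; omega
      · intro j hj
        rw [Store.setReg_arr, Store.setReg_arr, hf'.arr 1 (by decide)]
        exact g1 j (by simpa using hj)

/-- Recomputing the open block from the data of `pre₀` costs `O(ℓ)` operations and the search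
`O(μ)`, whence the budget of one round. -/
theorem decodeBody_ok {P : Params} (hP : P.Admissible) {W : ℕ} (hW : P.Fits W)
    {pre pre₀ : List ℕ} {x a k : ℕ} (hlen : pre.length < P.ℓ) {σ : Store} (he : DecodeEnv P σ)
    (h : DecodeInv P pre x pre₀ a k σ) :
    Ok W decodeBody σ (51 + P.ℓ * 11 + P.μ * 15) fun τ => ∃ pre₀' a' k',
      DecodeInv P (pre ++ [P.nextEntry pre x])
        (x - P.cumulCount pre (P.nextEntry pre x)) pre₀' a' k' τ := by
  have hklen := h.block.length
  have ha := h.block.le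
  have hk : k * 11 ≤ P.ℓ * 11 := by omega
  have hts := hP.t_le
  refine ((closeProg_ok hP hW (p := pre₀.length) ha (by omega) (by omega) h.num_le h.den_le
    he.r1 he.r6 he.r7 he.r8 h.r26 h.r27 h.r28 h.r29 h.r30 h.r31 he.binom).frame.seq
    (T' := 29 + a * 15) fun τ => ?_).mono (by omega) fun _ => id
  rintro ⟨⟨g35, g38, g46, g47, hN, hD⟩, hf⟩
  rw [← h.block.sub_listCap hP.μ_le] at g38
  rw [← h.block.listNum] at g46 hN
  rw [← h.block.listDen] at g47 hD
  rw [Nat.sub_sub, ← h.block.sum] at g35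
  rw [← hklen] at hN hD
  have he' := he.frame hf (by decide) (by decide)
  have hpos := (Nat.zero_le _).trans_lt h.lt
  have hval := fun c (hc : c < a) => hP.entry_mul_div hlen hpos (c := c) (by omega)
    fun y hy => hc.trans_le (h.block.ge y hy)
  refine ((lookupProg_ok hP hW (S := P.cumulCount pre) (by simp [Params.cumulCount]) hval ha
    hlen.le (by omega) (by omega)
    (hN.trans (Nat.pow_le_pow_right hP.binomBound_pos hlen.le))
    he'.r4 he'.r6 he'.r7 he'.r8 he'.r19 he'.r21 he'.r22 ((hf.reg 25 (by decide)).trans h.r25)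
    ((hf.reg 30 (by decide)).trans h.r30) ((hf.reg 32 (by decide)).trans h.r32) g35 g38 g46 g47
    he'.table).frame.seq (T' := 15) fun υ => ?_).mono (by omega) fun _ => id
  rintro ⟨⟨m54, m55⟩, hf'⟩
  rw [← h.block.nextEntry_eq hlen h.lt] at m54 m55
  have hreg : ∀ r ∈ [25, 26, 27, 28, 29, 30, 31, 32, 33], υ.reg r = σ.reg r := fun r hr =>
    (hf'.reg r (by revert r; decide)).trans (hf.reg r (by revert r; decide))
  have hinv : DecodeInv P pre x pre₀ a k υ := by
    refine ⟨h.block, h.lt, h.num_le, h.den_le, (hreg _ (by simp)).trans h.r25,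
      (hreg _ (by simp)).trans h.r26, (hreg _ (by simp)).trans h.r27,
      (hreg _ (by simp)).trans h.r28, (hreg _ (by simp)).trans h.r29,
      (hreg _ (by simp)).trans h.r30, (hreg _ (by simp)).trans h.r31,
      (hreg _ (by simp)).trans h.r32, (hreg _ (by simp)).trans h.r33, fun j hj => ?_⟩
    rw [hf'.arr 1 (by decide), hf.arr 1 (by decide)]
    exact h.arr j hj
  exact updateProg_ok hW hlen (he'.frame hf' (by decide) (by decide)) hinv hN hD
    ((hf'.reg 35 (by decide)).trans g35) ((hf'.reg 38 (by decide)).trans g38)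
    ((hf'.reg 46 (by decide)).trans g46) ((hf'.reg 47 (by decide)).trans g47) m54 m55

theorem iterate_decodeStep_length (P : Params) (X : ℕ) : ∀ i,
    (P.decodeStep^[i] ([], X)).1.length = i
  | 0 => rfl
  | i + 1 => by
    rw [Function.iterate_succ_apply', Params.decodeStep, List.length_append,
      iterate_decodeStep_length P X i, List.length_singleton]

theorem decodeProg_ok {P : Params} (hP : P.Admissible) {W : ℕ} (hW : P.Fits W) {X : ℕ}
    (hX : X < P.prefixCount []) {σ : Store} (he : DecodeEnv P σ) (h0 : σ.reg 0 = X)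
    (h2 : σ.reg 2 = P.t) (h3 : σ.reg 3 = P.s) (h5 : σ.reg 5 = P.μ) :
    Ok W decodeProg σ (11 + P.ℓ * (52 + P.ℓ * 11 + P.μ * 15)) fun τ =>
      ∀ j < P.ℓ, τ.arr 1 j = (P.decodeList X).getD j 0 := by
  refine (Ok.seq (R := fun τ => DecodeInv P [] X [] P.μ 0 τ ∧ Frame (.block _) σ τ)
    (Ok.block ?_).frame (T' := P.ℓ * (52 + P.ℓ * 11 + P.μ * 15) + 1) fun τ => ?_).mono
    (by simp only [List.length_cons, List.length_nil]; omega) fun _ => id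
  -- At the start the block is empty with the fictitious value `a = μ`, which makes the first search
  -- run up to `μ`.
  · simp only [blockPre, Instr.Safe, true_and]
    refine ⟨⟨by simp, by simp, le_rfl, fun _ => ⟨rfl, rfl⟩⟩, hX, by simp [listNum], by simp, ?_, ?_,
      ?_, ?_, ?_, ?_, ?_, ?_, ?_, by simp⟩ <;>
    simp [Instr.step, h0, h2, h3, h5, he.r4, he.r6, he.r8, listNum, listCap]
  · rintro ⟨g, hf⟩
    have he' := he.frame hf (by decide) (by decide)
    have hloop := Ok.loop_frame (W := W) (a := 33) (c := decodeBody)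
      (T := 51 + P.ℓ * 11 + P.μ * 15) (n := P.ℓ) (σ := τ)
      (I := fun n υ => ∃ i, i + n = P.ℓ ∧ ∃ pre₀ a k, DecodeInv P (P.decodeStep^[i] ([], X)).1
        (P.decodeStep^[i] ([], X)).2 pre₀ a k υ)
      (fun n υ ⟨i, hi, pre₀, a, k, h⟩ => by
        rw [h.r33, iterate_decodeStep_length]; omega)
      (fun n υ ⟨i, hi, pre₀, a, k, h⟩ hf' =>
        (decodeBody_ok hP hW (by rw [iterate_decodeStep_length]; omega)
          (he'.frame hf' (by decide) (by decide)) h).mono le_rfl fun ω hω =>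
            ⟨i + 1, by omega, by rw [Function.iterate_succ_apply']; exact hω⟩)
      ⟨0, by omega, [], P.μ, 0, g⟩
    refine hloop.mono (by
      rw [show 51 + P.ℓ * 11 + P.μ * 15 + 1 = 52 + P.ℓ * 11 + P.μ * 15 by ring]) fun υ hυ => ?_
    obtain ⟨⟨i, hi, pre₀, a, k, h⟩, -⟩ := hυ
    obtain rfl : i = P.ℓ := by omega
    intro j hj
    exact h.arr j (by rw [iterate_decodeStep_length]; exact hj)

/-! ### Randomized programs -/

/-- Started in `σ`, the program `c` halts for all outcomes of its random draws, after at most `B`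
bit operations, and the law of the value of `f` at the final store is `p`. -/
def HasLaw {α : Type*} (c : Program) (σ : Store) (f : Store → α) (p : PMF α) (B : ℕ) : Prop :=
  ∃ D : PMF (Store × ℕ), Runs c σ D ∧ D.map (fun r => f r.1) = p ∧ ∀ r ∈ D.support, r.2 ≤ B

theorem Ok.hasLaw {α : Type*} {W : ℕ} {c : Program} {σ : Store} {T : ℕ} {f : Store → α} {y : α}
    (h : Ok W c σ T fun τ => f τ = y) (hσ : σ.Bounded W) :
    HasLaw c σ f (PMF.pure y) (T * opCost W) := by
  obtain ⟨τ, k, h1, h2, -, h4⟩ := h hσ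
  refine ⟨_, h1, by rw [PMF.pure_map, h4], fun r hr => ?_⟩
  obtain rfl : r = (τ, k) := by simpa using hr
  exact h2

theorem Ok.hasLaw_seq {α : Type*} {W : ℕ} {c d : Program} {σ : Store} {T B : ℕ} {f : Store → α}
    {p : PMF α} {Q : Store → Prop} (h : Ok W c σ T Q) (hσ : σ.Bounded W)
    (hd : ∀ τ, τ.Bounded W → Q τ → HasLaw d τ f p B) :
    HasLaw (.seq c d) σ f p (T * opCost W + B) := by
  obtain ⟨τ, k, h1, h2, h3, h4⟩ := h hσ
  obtain ⟨D, h5, h6, h7⟩ := hd τ h3 h4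
  refine ⟨_, h1.seq_pure h5, by rw [PMF.map_comp, ← h6]; rfl, fun r hr => ?_⟩
  rw [PMF.support_map] at hr
  obtain ⟨r', hr', rfl⟩ := hr
  exact Nat.add_le_add h2 (h7 r' hr')

theorem PMF.bind_congr_support {α β : Type*} (p : PMF α) {f g : α → PMF β}
    (h : ∀ a ∈ p.support, f a = g a) : p.bind f = p.bind g := by
  ext b
  rw [PMF.bind_apply, PMF.bind_apply]
  refine tsum_congr fun a => ?_
  by_cases ha : p a = 0
  · rw [ha, zero_mul, zero_mul]
  · rw [h a ((PMF.mem_support_iff p a).2 ha)]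

/-- `Runs.seq` wants the continuation as a function of the intermediate store and cost; the drawn
number is recovered from register `d`. -/
theorem HasLaw.rand_seq {α : Type*} {W d a : ℕ} {c : Program} {σ : Store} {B N : ℕ}
    {f : Store → α} {p : ℕ → PMF α} (hσ : σ.Bounded W) (ha : σ.reg a = N) (hN : 0 < N)
    (h : ∀ x < N, HasLaw c (σ.setReg d x) f (p x) B) :
    HasLaw (.seq (.instr (.rand d a)) c) σ f ((unifBelow N).bind p) (opCost W + B) := by
  have : Nonempty (PMF (Store × ℕ)) := ⟨PMF.pure (σ, 0)⟩
  choose! E h1 h2 h3 using h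
  have hrun := Runs.seq (E := fun r => E (r.1.reg d)) (Runs.instr (.rand d a) σ) (d := c)
    fun r hr => by
      rw [PMF.support_map, Instr.eval, PMF.support_map, ha] at hr
      obtain ⟨τ, ⟨x, hx, rfl⟩, rfl⟩ := hr
      simpa using h1 x ((mem_support_unifBelow hN).1 hx)
  rw [Instr.eval, PMF.map_comp, PMF.bind_map, ha] at hrun
  refine ⟨_, hrun, ?_, fun r hr => ?_⟩
  · rw [PMF.map_bind]
    refine PMF.bind_congr_support _ fun x hx => ?_
    rw [← h2 x ((mem_support_unifBelow hN).1 hx)]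
    simp only [Function.comp_apply, Store.setReg_reg, if_true, PMF.map_comp]
    rfl
  · rw [PMF.mem_support_bind_iff] at hr
    obtain ⟨x, hx, hr⟩ := hr
    rw [Function.comp_apply, PMF.support_map] at hr
    obtain ⟨r', hr', rfl⟩ := hr
    refine Nat.add_le_add (size_le_opCost (hσ a)) ?_
    exact h3 x ((mem_support_unifBelow hN).1 hx) r' (by simpa using hr')

/-! ### The whole program -/

/-- The drawing algorithm as a program. -/
def drawProg : Program :=
  .seq pascalProg (.seq rangeProg (.seq (.instr (.rand 0 24)) (.seq decodeProg
    (.seq (.instr (.rand 60 19)) shuffleProg))))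

namespace Params

variable {P : Params}

theorem Admissible.drawRun_eq (hP : P.Admissible) : P.drawRun =
    (unifBelow (P.prefixCount [])).bind fun X => (unifBelow P.ℓ !).bind fun R =>
      PMF.pure (X, P.decode X, P.decode X ∘ shufflePerm P.ℓ R) := by
  rw [drawRun, hP.ceil_iota_mul_Q]
  congr 1
  ext1 X
  rw [← map_shufflePerm, PMF.map_comp]
  rfl

/-- The word size `W₁` serves the table of Gaussian binomials and `W₂` all the rest; a store bounded
for `W₁` is bounded for `W₂`, so the parts can be chained. -/
theorem Admissible.hasLaw_drawProg (hP : P.Admissible) {W₁ W₂ : ℕ} (hW : W₁ ≤ W₂)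
    (hW₂ : P.Fits W₂) (hS : (P.ζ + 2) * (P.μ + 1) < 2 ^ W₁) (hΓ : P.binomBound < 2 ^ W₁)
    (hin : P.input.Bounded W₁) : HasLaw drawProg P.input P.output P.drawRun
      ((7 + (P.ζ + 1) * (12 + P.μ * 11)) * opCost W₁ + ((15 + P.ℓ * 4) * opCost W₂ +
        (opCost W₂ + ((11 + P.ℓ * (52 + P.ℓ * 11 + P.μ * 15)) * opCost W₂ +
          (opCost W₂ + (4 + P.ℓ * 11) * opCost W₂))))) := by
  have hpow : 2 ^ W₁ ≤ 2 ^ W₂ := Nat.pow_le_pow_right (by omega) hW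
  refine (pascalProg_ok hP.q_ge hS hΓ (σ := P.input) rfl rfl rfl rfl fun j => rfl).frame.hasLaw_seq
    hin fun τ₁ hτ₁ => ?_
  rintro ⟨⟨a6, a7, a3⟩, hf₁⟩
  have b2 : τ₁.reg 2 = P.t := hf₁.reg 2 (by decide)
  have b3 : τ₁.reg 3 = P.s := hf₁.reg 3 (by decide)
  have b4 : τ₁.reg 4 = P.ℓ := hf₁.reg 4 (by decide)
  have b5 : τ₁.reg 5 = P.μ := hf₁.reg 5 (by decide)
  have b1 : τ₁.reg 1 = P.ζ := hf₁.reg 1 (by decide)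
  have b8 : τ₁.reg 8 = 0 := hf₁.reg 8 (by decide)
  have b0 : τ₁.arr 0 = P.tableCell := by
    rw [hf₁.arr 0 (by decide)]
    ext j
    simp [input]
  have b2' : τ₁.arr 2 = fun _ => 0 := hf₁.arr 2 (by decide)
  refine (rangeProg_ok hP hW₂ b2 b3 b4 b5 a6 a7 b0).frame.hasLaw_seq
    (fun r => (hτ₁ r).trans_le hpow) fun τ₂ hτ₂ => ?_
  rintro ⟨⟨c19, c21, c22, c24⟩, hf₂⟩
  rw [hP.drawRun_eq]
  -- The draw overwrites `q` in register `0`; the table of Gaussian binomials is already complete.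
  refine HasLaw.rand_seq hτ₂ c24 hP.prefixCount_pos fun X hX => ?_
  have henv : DecodeEnv P (τ₂.setReg 0 X) := by
    refine ⟨?_, ?_, ?_, ?_, ?_, ?_, ?_, ?_, ?_, ?_⟩
    · simpa using (hf₂.reg 1 (by decide)).trans b1
    · simpa using (hf₂.reg 4 (by decide)).trans b4
    · simpa using (hf₂.reg 6 (by decide)).trans a6
    · simpa using (hf₂.reg 7 (by decide)).trans a7
    · simpa using (hf₂.reg 8 (by decide)).trans b8
    · simpa using c19
    · simpa using c21
    · simpa using c22
    · exact (hf₂.arr 0 (by decide)).trans b0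
    · rw [Store.setReg_arr, hf₂.arr 3 (by decide)]; exact a3
  have hX2 : X < 2 ^ W₂ := hX.trans (c24 ▸ hτ₂ 24)
  refine (decodeProg_ok hP hW₂ hX henv (by simp)
    (by simpa using (hf₂.reg 2 (by decide)).trans b2)
    (by simpa using (hf₂.reg 3 (by decide)).trans b3)
    (by simpa using (hf₂.reg 5 (by decide)).trans b5)).frame.hasLaw_seq (hτ₂.setReg hX2)
    fun τ₃ hτ₃ => ?_
  rintro ⟨d1, hf₃⟩
  have henv' := henv.frame hf₃ (by decide) (by decide)
  refine HasLaw.rand_seq hτ₃ henv'.r19 (Nat.factorial_pos _) fun R hR => ?_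
  have hR2 : R < 2 ^ W₂ := hR.trans (henv'.r19 ▸ hτ₃ 19)
  have hℓW : P.ℓ < 2 ^ W₂ := henv'.r4 ▸ hτ₃ 4
  have hlist := mem_sortedLists.1 (P.decodeList_mem hX)
  have hsmall : ∀ j < P.ℓ, (P.decodeList X).getD j 0 < 2 ^ W₂ := fun j hj => by
    have hj' : j < (P.decodeList X).length := by rw [hlist.1]; exact hj
    have h1 : (P.decodeList X).getD j 0 ≤ P.μ := by
      rw [List.getD_eq_getElem _ _ hj']
      exact hlist.2.1 _ (List.getElem_mem hj')
    have h2 : P.μ + 1 < 2 ^ W₂ := henv'.r7 ▸ hτ₃ 7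
    omega
  refine ((shuffleProg_ok (fun j => (P.decodeList X).getD j 0) hℓW (σ := τ₃.setReg 60 R)
    (R := R) (by simpa using henv'.r4) (by simpa using henv'.r6) (by simpa using henv'.r8)
    (by simp) d1 hsmall (fun j => ?_)).frame.mono le_rfl fun τ₄ h => ?_).hasLaw (hτ₃.setReg hR2)
  · rw [Store.setReg_arr, hf₃.arr 2 (by decide), Store.setReg_arr, hf₂.arr 2 (by decide), b2']
    exact Nat.two_pow_pos _
  · obtain ⟨e2, hf₄⟩ := h
    rw [output]
    refine Prod.ext ?_ (Prod.ext (funext fun i => ?_) (funext fun i => ?_))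
    · exact (hf₄.reg 0 (by decide)).trans (by simpa using hf₃.reg 0 (by decide))
    · simp only
      rw [hf₄.arr 1 (by decide), hP.decode_apply]
      exact d1 i i.2
    · simp only [Function.comp_apply]
      rw [hP.decode_apply, shufflePerm_val]
      exact e2 i i.2

end Params

/-! ### The sizes of the integers -/

namespace Params

variable {P : Params}

/-- The number of bits of the integers used for the table of Gaussian binomials. -/
def smallBits (P : Params) : ℕ := 8 * (P.ζ * P.μ * P.q.size * P.ℓ.size)

/-- The number of bits of the integers used by the main loop. -/
def largeBits (P : Params) : ℕ := 64 * (P.ℓ * P.μ ^ 2 * P.ζ ^ 2 * P.q.size * P.ℓ.size)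

theorem Admissible.ζ_pos (hP : P.Admissible) : 0 < P.ζ := hP.μ_pos.trans_le hP.μ_le

theorem Admissible.size_q_pos (hP : P.Admissible) : 0 < P.q.size :=
  Nat.size_pos.2 (by have := hP.q_ge; omega)

theorem Admissible.size_ℓ_pos (hP : P.Admissible) : 0 < P.ℓ.size := Nat.size_pos.2 hP.ℓ_pos

theorem Admissible.binomBound_le (hP : P.Admissible) :
    P.binomBound ≤ 2 ^ (4 * (P.ζ * P.μ * P.q.size)) := by
  have h1 : P.q ≤ 2 ^ P.q.size := (Nat.lt_size_self P.q).le
  have h2 : (P.ζ + 1) * (P.μ + 1) ≤ (2 * P.ζ) * (2 * P.μ) :=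
    Nat.mul_le_mul (by have := hP.ζ_pos; omega) (by have := hP.μ_pos; omega)
  calc P.binomBound ≤ (2 ^ P.q.size) ^ ((P.ζ + 1) * (P.μ + 1)) := Nat.pow_le_pow_left h1 _
    _ = 2 ^ (P.q.size * ((P.ζ + 1) * (P.μ + 1))) := (pow_mul _ _ _).symm
    _ ≤ _ := Nat.pow_le_pow_right (by omega) (by
      calc P.q.size * ((P.ζ + 1) * (P.μ + 1)) ≤ P.q.size * ((2 * P.ζ) * (2 * P.μ)) :=
            Nat.mul_le_mul_left _ h2
        _ = _ := by ring)

theorem succ_le_two_pow (n : ℕ) : n + 1 ≤ 2 ^ n := Nat.lt_two_pow_self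

/-- The factor `P.ℓ.size` accommodates the inputs `ℓ` and `t ≤ s ≤ ℓ * μ`. `Store.Bounded` concerns
registers only, so the large cells of the precomputed table do not matter yet. -/
theorem Admissible.smallBits_fits (hP : P.Admissible) :
    (P.ζ + 2) * (P.μ + 1) < 2 ^ P.smallBits ∧ P.binomBound < 2 ^ P.smallBits ∧
      P.input.Bounded P.smallBits := by
  have hζ := hP.ζ_pos
  have hμ := hP.μ_pos
  have hq := hP.size_q_pos
  have hℓ := hP.size_ℓ_pos
  obtain ⟨z, hz⟩ : ∃ z, z = P.ζ * P.μ := ⟨_, rfl⟩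
  have e1 : P.ζ ≤ z := hz ▸ Nat.le_mul_of_pos_right _ hμ
  have e2 : P.μ ≤ z := hz ▸ Nat.le_mul_of_pos_left _ hζ
  have e3 : z ≤ z * P.q.size := Nat.le_mul_of_pos_right _ hq
  have e3' : P.q.size ≤ z * P.q.size := Nat.le_mul_of_pos_left _ (by omega)
  have e4 : z * P.q.size ≤ z * P.q.size * P.ℓ.size := Nat.le_mul_of_pos_right _ hℓ
  have e5 : P.ℓ.size ≤ z * P.q.size * P.ℓ.size :=
    Nat.le_mul_of_pos_left _ (Nat.mul_pos (by omega) hq)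
  have hW : P.smallBits = 8 * (z * P.q.size * P.ℓ.size) := by rw [smallBits, hz]
  have hb := hP.binomBound_le
  rw [← hz] at hb
  have hlt : ∀ {a n : ℕ}, a ≤ 2 ^ n → n < P.smallBits → a < 2 ^ P.smallBits := fun h h' =>
    h.trans_lt (Nat.pow_lt_pow_right (by omega) h')
  have hμ1 : P.μ < 2 ^ P.smallBits := hlt ((Nat.le_succ _).trans (succ_le_two_pow P.μ)) (by omega)
  have hℓ1 : P.ℓ ≤ 2 ^ P.ℓ.size := (Nat.lt_size_self P.ℓ).le
  have hs : P.s < 2 ^ P.smallBits := by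
    refine hlt (n := P.ℓ.size + P.μ) ?_ (by omega)
    rw [pow_add]
    exact hP.s_le.trans (Nat.mul_le_mul hℓ1 ((Nat.le_succ _).trans (succ_le_two_pow P.μ)))
  have hts := hP.t_le
  refine ⟨?_, hlt hb (by omega), fun r => ?_⟩
  · refine hlt (n := P.ζ + 1 + P.μ) ?_ (by omega)
    rw [pow_add]
    exact Nat.mul_le_mul (succ_le_two_pow _) (succ_le_two_pow _)
  · match r with
    | 0 => exact hlt (Nat.lt_size_self P.q).le (by omega)
    | 1 => exact hlt ((Nat.le_succ _).trans (succ_le_two_pow P.ζ)) (by omega)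
    | 2 => exact hts.trans_lt hs
    | 3 => exact hs
    | 4 => exact hlt hℓ1 (by omega)
    | 5 => exact hμ1
    | _ + 6 => exact Nat.two_pow_pos _

theorem card_sortedDecomps_le (t ℓ μ : ℕ) : (sortedDecomps t ℓ μ).card ≤ (μ + 1) ^ ℓ := by
  refine (Finset.card_filter_le _ _).trans ((Finset.card_filter_le _ _).trans ?_)
  rw [Fintype.card_piFinset]
  simp

/-- There are at most `(μ + 1) ^ ℓ` summands, and each is at most its numerator: a binomial in the
denominator is at least `1`, or `0`, when the quotient is `0` by convention. -/
theorem Admissible.tableM_le (hP : P.Admissible) {t' ℓ' μ' s' : ℕ} (hℓ : ℓ' ≤ P.ℓ)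
    (hμ : μ' ≤ P.μ) :
    tableM P.q P.ζ t' ℓ' μ' s' ≤ (((P.μ + 1) ^ P.ℓ * P.binomBound ^ P.ℓ : ℕ) : ℚ) := by
  have h1 : 1 ≤ (P.μ + 1) ^ P.ℓ * P.binomBound ^ P.ℓ :=
    Nat.mul_pos (Nat.pow_pos (by omega)) (Nat.pow_pos hP.binomBound_pos)
  rw [tableM]
  split_ifs
  · have hterm : ∀ v ∈ sortedDecomps t' ℓ' μ',
        (∏ i ∈ Finset.range (μ' + 1), ((mult v i)! : ℚ))⁻¹ *
          ∏ i, (gaussBinom P.q P.ζ (v i) : ℚ) / (gaussBinom P.q (scomp P.ζ v s' i) (v i) : ℚ) ≤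
            (P.binomBound : ℚ) ^ P.ℓ := fun v hv => by
      have hv' := (mem_decomps.1 (Finset.mem_filter.1 hv).1).1
      have h2 : ∀ i, (gaussBinom P.q P.ζ (v i) : ℚ) / (gaussBinom P.q (scomp P.ζ v s' i) (v i) : ℚ)
          ≤ P.binomBound := fun i => by
        have h3 : (gaussBinom P.q P.ζ (v i) : ℚ) ≤ P.binomBound := by
          exact_mod_cast hP.gaussBinom_le (by omega) ((hv' i).trans hμ)
        rcases Nat.eq_zero_or_pos (gaussBinom P.q (scomp P.ζ v s' i) (v i)) with h4 | h4
        · rw [h4, Nat.cast_zero, div_zero]; exact Nat.cast_nonneg _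
        · exact (div_le_self (Nat.cast_nonneg _) (by exact_mod_cast h4)).trans h3
      have h5 : ∏ i, (gaussBinom P.q P.ζ (v i) : ℚ) / (gaussBinom P.q (scomp P.ζ v s' i) (v i) : ℚ)
          ≤ (P.binomBound : ℚ) ^ ℓ' :=
        (Finset.prod_le_prod (fun i _ => by positivity) fun i _ => h2 i).trans (by simp)
      have h6 : (P.binomBound : ℚ) ^ ℓ' ≤ (P.binomBound : ℚ) ^ P.ℓ :=
        pow_le_pow_right₀ (by exact_mod_cast hP.binomBound_pos) hℓ
      have h7 : (∏ i ∈ Finset.range (μ' + 1), ((mult v i)! : ℚ))⁻¹ ≤ 1 := by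
        refine inv_le_one_of_one_le₀ ?_
        exact_mod_cast Finset.one_le_prod' fun i _ => Nat.succ_le_of_lt (Nat.factorial_pos _)
      calc _ ≤ 1 * ∏ i, (gaussBinom P.q P.ζ (v i) : ℚ) /
            (gaussBinom P.q (scomp P.ζ v s' i) (v i) : ℚ) :=
              mul_le_mul_of_nonneg_right h7 (Finset.prod_nonneg fun i _ => by positivity)
        _ ≤ _ := by rw [one_mul]; exact h5.trans h6
    refine (Finset.sum_le_card_nsmul _ _ _ hterm).trans ?_
    rw [nsmul_eq_mul, Nat.cast_mul, Nat.cast_pow P.binomBound]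
    refine mul_le_mul_of_nonneg_right ?_ (by positivity)
    have h8 := (card_sortedDecomps_le t' ℓ' μ').trans ((Nat.pow_le_pow_left
      (Nat.succ_le_succ hμ) ℓ').trans (Nat.pow_le_pow_right (by omega) hℓ))
    exact_mod_cast h8
  · exact_mod_cast h1
  · exact Nat.cast_nonneg _

theorem Admissible.tableCell_le (hP : P.Admissible) (j : ℕ) :
    P.tableCell j ≤ P.iota * ((P.μ + 1) ^ P.ℓ * P.binomBound ^ P.ℓ) := by
  rw [tableCell]
  split_ifs
  · refine Nat.floor_le_of_le ?_
    rw [Nat.cast_mul]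
    exact mul_le_mul_of_nonneg_left
      (hP.tableM_le (Nat.le_of_lt_succ (Nat.mod_lt _ (Nat.succ_pos _)))
        (Nat.le_of_lt_succ (Nat.mod_lt _ (Nat.succ_pos _)))) (Nat.cast_nonneg _)
  · exact Nat.zero_le _

theorem Admissible.iota_le (hP : P.Admissible) :
    P.iota ≤ P.ℓ ^ P.ℓ * (P.binomBound ^ ((P.μ + 1) * (P.ζ + 1))) ^ P.ℓ := by
  refine Nat.mul_le_mul (Nat.factorial_le_pow _) (Nat.pow_le_pow_left ?_ _)
  have h : ∀ t' ∈ Finset.range (P.μ + 1), ∏ s' ∈ Finset.Icc t' P.ζ, gaussBinom P.q s' t' ≤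
      P.binomBound ^ (P.ζ + 1) := fun t' ht' => by
    refine (Finset.prod_le_pow_card _ _ P.binomBound fun s' hs' => hP.gaussBinom_le
      (by have := (Finset.mem_Icc.1 hs').2; omega) (by have := Finset.mem_range.1 ht'; omega)).trans ?_
    exact Nat.pow_le_pow_right hP.binomBound_pos (by rw [Nat.card_Icc]; omega)
  refine (Finset.prod_le_pow_card _ _ _ h).trans ?_
  rw [Finset.card_range, ← pow_mul, mul_comm]

/-- The dominant contribution is `ι`, with about `(μ + 1) (ζ + 1) ℓ` factors `binomBound` of at most
`4 ζ μ P.q.size` bits each; this is where `ℓ μ² ζ²` comes from. -/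
theorem Admissible.largeBits_fits (hP : P.Admissible) : P.Fits P.largeBits := by
  have hζ := hP.ζ_pos
  have hμ := hP.μ_pos
  have hq := hP.size_q_pos
  have hg := hP.size_ℓ_pos
  have hℓ := hP.ℓ_pos
  have hμζ := hP.μ_le
  -- The nested products get the names `z`, `y`, `w`, so that all later comparisons of exponents are
  -- linear.
  obtain ⟨z, hz⟩ : ∃ z, z = P.ζ * P.μ := ⟨_, rfl⟩
  obtain ⟨y, hy⟩ : ∃ y, y = z * P.q.size := ⟨_, rfl⟩
  have e1 : P.ζ ≤ z := hz ▸ Nat.le_mul_of_pos_right _ hμ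
  have e2 : P.μ ≤ z := hz ▸ Nat.le_mul_of_pos_left _ hζ
  have e3 : z ≤ y := hy ▸ Nat.le_mul_of_pos_right _ hq
  have e4 : y ≤ z * y := Nat.le_mul_of_pos_left _ (by omega)
  have e5 : z * y ≤ z * y * P.ℓ.size := Nat.le_mul_of_pos_right _ hg
  have e6 : P.ℓ.size ≤ z * y * P.ℓ.size := Nat.le_mul_of_pos_left _ (Nat.mul_pos (by omega)
    (by omega))
  obtain ⟨w, hw⟩ : ∃ w, w = z * y * P.ℓ.size := ⟨_, rfl⟩
  rw [← hw] at e5 e6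
  have hW : P.largeBits = 64 * (P.ℓ * w) := by rw [largeBits, hw, hy, hz]; ring
  have hwpos : 0 < P.ℓ * w := Nat.mul_pos hℓ (by omega)
  have hℓw : P.ℓ ≤ P.ℓ * w := Nat.le_mul_of_pos_right _ (by omega)
  have hww : w ≤ P.ℓ * w := Nat.le_mul_of_pos_left _ hℓ
  have hmul : ∀ {a : ℕ}, a ≤ w → P.ℓ * a ≤ P.ℓ * w := fun h => Nat.mul_le_mul_left _ h
  have hlt : ∀ {a n : ℕ}, a ≤ 2 ^ n → n < P.largeBits → a < 2 ^ P.largeBits := fun h h' =>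
    h.trans_lt (Nat.pow_lt_pow_right (by omega) h')
  have hb : P.binomBound ≤ 2 ^ (4 * y) := by rw [hy, hz]; exact hP.binomBound_le
  have hℓ1 : P.ℓ ≤ 2 ^ P.ℓ.size := (Nat.lt_size_self P.ℓ).le
  have hs : P.s + 1 ≤ 2 ^ (P.ℓ * P.μ) :=
    (Nat.succ_le_succ hP.s_le).trans (succ_le_two_pow _)
  have hden : (P.ℓ * P.binomBound) ^ P.ℓ ≤ 2 ^ (P.ℓ * (P.ℓ.size + 4 * y)) := by
    rw [show P.ℓ * (P.ℓ.size + 4 * y) = (P.ℓ.size + 4 * y) * P.ℓ from mul_comm _ _, pow_mul,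
      pow_add]
    exact Nat.pow_le_pow_left (Nat.mul_le_mul hℓ1 hb) _
  have hnum : P.ℓ ! * P.binomBound ^ P.ℓ ≤ 2 ^ (P.ℓ * (P.ℓ.size + 4 * y)) := by
    refine le_trans ?_ hden
    rw [mul_pow]
    exact Nat.mul_le_mul_right _ (Nat.factorial_le_pow _)
  have hm1 := hmul (show P.μ ≤ w by omega)
  have hm2 := hmul (show P.ζ ≤ w by omega)
  have hm3 := hmul (show P.ℓ.size ≤ w by omega)
  have hm4 := hmul (show y ≤ w by omega)
  have hm5 : P.ℓ * (P.ℓ.size + 4 * y) = P.ℓ * P.ℓ.size + 4 * (P.ℓ * y) := by ring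
  refine ⟨?_, ?_, ?_, hlt hden (by omega), hlt hnum (by omega), fun j => ?_⟩
  · refine hlt (n := P.ℓ * P.μ + P.ℓ + 2 + P.μ + P.ℓ * P.μ) ?_ (by omega)
    rw [pow_add _ _ (P.ℓ * P.μ), pow_add _ _ P.μ, pow_add _ _ 2, pow_add]
    refine Nat.mul_le_mul (Nat.mul_le_mul ?_ (succ_le_two_pow _)) hs
    have h1 := Nat.mul_le_mul hs (succ_le_two_pow P.ℓ)
    have h2 : 0 < (P.s + 1) * (P.ℓ + 1) := by positivity
    omega
  · refine hlt (n := P.ζ + 1 + P.μ) ?_ (by omega)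
    rw [pow_add]
    exact Nat.mul_le_mul (succ_le_two_pow _) (succ_le_two_pow _)
  · refine hlt (n := P.ℓ * P.ζ + 2) ?_ (by omega)
    have h1 := succ_le_two_pow (P.ℓ * P.ζ)
    have h2 := Nat.mul_le_mul_left P.ℓ hμζ
    have h3 := hP.s_le
    rw [pow_add]
    omega
  · have h1 : P.iota ≤ 2 ^ (P.ℓ.size * P.ℓ + 16 * (z * y) * P.ℓ) := by
      refine hP.iota_le.trans ?_
      rw [pow_add]
      refine Nat.mul_le_mul (by rw [pow_mul]; exact Nat.pow_le_pow_left hℓ1 _) ?_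
      rw [pow_mul 2 (16 * (z * y)) P.ℓ]
      refine Nat.pow_le_pow_left ((Nat.pow_le_pow_left hb _).trans ?_) _
      rw [← pow_mul]
      refine Nat.pow_le_pow_right (by omega) ?_
      have h2 : (P.μ + 1) * (P.ζ + 1) ≤ (2 * P.μ) * (2 * P.ζ) :=
        Nat.mul_le_mul (by omega) (by omega)
      calc 4 * y * ((P.μ + 1) * (P.ζ + 1)) ≤ 4 * y * ((2 * P.μ) * (2 * P.ζ)) :=
            Nat.mul_le_mul_left _ h2
        _ = 16 * (z * y) := by rw [hz]; ring
    have h3 : (P.μ + 1) ^ P.ℓ ≤ 2 ^ (P.ℓ * P.μ) := by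
      rw [mul_comm, pow_mul]; exact Nat.pow_le_pow_left (succ_le_two_pow _) _
    have h4 : P.binomBound ^ P.ℓ ≤ 2 ^ (4 * y * P.ℓ) := by
      rw [pow_mul]; exact Nat.pow_le_pow_left hb _
    refine hlt (n := P.ℓ.size * P.ℓ + 16 * (z * y) * P.ℓ + (P.ℓ * P.μ + 4 * y * P.ℓ) +
      P.ℓ * (P.ℓ.size + 4 * y)) ?_ ?_
    · rw [pow_add _ _ (P.ℓ * (P.ℓ.size + 4 * y)), pow_add _ _ (P.ℓ * P.μ + 4 * y * P.ℓ),
        pow_add _ (P.ℓ * P.μ)]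
      exact Nat.mul_le_mul ((hP.tableCell_le j).trans
        (Nat.mul_le_mul h1 (Nat.mul_le_mul h3 h4))) hnum
    · have hm6 := hmul e5
      have hm7 : 16 * (z * y) * P.ℓ = 16 * (P.ℓ * (z * y)) := by ring
      have hm8 : 4 * y * P.ℓ = 4 * (P.ℓ * y) := by ring
      have hm9 : P.ℓ.size * P.ℓ = P.ℓ * P.ℓ.size := mul_comm _ _
      omega

theorem Admissible.smallBits_le (hP : P.Admissible) : P.smallBits ≤ P.largeBits := by
  have h1 : 0 < P.ℓ * (P.μ * P.ζ) := Nat.mul_pos hP.ℓ_pos (Nat.mul_pos hP.μ_pos hP.ζ_pos)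
  have h2 := Nat.le_mul_of_pos_left (P.ζ * P.μ * P.q.size * P.ℓ.size) h1
  have h3 : P.ℓ * (P.μ * P.ζ) * (P.ζ * P.μ * P.q.size * P.ℓ.size) =
    P.ℓ * P.μ ^ 2 * P.ζ ^ 2 * P.q.size * P.ℓ.size := by ring
  rw [smallBits, largeBits, ← h3]
  omega

/-! ### The running time -/

theorem opCost_le {W W' : ℕ} (h : 0 < W) (hW : W ≤ W') :
    opCost W ≤ 3 * W * (Nat.log 2 (2 * W') + 1) := by
  have h1 : Nat.log 2 (2 * W) + 1 ≤ Nat.log 2 (2 * W') + 1 :=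
    Nat.succ_le_succ (Nat.log_mono_right (by omega))
  have h2 := Nat.mul_le_mul_left (2 * W) h1
  have h3 : 0 < W * (Nat.log 2 (2 * W') + 1) := Nat.mul_pos h (Nat.succ_pos _)
  have h4 : 3 * W * (Nat.log 2 (2 * W') + 1) =
    W * (Nat.log 2 (2 * W') + 1) + 2 * W * (Nat.log 2 (2 * W') + 1) := by ring
  rw [opCost, quasiLinear, h4]
  omega

/-- The number of bit operations, up to a polylogarithmic factor. -/
def mainTerm (P : Params) : ℕ := P.ℓ ^ 3 * P.μ ^ 3 * P.ζ ^ 2 * P.q.size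

/-- Both parts cost a number of operations times `3 W y`, with `y` the logarithmic factor. The
constants add up to `53 * 3 * 8 + 125 * 3 * 64 = 25272`. -/
theorem Admissible.cost_le (hP : P.Admissible) :
    (7 + (P.ζ + 1) * (12 + P.μ * 11)) * opCost P.smallBits +
      ((15 + P.ℓ * 4) * opCost P.largeBits + (opCost P.largeBits +
        ((11 + P.ℓ * (52 + P.ℓ * 11 + P.μ * 15)) * opCost P.largeBits +
          (opCost P.largeBits + (4 + P.ℓ * 11) * opCost P.largeBits)))) ≤
      30000 * P.mainTerm * P.ℓ.size * (Nat.log 2 (2 * P.largeBits) + 1) := by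
  have hζ := hP.ζ_pos
  have hμ := hP.μ_pos
  have hℓ := hP.ℓ_pos
  have hs : 0 < P.smallBits := Nat.mul_pos (by omega) (Nat.mul_pos (Nat.mul_pos
    (Nat.mul_pos hζ hμ) hP.size_q_pos) hP.size_ℓ_pos)
  have hl : 0 < P.largeBits := hs.trans_le hP.smallBits_le
  have h1 := opCost_le hs hP.smallBits_le
  have h2 := opCost_le hl le_rfl
  generalize Nat.log 2 (2 * P.largeBits) + 1 = y at h1 h2
  have h3 : 7 + (P.ζ + 1) * (12 + P.μ * 11) ≤ 53 * (P.ζ * P.μ) := by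
    have a1 : (P.ζ + 1) * (12 + P.μ * 11) ≤ (2 * P.ζ) * (23 * P.μ) :=
      Nat.mul_le_mul (by omega) (by omega)
    have a2 : (2 * P.ζ) * (23 * P.μ) = 46 * (P.ζ * P.μ) := by ring
    have a3 := Nat.mul_pos hζ hμ
    omega
  have h4 : (15 + P.ℓ * 4) + 1 + (11 + P.ℓ * (52 + P.ℓ * 11 + P.μ * 15)) + 1 + (4 + P.ℓ * 11) ≤
      125 * (P.ℓ ^ 2 * P.μ) := by
    have a1 : 52 + P.ℓ * 11 + P.μ * 15 ≤ 78 * (P.ℓ * P.μ) := by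
      have b1 := Nat.le_mul_of_pos_right P.ℓ hμ
      have b2 := Nat.le_mul_of_pos_left P.μ hℓ
      omega
    have a2 := Nat.mul_le_mul_left P.ℓ a1
    have a3 : P.ℓ * (78 * (P.ℓ * P.μ)) = 78 * (P.ℓ ^ 2 * P.μ) := by ring
    have a4 : P.ℓ ≤ P.ℓ ^ 2 * P.μ := by
      rw [sq, mul_assoc]; exact Nat.le_mul_of_pos_right _ (Nat.mul_pos hℓ hμ)
    omega
  have h5 : P.ζ * P.μ * P.smallBits ≤ 8 * (P.mainTerm * P.ℓ.size) := by
    have a1 : P.ζ * P.μ * P.smallBits = 8 * (P.μ ^ 2 * P.ζ ^ 2 * P.q.size * P.ℓ.size) := by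
      rw [smallBits]; ring
    have a2 : P.mainTerm * P.ℓ.size =
        (P.ℓ ^ 3 * P.μ) * (P.μ ^ 2 * P.ζ ^ 2 * P.q.size * P.ℓ.size) := by rw [mainTerm]; ring
    have a3 := Nat.le_mul_of_pos_left (P.μ ^ 2 * P.ζ ^ 2 * P.q.size * P.ℓ.size)
      (Nat.mul_pos (Nat.pow_pos hℓ : 0 < P.ℓ ^ 3) hμ)
    omega
  have h6 : P.ℓ ^ 2 * P.μ * P.largeBits = 64 * (P.mainTerm * P.ℓ.size) := by
    rw [largeBits, mainTerm]; ring
  calc _ = (7 + (P.ζ + 1) * (12 + P.μ * 11)) * opCost P.smallBits +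
      ((15 + P.ℓ * 4) + 1 + (11 + P.ℓ * (52 + P.ℓ * 11 + P.μ * 15)) + 1 + (4 + P.ℓ * 11)) *
        opCost P.largeBits := by ring
    _ ≤ 53 * (P.ζ * P.μ) * (3 * P.smallBits * y) +
      125 * (P.ℓ ^ 2 * P.μ) * (3 * P.largeBits * y) :=
        Nat.add_le_add (Nat.mul_le_mul h3 h1) (Nat.mul_le_mul h4 h2)
    _ = 159 * (P.ζ * P.μ * P.smallBits) * y + 375 * (P.ℓ ^ 2 * P.μ * P.largeBits) * y := by ring
    _ ≤ 159 * (8 * (P.mainTerm * P.ℓ.size)) * y + 375 * (64 * (P.mainTerm * P.ℓ.size)) * y := by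
        rw [h6]
        exact Nat.add_le_add_right (Nat.mul_le_mul_right _ (Nat.mul_le_mul_left _ h5)) _
    _ ≤ _ := by
        have : 159 * (8 * (P.mainTerm * P.ℓ.size)) * y + 375 * (64 * (P.mainTerm * P.ℓ.size)) * y =
          25272 * (P.mainTerm * P.ℓ.size * y) := by ring
        have h' : 30000 * P.mainTerm * P.ℓ.size * y = 30000 * (P.mainTerm * P.ℓ.size * y) := by ring
        omega

theorem size_le_logb {x : ℕ} (hx : 0 < x) : (x.size : ℝ) ≤ Real.logb 2 x + 1 := by
  have h1 : x.size = Nat.log 2 x + 1 := by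
    have hne : x.size ≠ 0 := (Nat.size_pos.2 hx).ne'
    have h2 : Nat.log 2 x = x.size - 1 := by
      rw [Nat.log_eq_iff (Or.inr ⟨by omega, hx.ne'⟩)]
      refine ⟨Nat.lt_size.1 (by omega), ?_⟩
      rw [show x.size - 1 + 1 = x.size by omega]
      exact Nat.lt_size_self x
    omega
  have h3 := Real.natLog_le_logb x 2
  rw [h1, Nat.cast_add, Nat.cast_one]
  push_cast at h3
  linarith

/-- With `L = Real.logb 2 (f + 2)`, the estimates are `mainTerm ≤ 2 f` (from `ℓ μ ≤ n`), `P.ℓ.size ≤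
2 L`, and `11 L` for the logarithmic factor, since `2 * largeBits ≤ 256 f²`. So `1320000 = 30000 * 2
* 2 * 11`. -/
theorem Admissible.cost_le_real (hP : P.Admissible) {n : ℕ} (hn : P.ℓ * P.μ ≤ n) :
    ((30000 * P.mainTerm * P.ℓ.size * (Nat.log 2 (2 * P.largeBits) + 1) : ℕ) : ℝ) ≤
      1320000 * ((n : ℝ) ^ 3 * (P.ζ : ℝ) ^ 2 * Real.logb 2 P.q) *
        Real.logb 2 ((n : ℝ) ^ 3 * (P.ζ : ℝ) ^ 2 * Real.logb 2 P.q + 2) ^ 2 := by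
  have hℓ1 : (1 : ℝ) ≤ P.ℓ := by exact_mod_cast hP.ℓ_pos
  have hμ1 : (1 : ℝ) ≤ P.μ := by exact_mod_cast hP.μ_pos
  have hζ1 : (1 : ℝ) ≤ P.ζ := by exact_mod_cast hP.ζ_pos
  have hq2 : (2 : ℝ) ≤ P.q := by exact_mod_cast hP.q_ge
  have hlq : 1 ≤ Real.logb 2 P.q := by
    rw [Real.le_logb_iff_rpow_le (by norm_num) (by linarith)]; simpa using hq2
  have hnℓμ : (P.ℓ : ℝ) * P.μ ≤ n := by exact_mod_cast hn
  have hℓn : (P.ℓ : ℝ) ≤ n := le_trans (by nlinarith) hnℓμ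
  have hn1 : (1 : ℝ) ≤ n := hℓ1.trans hℓn
  set f : ℝ := (n : ℝ) ^ 3 * (P.ζ : ℝ) ^ 2 * Real.logb 2 P.q with hf
  have hζ2 : (1 : ℝ) ≤ (P.ζ : ℝ) ^ 2 := one_le_pow₀ hζ1
  have hn3 : (n : ℝ) ≤ (n : ℝ) ^ 3 := le_self_pow₀ hn1 (by norm_num)
  have hnf : (n : ℝ) ≤ f := by
    calc (n : ℝ) ≤ (n : ℝ) ^ 3 := hn3
      _ ≤ (n : ℝ) ^ 3 * (P.ζ : ℝ) ^ 2 := le_mul_of_one_le_right (by positivity) hζ2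
      _ ≤ f := le_mul_of_one_le_right (by positivity) hlq
  have hf1 : 1 ≤ f := hn1.trans hnf
  have hℓf : (P.ℓ : ℝ) ≤ f := hℓn.trans hnf
  have hL1 : 1 ≤ Real.logb 2 (f + 2) := by
    rw [Real.le_logb_iff_rpow_le (by norm_num) (by linarith), Real.rpow_one]; linarith
  have hlogf : Real.logb 2 f ≤ Real.logb 2 (f + 2) :=
    Real.logb_le_logb_of_le (by norm_num) (by linarith) (by linarith)
  set L : ℝ := Real.logb 2 (f + 2) with hL
  have hsize : (P.ℓ.size : ℝ) ≤ 2 * L := by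
    have h1 := size_le_logb hP.ℓ_pos
    have h2 : Real.logb 2 P.ℓ ≤ Real.logb 2 f :=
      Real.logb_le_logb_of_le (by norm_num) (by linarith) hℓf
    linarith
  have hqsize : (P.q.size : ℝ) ≤ 2 * Real.logb 2 P.q := by
    have h1 := size_le_logb (x := P.q) (by have := hP.q_ge; omega)
    linarith
  have hmain : (P.mainTerm : ℝ) ≤ 2 * f := by
    have h1 : (P.mainTerm : ℝ) = ((P.ℓ : ℝ) * P.μ) ^ 3 * (P.ζ : ℝ) ^ 2 * P.q.size := by
      rw [mainTerm]; push_cast; ring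
    have h2 : ((P.ℓ : ℝ) * P.μ) ^ 3 ≤ (n : ℝ) ^ 3 := pow_le_pow_left₀ (by positivity) hnℓμ 3
    rw [h1, hf]
    calc _ ≤ (n : ℝ) ^ 3 * (P.ζ : ℝ) ^ 2 * (2 * Real.logb 2 P.q) :=
          mul_le_mul (mul_le_mul_of_nonneg_right h2 (by positivity)) hqsize (by positivity)
            (by positivity)
      _ = _ := by ring
  have hlarge : (2 * P.largeBits : ℕ) ≤ 256 * f ^ 2 := by
    have h1 : P.ℓ * P.μ ^ 2 * P.ζ ^ 2 * P.q.size ≤ P.mainTerm := by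
      have h2 : P.mainTerm = (P.ℓ ^ 2 * P.μ) * (P.ℓ * P.μ ^ 2 * P.ζ ^ 2 * P.q.size) := by
        rw [mainTerm]; ring
      rw [h2]
      exact Nat.le_mul_of_pos_left _ (Nat.mul_pos (Nat.pow_pos hP.ℓ_pos) hP.μ_pos)
    have h3 : P.ℓ.size ≤ P.ℓ := Nat.size_le.2 Nat.lt_two_pow_self
    have h4 : 2 * P.largeBits ≤ 128 * (P.mainTerm * P.ℓ) := by
      have := Nat.mul_le_mul h1 h3
      rw [largeBits]; omega
    have h5 : ((2 * P.largeBits : ℕ) : ℝ) ≤ 128 * (P.mainTerm * P.ℓ) := by exact_mod_cast h4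
    have h6 : (P.mainTerm : ℝ) * P.ℓ ≤ 2 * f * f :=
      mul_le_mul hmain hℓf (by positivity) (by positivity)
    calc _ ≤ _ := h5
      _ ≤ 128 * (2 * f * f) := by linarith
      _ = _ := by ring
  have hlog : ((Nat.log 2 (2 * P.largeBits) + 1 : ℕ) : ℝ) ≤ 11 * L := by
    have h1 := Real.natLog_le_logb (2 * P.largeBits) 2
    have hpos : 0 < 2 * P.largeBits := by
      refine Nat.mul_pos (by omega) ((Nat.mul_pos (by omega) (Nat.mul_pos (Nat.mul_pos
        (Nat.mul_pos hP.ζ_pos hP.μ_pos) hP.size_q_pos) hP.size_ℓ_pos)).trans_le hP.smallBits_le)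
    have h2 : Real.logb 2 ((2 * P.largeBits : ℕ) : ℝ) ≤ Real.logb 2 (256 * f ^ 2) :=
      Real.logb_le_logb_of_le (by norm_num) (by exact_mod_cast hpos) hlarge
    have h3 : Real.logb 2 (256 * f ^ 2) = 8 + 2 * Real.logb 2 f := by
      rw [Real.logb_mul (by norm_num) (by positivity), Real.logb_pow]
      congr 1
      rw [show (256 : ℝ) = 2 ^ (8 : ℕ) by norm_num, Real.logb_pow, Real.logb_self_eq_one (by norm_num)]
      norm_num
    rw [Nat.cast_add, Nat.cast_one]
    have h4 : ((Nat.log 2 (2 * P.largeBits) : ℕ) : ℝ) ≤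
        Real.logb 2 ((2 * P.largeBits : ℕ) : ℝ) := by exact_mod_cast h1
    linarith
  rw [Nat.cast_mul, Nat.cast_mul, Nat.cast_mul]
  calc _ ≤ (30000 : ℝ) * (2 * f) * (2 * L) * (11 * L) := by
        refine mul_le_mul (mul_le_mul (mul_le_mul (by norm_num) hmain (by positivity)
          (by norm_num)) hsize (by positivity) (by positivity)) hlog (by positivity) (by positivity)
    _ = _ := by ring

end Params

/-! ### The main theorem -/

theorem mainTheorem9 :
    ∃ (prog : Program) (C : ℝ) (k : ℕ),
      ∀ (q n m ℓ μ ζ t s : ℕ),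
        IsPrimePow q → 0 < n → 0 < m → ℓ ∣ n → μ = min (n / ℓ) m → μ ≤ ζ →
        t ≤ s → s ≤ ℓ * μ →
        let P : Params := ⟨q, ζ, t, s, ℓ, μ⟩
        let f : ℝ := (n : ℝ) ^ 3 * (ζ : ℝ) ^ 2 * Real.logb 2 q
        (∀ v ∈ decomps t ℓ μ, ∀ w : Fin ℓ → ℕ,
            IsScompOutput ζ v s w → rho q ζ w v = rhoS q ζ s v) ∧
        (∀ v : Fin ℓ → ℕ, (P.draw v).toReal = (P.target v : ℝ)) ∧
        ∃ D : PMF (Store × ℕ),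
          Runs prog P.input D ∧
          D.map (fun r => P.output r.1) = P.drawRun ∧
          ∀ r ∈ D.support, (r.2 : ℝ) ≤ C * f * Real.logb 2 (f + 2) ^ k := by
  -- One logarithm in the exponent `2` stems from the bit length of `ℓ`, the other from quasi-linear
  -- multiplication.
  refine ⟨drawProg, 1320000, 2, ?_⟩
  intro q n m ℓ μ ζ t s hq hn hm hℓn hμ hμζ hts hs P f
  have hℓ : 0 < ℓ := Nat.pos_of_dvd_of_pos hℓn hn
  have hμpos : 0 < μ := by
    rw [hμ]
    exact lt_min (Nat.div_pos (Nat.le_of_dvd hn hℓn) hℓ) hm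
  have hP : P.Admissible :=
    ⟨hq.two_le, hℓ, hμpos, hμζ, hts, hs⟩
  have hnℓμ : ℓ * μ ≤ n := by
    have h1 : μ ≤ n / ℓ := hμ.trans_le (min_le_left _ _)
    have h2 := Nat.mul_le_mul_left ℓ h1
    rwa [Nat.mul_div_cancel' hℓn] at h2
  refine ⟨fun v hv w hw => rho_eq_rhoS hμζ hts hP.s_le' hv hw,
    fun v => hP.draw_toReal hP.prefixCount_pos v, ?_⟩
  obtain ⟨h1, h2, h3⟩ := hP.smallBits_fits
  obtain ⟨D, hD, hlaw, hcost⟩ := hP.hasLaw_drawProg hP.smallBits_le hP.largeBits_fits h1 h2 h3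
  refine ⟨D, hD, hlaw, fun r hr => ?_⟩
  exact (Nat.cast_le.2 ((hcost r hr).trans hP.cost_le)).trans (hP.cost_le_real hnℓμ)
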